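/- Let $\tau\in\mathbb{C}$ with $\operatorname{Im}\tau>0$, put $q^{\lambda}=e^{2\pi i\lambda\tau}$ for $\lambda\in\mathbb{Q}$ and $q=q^1$, so that $0<|q|<1$ (every such $q$ arises). Let $K=\mathbb{C}(\{z\})$ be the field of convergent Laurent series with the automorphism $\phi$, $\phi(z)=qz$, and for $n\ge 1$ let $K_n=\mathbb{C}(\{z^{1/n}\})\supset K$ with the extension of $\phi$ given by $\phi(z^{1/n})=q^{1/n}z^{1/n}$. A $q$-difference module over $K$ is a finite dimensional $K$-vector space $M$ with an additive bijection $\Phi:M\to M$ such that $\Phi(fm)=\phi(f)\Phi(m)$ for $f\in K$, $m\in M$; submodules are the $K$-subspaces stable under $\Phi$ and $\Phi^{-1}$, isomorphisms are the $K$-linear bijections commuting with $\Phi$, and $\Phi(m_1\otimes m_2)=\Phi(m_1)\otimes\Phi(m_2)$ on tensor products. $M$ is indecomposable if $M\neq 0$ and $M$ is not the direct sum of two proper submodules. Every $M$ is isomorphic to $K[\Phi,\Phi^{-1}]/K[\Phi,\Phi^{-1}]L$ for some $L=\Phi^d+a_{d-1}\Phi^{d-1}+\cdots+a_0$ with $a_i\in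 K$ and $a_0\neq 0$; $M$ is pure if the Newton polygon of $L$ (the lower convex hull of the points $(i,v(a_i))$ with $0\le i\le d$, $a_d=1$ and $a_i\ne 0$, where $v$ is the order at $z=0$), which depends only on $M$, has exactly one slope. For $n\ge 1$, $t\in\mathbb{Z}$ with $\gcd(t,n)=1$ and $c\in\mathbb{C}^*$ with $|q|^{1/n}<|c|\le 1$, let $E(cz^{t/n})$ be the one-dimensional difference module $K_ne$, $\Phi e=cz^{t/n}e$, over $K_n$, regarded as an $n$-dimensional difference module over $K$. For $m\ge 1$ let $U_m=K^m$ with $\Phi(Y)=A\,\phi(Y)$, where $A$ is the $m\times m$ matrix with entries $1$ on the diagonal and on the first superdiagonal and $0$ elsewhere. Theorem. For all such $t,n,c,m$ the difference module $E(cz^{t/n})\otimes_K U_m$ is indecomposable and pure, and every indecomposable pure $q$-difference module over $K$ is isomorphic to one of these modules. Moreover, if $E(cz^{t/n})\otimes_K U_m\cong E(c'z^{t'/n'})\otimes_K U_{m'}$, with both sets of data as above, then $t/n=t'/n'$, $c^n=c'^{\,n'}$ and $m=m'$. -/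

import Mathlib

open scoped TensorProduct

noncomputable section

namespace QDiff

/-! ### Convergent Laurent series -/

/-- A formal Laurent series (which has a finite principal part) is convergent if its regular part
converges absolutely at some positive radius. -/
def IsConvergent (f : LaurentSeries ℂ) : Prop :=
  ∃ ρ : ℝ, 0 < ρ ∧ Summable fun k : ℕ => ‖f.coeff (k : ℤ)‖ * ρ ^ k

/-- Convergence expressed by a geometric bound on all coefficients. -/
theorem isConvergent_iff (f : LaurentSeries ℂ) :
    IsConvergent f ↔ ∃ C r : ℝ, 0 ≤ C ∧ 0 < r ∧ ∀ k : ℤ, ‖f.coeff k‖ ≤ C * r ^ k := by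
  constructor
  · rintro ⟨ρ, hρ, hs⟩
    set S := ∑' k : ℕ, ‖f.coeff (k : ℤ)‖ * ρ ^ k with hS
    have hS0 : 0 ≤ S := tsum_nonneg fun k => by positivity
    have hb : ∀ k : ℕ, ‖f.coeff (k : ℤ)‖ * ρ ^ k ≤ S := fun k =>
      hs.le_tsum k fun j _ => by positivity
    set T := ∑ k ∈ Finset.Icc f.order 0, ‖f.coeff k‖ * ρ ^ k with hT
    have hT0 : 0 ≤ T := Finset.sum_nonneg fun k _ => by positivity
    have key : ∀ k : ℤ, ‖f.coeff k‖ * ρ ^ k ≤ S + T := by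
      intro k
      rcases le_or_gt 0 k with hk | hk
      · lift k to ℕ using hk
        have := hb k
        rw [zpow_natCast]
        linarith
      · by_cases hk' : k < f.order
        · rw [HahnSeries.coeff_eq_zero_of_lt_order hk']
          simp only [norm_zero, zero_mul]
          positivity
        · have hm : k ∈ Finset.Icc f.order 0 := Finset.mem_Icc.2 ⟨not_lt.1 hk', hk.le⟩
          have := Finset.single_le_sum (f := fun k : ℤ => ‖f.coeff k‖ * ρ ^ k)
            (fun j _ => by positivity) hm
          linarith
    refine ⟨S + T, ρ⁻¹, by positivity, by positivity, fun k => ?_⟩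
    rw [inv_zpow, ← div_eq_mul_inv, le_div_iff₀ (by positivity)]
    exact key k
  · rintro ⟨C, r, hC, hr, h⟩
    refine ⟨(2 * r)⁻¹, by positivity, ?_⟩
    refine Summable.of_nonneg_of_le (fun k => by positivity) (fun k => ?_)
      ((summable_geometric_two).mul_left C)
    have := h k
    rw [zpow_natCast] at this
    calc ‖f.coeff (k : ℤ)‖ * (2 * r)⁻¹ ^ k ≤ C * r ^ k * (2 * r)⁻¹ ^ k := by gcongr
      _ = C * (1 / 2) ^ k := by
        rw [mul_assoc, ← mul_pow]
        congr 2
        field_simp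

theorem isConvergent_single (k : ℤ) (c : ℂ) : IsConvergent (HahnSeries.single k c) := by
  rw [isConvergent_iff]
  refine ⟨‖c‖, 1, norm_nonneg _, one_pos, fun j => ?_⟩
  rw [HahnSeries.coeff_single]
  split_ifs <;> simp

theorem IsConvergent.add {f g : LaurentSeries ℂ} (hf : IsConvergent f) (hg : IsConvergent g) :
    IsConvergent (f + g) := by
  obtain ⟨ρ, hρ, hf⟩ := hf
  obtain ⟨σ, hσ, hg⟩ := hg
  refine ⟨min ρ σ, lt_min hρ hσ, ?_⟩
  refine Summable.of_nonneg_of_le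
    (fun k => mul_nonneg (norm_nonneg _) (pow_nonneg (lt_min hρ hσ).le _)) (fun k => ?_)
    (hf.add hg)
  have h1 : min ρ σ ^ k ≤ ρ ^ k := pow_le_pow_left₀ (lt_min hρ hσ).le (min_le_left _ _) k
  have h2 : min ρ σ ^ k ≤ σ ^ k := pow_le_pow_left₀ (lt_min hρ hσ).le (min_le_right _ _) k
  have h0 : 0 ≤ min ρ σ ^ k := pow_nonneg (lt_min hρ hσ).le _
  calc ‖(f + g).coeff (k : ℤ)‖ * min ρ σ ^ k
      ≤ (‖f.coeff (k : ℤ)‖ + ‖g.coeff (k : ℤ)‖) * min ρ σ ^ k := by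
        gcongr
        exact norm_add_le _ _
    _ ≤ _ := by
        rw [add_mul]
        gcongr

theorem IsConvergent.neg {f : LaurentSeries ℂ} (hf : IsConvergent f) : IsConvergent (-f) := by
  obtain ⟨ρ, hρ, hf⟩ := hf
  exact ⟨ρ, hρ, by simpa using hf⟩

theorem IsConvergent.single_mul {f : LaurentSeries ℂ} (hf : IsConvergent f) (k : ℤ) :
    IsConvergent (HahnSeries.single k 1 * f) := by
  rw [isConvergent_iff] at hf ⊢
  obtain ⟨C, r, hC, hr, h⟩ := hf
  refine ⟨C * r ^ (-k), r, by positivity, hr, fun j => ?_⟩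
  rw [HahnSeries.coeff_single_mul, one_mul, mul_assoc, ← zpow_add₀ hr.ne']
  have := h (j - k)
  rwa [sub_eq_neg_add] at this ⊢

theorem isConvergent_ofPowerSeries_iff (P : PowerSeries ℂ) :
    IsConvergent (HahnSeries.ofPowerSeries ℤ ℂ P) ↔
      ∃ C r : ℝ, 0 ≤ C ∧ 0 < r ∧ ∀ n : ℕ, ‖PowerSeries.coeff n P‖ ≤ C * r ^ n := by
  rw [isConvergent_iff]
  constructor
  · rintro ⟨C, r, hC, hr, h⟩
    refine ⟨C, r, hC, hr, fun n => ?_⟩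
    have := h n
    rwa [LaurentSeries.coeff_coe_powerSeries, zpow_natCast] at this
  · rintro ⟨C, r, hC, hr, h⟩
    refine ⟨C, r, hC, hr, fun k => ?_⟩
    rw [PowerSeries.coeff_coe]
    split_ifs with hk
    · rw [norm_zero]
      positivity
    · have := h k.natAbs
      rwa [← zpow_natCast, Int.natAbs_of_nonneg (not_lt.1 hk)] at this

theorem IsConvergent.powerSeriesPart {f : LaurentSeries ℂ} (hf : IsConvergent f) :
    IsConvergent (HahnSeries.ofPowerSeries ℤ ℂ f.powerSeriesPart) := by
  rw [LaurentSeries.ofPowerSeries_powerSeriesPart]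
  exact hf.single_mul _

theorem IsConvergent.mul {f g : LaurentSeries ℂ} (hf : IsConvergent f) (hg : IsConvergent g) :
    IsConvergent (f * g) := by
  have hP := (isConvergent_ofPowerSeries_iff _).1 hf.powerSeriesPart
  have hQ := (isConvergent_ofPowerSeries_iff _).1 hg.powerSeriesPart
  obtain ⟨C, r, hC, hr, hP⟩ := hP
  obtain ⟨D, s, hD, hs, hQ⟩ := hQ
  have key : IsConvergent
      (HahnSeries.ofPowerSeries ℤ ℂ (f.powerSeriesPart * g.powerSeriesPart)) := by
    rw [isConvergent_ofPowerSeries_iff]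
    refine ⟨C * D, 2 * max r s, by positivity, by positivity, fun n => ?_⟩
    rw [PowerSeries.coeff_mul]
    have hm : 0 < max r s := lt_max_of_lt_left hr
    calc ‖∑ p ∈ Finset.HasAntidiagonal.antidiagonal n,
            PowerSeries.coeff p.1 f.powerSeriesPart * PowerSeries.coeff p.2 g.powerSeriesPart‖
        ≤ ∑ p ∈ Finset.HasAntidiagonal.antidiagonal n, C * D * max r s ^ n := by
          refine norm_sum_le_of_le _ fun p hp => ?_
          rw [norm_mul]
          have h1 : ‖PowerSeries.coeff p.1 f.powerSeriesPart‖ ≤ C * max r s ^ p.1 :=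
            (hP _).trans (by gcongr; exact le_max_left _ _)
          have h2 : ‖PowerSeries.coeff p.2 g.powerSeriesPart‖ ≤ D * max r s ^ p.2 :=
            (hQ _).trans (by gcongr; exact le_max_right _ _)
          calc _ ≤ (C * max r s ^ p.1) * (D * max r s ^ p.2) := by gcongr
            _ = C * D * max r s ^ (p.1 + p.2) := by ring
            _ = _ := by rw [Finset.HasAntidiagonal.mem_antidiagonal.1 hp]
      _ = (n + 1) * (C * D * max r s ^ n) := by
          rw [Finset.sum_const, Finset.Nat.card_antidiagonal, nsmul_eq_mul]
          push_cast
          ring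
      _ ≤ 2 ^ n * (C * D * max r s ^ n) := by
          gcongr
          exact_mod_cast Nat.lt_two_pow_self (n := n)
      _ = C * D * (2 * max r s) ^ n := by ring
  have e : f * g = HahnSeries.single f.order 1 * (HahnSeries.single g.order 1 *
      HahnSeries.ofPowerSeries ℤ ℂ (f.powerSeriesPart * g.powerSeriesPart)) := by
    conv_lhs => rw [← LaurentSeries.single_order_mul_powerSeriesPart f,
      ← LaurentSeries.single_order_mul_powerSeriesPart g]
    rw [map_mul]
    ring
  rw [e]
  exact (key.single_mul _).single_mul _

theorem IsConvergent.inv {f : LaurentSeries ℂ} (hf : IsConvergent f) : IsConvergent f⁻¹ := by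
  rcases eq_or_ne f 0 with rfl | h0
  · simpa using hf
  obtain ⟨C, r, hC, hr, hP⟩ := (isConvergent_ofPowerSeries_iff _).1 hf.powerSeriesPart
  set P := f.powerSeriesPart with hPdef
  have hP0 : PowerSeries.constantCoeff P ≠ 0 := by
    rw [← PowerSeries.coeff_zero_eq_constantCoeff_apply, LaurentSeries.powerSeriesPart_coeff]
    simpa using HahnSeries.coeff_order_eq_zero.not.2 h0
  set d := ‖(PowerSeries.constantCoeff P)⁻¹‖ with hd
  have hd0 : 0 ≤ d := norm_nonneg _
  set s := r * (1 + d * C) with hs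
  have hs0 : 0 < s := by positivity
  have key : ∀ n : ℕ, ‖PowerSeries.coeff n P⁻¹‖ ≤ d * s ^ n := by
    intro n
    induction n using Nat.strong_induction_on with
    | _ n ih =>
      rw [PowerSeries.coeff_inv]
      split_ifs with hn
      · rw [hn, pow_zero, mul_one]
      · rw [norm_mul, norm_neg]
        refine mul_le_mul_of_nonneg_left ?_ hd0
        have hsum : ‖∑ x ∈ Finset.HasAntidiagonal.antidiagonal n, if x.2 < n then
            PowerSeries.coeff x.1 P * PowerSeries.coeff x.2 P⁻¹ else 0‖ ≤
            ∑ x ∈ Finset.HasAntidiagonal.antidiagonal n, if x.2 < n then C * r ^ x.1 * (d * s ^ x.2) else 0 := by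
          refine norm_sum_le_of_le _ fun x _ => ?_
          split_ifs with hx
          · rw [norm_mul]
            gcongr
            · exact hP _
            · exact ih _ hx
          · simp
        refine hsum.trans ?_
        rw [Finset.Nat.sum_antidiagonal_eq_sum_range_succ_mk, ← Finset.sum_range_reflect,
          Finset.sum_range_succ]
        have e1 : ∀ j ∈ Finset.range n,
            (if n - (n + 1 - 1 - j) < n then
              C * r ^ (n + 1 - 1 - j) * (d * s ^ (n - (n + 1 - 1 - j))) else 0) =
            C * d * r * (s ^ j * r ^ (n - 1 - j)) := by
          intro j hj
          have hj' := Finset.mem_range.1 hj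
          have a1 : n - (n + 1 - 1 - j) = j := by omega
          have a2 : n + 1 - 1 - j = n - 1 - j + 1 := by omega
          rw [a1, if_pos hj', a2, pow_succ]
          ring
        have e2 : ¬ (n - (n + 1 - 1 - n) < n) := by omega
        simp only [Nat.succ_eq_add_one]
        rw [Finset.sum_congr rfl e1, if_neg e2, add_zero, ← Finset.mul_sum]
        have g := Commute.geom_sum₂_mul (Commute.all s r) n
        have : C * d * r = s - r := by rw [hs]; ring
        rw [this, mul_comm, g]
        have : 0 < r ^ n := by positivity
        linarith
  have hc : IsConvergent (HahnSeries.ofPowerSeries ℤ ℂ P⁻¹) :=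
    (isConvergent_ofPowerSeries_iff _).2 ⟨d, s, hd0, hs0, key⟩
  have e : f⁻¹ = HahnSeries.single (-f.order) 1 * HahnSeries.ofPowerSeries ℤ ℂ P⁻¹ := by
    refine inv_eq_of_mul_eq_one_right ?_
    have hfP : f = HahnSeries.single f.order 1 * HahnSeries.ofPowerSeries ℤ ℂ P :=
      (LaurentSeries.single_order_mul_powerSeriesPart f).symm
    generalize f.order = k at hfP
    rw [hfP]
    calc _ = (HahnSeries.single k (1 : ℂ) * HahnSeries.single (-k) 1) *
          HahnSeries.ofPowerSeries ℤ ℂ (P * P⁻¹) := by rw [map_mul]; ring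
      _ = 1 := by
        rw [PowerSeries.mul_inv_cancel _ hP0, HahnSeries.single_mul_single]
        simp
  rw [e]
  exact hc.single_mul _

/-- The field `ℂ({z})` of convergent Laurent series, as a subfield of `ℂ((z))`. -/
def convergentLaurent : Subfield (LaurentSeries ℂ) where
  carrier := {f | IsConvergent f}
  mul_mem' := fun hf hg => hf.mul hg
  one_mem' := isConvergent_single 0 1
  add_mem' := fun hf hg => hf.add hg
  zero_mem' := by simpa using isConvergent_single 0 0
  neg_mem' := fun hf => hf.neg
  inv_mem' := fun _ hf => hf.inv

/-- The field `K = ℂ({z})`. -/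
abbrev K : Type := convergentLaurent

/-- The monomial `c z^k` in `K`. -/
def monomial (k : ℤ) (c : ℂ) : K := ⟨HahnSeries.single k c, isConvergent_single k c⟩

/-- The order at `z = 0`; the junk value at `0` is never used. -/
def ord (f : K) : ℤ := (f : LaurentSeries ℂ).order

/-! ### The dilations `z ↦ a z` -/

/-- `f(z) ↦ f(a z)` on formal Laurent series. -/
def dilateFun (a : ℂˣ) (f : LaurentSeries ℂ) : LaurentSeries ℂ where
  coeff k := (a : ℂ) ^ k * f.coeff k
  isPWO_support' := f.isPWO_support.mono fun k hk => by
    simp only [Function.mem_support] at hk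
    exact right_ne_zero_of_mul hk

theorem coeff_dilateFun (a : ℂˣ) (f : LaurentSeries ℂ) (k : ℤ) :
    (dilateFun a f).coeff k = (a : ℂ) ^ k * f.coeff k := rfl

theorem support_dilateFun_subset (a : ℂˣ) (f : LaurentSeries ℂ) :
    (dilateFun a f).support ⊆ f.support := fun k hk => by
  rw [HahnSeries.mem_support, coeff_dilateFun] at hk
  exact right_ne_zero_of_mul hk

theorem support_dilateFun (a : ℂˣ) (f : LaurentSeries ℂ) :
    (dilateFun a f).support = f.support := by
  ext k
  simp [HahnSeries.mem_support, coeff_dilateFun, zpow_ne_zero]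

theorem dilateFun_mul (a : ℂˣ) (f g : LaurentSeries ℂ) :
    dilateFun a (f * g) = dilateFun a f * dilateFun a g := by
  ext k
  rw [coeff_dilateFun, HahnSeries.coeff_mul, HahnSeries.coeff_mul, Finset.mul_sum]
  refine Finset.sum_congr ?_ fun p hp => ?_
  · ext p
    simp [support_dilateFun]
  · have := hp
    simp only [Finset.mem_antidiagonal] at this
    rw [coeff_dilateFun, coeff_dilateFun, ← this.2.2, zpow_add₀ a.ne_zero]
    ring

theorem IsConvergent.dilate {f : LaurentSeries ℂ} (hf : IsConvergent f) (a : ℂˣ) :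
    IsConvergent (dilateFun a f) := by
  rw [isConvergent_iff] at hf ⊢
  obtain ⟨C, r, hC, hr, h⟩ := hf
  refine ⟨C, ‖(a : ℂ)‖ * r, hC, mul_pos (norm_pos_iff.2 a.ne_zero) hr, fun k => ?_⟩
  rw [coeff_dilateFun, norm_mul, norm_zpow, mul_zpow]
  have := h k
  calc _ ≤ ‖(a : ℂ)‖ ^ k * (C * r ^ k) := by gcongr
    _ = _ := by ring

/-- The automorphism `f(z) ↦ f(a z)` of `K`, as a ring homomorphism. -/
def dilate (a : ℂˣ) : K →+* K where
  toFun f := ⟨dilateFun a f, f.2.dilate a⟩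
  map_one' := by
    ext k
    simp only [coeff_dilateFun, OneMemClass.coe_one, HahnSeries.coeff_one]
    split_ifs with h <;> simp [h]
  map_mul' f g := Subtype.ext (dilateFun_mul a f g)
  map_zero' := by
    ext k
    simp [coeff_dilateFun]
  map_add' f g := by
    ext k
    simp [coeff_dilateFun, mul_add]

/-- `q^x = exp (2 π i x τ)`, a nonzero complex number. -/
def qpow (τ : ℂ) (x : ℂ) : ℂˣ :=
  Units.mk0 (Complex.exp (2 * Real.pi * Complex.I * x * τ)) (Complex.exp_ne_zero _)

/-- `φ : K → K`, `φ(z) = q z` with `q = exp (2 π i τ)`. -/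
def φ (τ : ℂ) : K →+* K := dilate (qpow τ 1)

/-! ### The extension `K_n = ℂ({z^{1/n}})` -/

/-- Substitution `z ↦ w ^ n` on formal Laurent series. -/
def substPow (n : ℕ+) : LaurentSeries ℂ →+* LaurentSeries ℂ :=
  HahnSeries.embDomainRingHom (AddMonoidHom.mulLeft (n : ℤ))
    (fun a b h => mul_left_cancel₀ (by exact_mod_cast n.ne_zero) h)
    (fun a b => mul_le_mul_iff_of_pos_left (by exact_mod_cast n.pos))

theorem coeff_substPow_mul (n : ℕ+) (f : LaurentSeries ℂ) (k : ℤ) :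
    (substPow n f).coeff (n * k) = f.coeff k :=
  HahnSeries.embDomain_coeff

theorem coeff_substPow_of_not_dvd (n : ℕ+) (f : LaurentSeries ℂ) (k : ℤ) (h : ¬ (n : ℤ) ∣ k) :
    (substPow n f).coeff k = 0 := by
  refine HahnSeries.embDomain_of_notMem_range ?_
  rintro ⟨j, hj⟩
  exact h ⟨j, hj.symm⟩

theorem IsConvergent.substPow {f : LaurentSeries ℂ} (hf : IsConvergent f) (n : ℕ+) :
    IsConvergent (substPow n f) := by
  rw [isConvergent_iff] at hf ⊢
  obtain ⟨C, r, hC, hr, h⟩ := hf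
  refine ⟨C, r ^ ((n : ℝ)⁻¹), hC, by positivity, fun k => ?_⟩
  by_cases hk : (n : ℤ) ∣ k
  · obtain ⟨j, rfl⟩ := hk
    rw [coeff_substPow_mul, zpow_mul, zpow_natCast, Real.rpow_inv_natCast_pow hr.le n.ne_zero]
    exact h j
  · rw [coeff_substPow_of_not_dvd n f k hk, norm_zero]
    positivity

/-- `K_n = ℂ({w})` with `w = z^{1/n}`; it is regarded as an extension of `K = ℂ({z})`
by `z ↦ w ^ n`. -/
def Kn (_n : ℕ+) : Type := K

instance (n : ℕ+) : Field (Kn n) := inferInstanceAs (Field K)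

/-- The embedding `K → K_n`, `f(z) ↦ f(w ^ n)`. -/
def toKn (n : ℕ+) : K →+* Kn n :=
  RingHom.codRestrict ((substPow n).comp convergentLaurent.subtype) convergentLaurent
    fun f => f.2.substPow n

instance (n : ℕ+) : Algebra K (Kn n) := (toKn n).toAlgebra

/-- The monomial `c z^{k/n} = c w^k` in `K_n`. -/
def monomialKn (n : ℕ+) (k : ℤ) (c : ℂ) : Kn n := monomial k c

/-- The extension of `φ` to `K_n`: `φ(z^{1/n}) = q^{1/n} z^{1/n}`. -/
def φn (τ : ℂ) (n : ℕ+) : Kn n →+* Kn n := dilate (qpow τ ((n : ℂ)⁻¹))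

theorem φn_toKn (τ : ℂ) (n : ℕ+) (f : K) : φn τ n (toKn n f) = toKn n (φ τ f) := by
  refine Subtype.ext (HahnSeries.ext (funext fun k => ?_))
  change (dilateFun (qpow τ ((n : ℂ)⁻¹)) (substPow n f)).coeff k =
    (substPow n (dilateFun (qpow τ 1) f)).coeff k
  rw [coeff_dilateFun]
  by_cases hk : (n : ℤ) ∣ k
  · obtain ⟨j, rfl⟩ := hk
    rw [coeff_substPow_mul, coeff_substPow_mul, coeff_dilateFun, zpow_mul]
    congr 2
    have hn : (n : ℂ) ≠ 0 := by exact_mod_cast n.ne_zero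
    simp only [qpow, Units.val_mk0, zpow_natCast]
    rw [← Complex.exp_nat_mul]
    congr 1
    field_simp
  · rw [coeff_substPow_of_not_dvd n _ k hk, coeff_substPow_of_not_dvd n _ k hk, mul_zero]

/-! ### Difference modules over `K` -/

section Modules

variable {τ : ℂ} {M N : Type*} [AddCommGroup M] [Module K M] [AddCommGroup N] [Module K N]

/-- `(M, Φ)` is a `q`-difference module over `K`: `M` is a finite dimensional vector space and the
`φ`-semilinear map `Φ` is bijective. -/
structure IsDifferenceModule (Φ : M →ₛₗ[φ τ] M) : Prop where
  finite : Module.Finite K M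
  bijective : Function.Bijective Φ

/-- `(M, Φ)` and `(N, Ψ)` are isomorphic. -/
def Iso (Φ : M →ₛₗ[φ τ] M) (Ψ : N →ₛₗ[φ τ] N) : Prop :=
  ∃ e : M ≃ₗ[K] N, ∀ x, e (Φ x) = Ψ (e x)

/-- `V` is a difference submodule: stable under `Φ` and `Φ⁻¹`. -/
def IsDifferenceSubmodule (Φ : M →ₛₗ[φ τ] M) (V : Submodule K M) : Prop :=
  ∀ x, Φ x ∈ V ↔ x ∈ V

/-- `M` is nonzero and not the direct sum of two proper difference submodules. -/
def IsIndecomposable (Φ : M →ₛₗ[φ τ] M) : Prop :=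
  Nontrivial M ∧ ∀ V W : Submodule K M, IsDifferenceSubmodule Φ V → IsDifferenceSubmodule Φ W →
    IsCompl V W → V = ⊤ ∨ W = ⊤

/-- `M ≅ K[Φ, Φ⁻¹] / K[Φ, Φ⁻¹] L` for the operator `L = Φ^d + a_{d-1} Φ^{d-1} + ⋯ + a_0`,
`a_0 ≠ 0`, whose coefficients are those of the given polynomial: there is `e` (the image of `1`)
such that `e, Φ e, …, Φ^{d-1} e` is a basis of `M` and `L e = 0`. -/
def IsPresentedBy (Φ : M →ₛₗ[φ τ] M) (L : Polynomial K) : Prop :=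
  L.Monic ∧ L.coeff 0 ≠ 0 ∧ ∃ e : M,
    LinearIndependent K (fun i : Fin L.natDegree => Φ^[i] e) ∧
    Submodule.span K (Set.range fun i : Fin L.natDegree => Φ^[i] e) = ⊤ ∧
    ∑ i ∈ Finset.range (L.natDegree + 1), L.coeff i • Φ^[i] e = 0

/-- `s` is a slope of the Newton polygon of `L = ∑ a_i Φ^i`, i.e. of the lower convex hull of the
points `(i, v(a_i))`: some line supporting these points from below contains two of them. The sign is
normalized such that `Φ - c z ^ t` has slope `t`, so the line has slope `-s`. -/
def IsSlope (L : Polynomial K) (s : ℚ) : Prop :=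
  ∃ i ∈ L.support, ∃ j ∈ L.support, i < j ∧
    ord (L.coeff i) + s * i = ord (L.coeff j) + s * j ∧
    ∀ k ∈ L.support, ord (L.coeff i) + s * i ≤ ord (L.coeff k) + s * k

/-- `M` is pure: the Newton polygon of an operator `L` with `M ≅ K[Φ, Φ⁻¹] / K[Φ, Φ⁻¹] L` has
exactly one slope. (The Newton polygon does not depend on the choice of `L`.) -/
def IsPure (Φ : M →ₛₗ[φ τ] M) : Prop :=
  ∃ L : Polynomial K, IsPresentedBy Φ L ∧ ∃! s : ℚ, IsSlope L s

end Modules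

/-- The operator of `E(c z^{t/n})`: the space `K_n e` with `Φ e = c z^{t/n} e`, regarded as a vector
space over `K`. -/
def ΦE (τ : ℂ) (t : ℤ) (n : ℕ+) (c : ℂ) : Kn n →ₛₗ[φ τ] Kn n where
  toFun f := φn τ n f * monomialKn n t c
  map_add' f g := by rw [map_add, add_mul]
  map_smul' a f := by
    rw [Algebra.smul_def, Algebra.smul_def, map_mul, mul_assoc]
    congr 1
    exact φn_toKn τ n a

/-- The matrix with ones on the diagonal and on the first superdiagonal. -/
def unipotentMatrix (m : ℕ) : Matrix (Fin m) (Fin m) K :=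
  Matrix.of fun i j => if i = j ∨ (i : ℕ) + 1 = j then 1 else 0

/-- The operator `Y ↦ A φ(Y)` of the unipotent module `U_m = K^m` of length `m`. -/
def ΦU (τ : ℂ) (m : ℕ) : (Fin m → K) →ₛₗ[φ τ] (Fin m → K) where
  toFun Y := (unipotentMatrix m).mulVec fun i => φ τ (Y i)
  map_add' Y Z := by
    rw [← Matrix.mulVec_add]
    congr 1
    funext i
    exact map_add _ _ _
  map_smul' a Y := by
    rw [← Matrix.mulVec_smul]
    congr 1
    funext i
    exact map_mul _ _ _

/-- The operator `Φ ⊗ Φ` of `E(c z^{t/n}) ⊗ U_m`. -/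
def ΦEU (τ : ℂ) (t : ℤ) (n : ℕ+) (c : ℂ) (m : ℕ) :
    (Kn n ⊗[K] (Fin m → K)) →ₛₗ[φ τ] (Kn n ⊗[K] (Fin m → K)) :=
  TensorProduct.map (ΦE τ t n c) (ΦU τ m)

/-- The conditions `(t, n) = 1`, `|q|^{1/n} < |c| ≤ 1` on the data of `E(c z^{t/n})`, where
`q = exp (2 π i τ)`. They imply `c ≠ 0`. -/
def Admissible (τ : ℂ) (t : ℤ) (n : ℕ+) (c : ℂ) : Prop :=
  IsCoprime t (n : ℤ) ∧ ‖(qpow τ 1 : ℂ)‖ ^ ((n : ℝ)⁻¹) < ‖c‖ ∧ ‖c‖ ≤ 1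

end QDiff

end

/-
Let `Φ` be pure of slope `t / n` in lowest terms and consider the operator `T = z ^ (-t) Φ ^ n`,
which is semilinear for `z ↦ q ^ n z`. The Newton polygon provides a lattice that `T` maps
bijectively to itself, and since `|q ^ n| < 1`, the generalized eigenvectors of the fibre of the
lattice at `z = 0` lift to convergent generalized eigenvectors of `T`. Hence the generalized
eigenspaces `V_μ`, `μ ≠ 0`, of `T` over `ℂ` span the module over `K`. Those of eigenvalues
inequivalent modulo `q ^ (n ℤ)` are independent over `K`, while multiplication by `z` carries
`V_μ` to `V_{q ^ n μ}`.

As `T Φ = q ^ t Φ T`, the map `Φ` carries `V_λ` to `V_{q ^ t λ}`. By coprimality of `t` and `n`,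
the eigenvalues `q ^ (t i) λ` with `i < n` represent the class of `λ` modulo `q ^ ℤ`, so that a
decomposition of `V_λ` under `T` induces one of the module. If the module is indecomposable, only
one class modulo `q ^ ℤ` occurs and `T` has a single Jordan block on `V_λ`. The module then has a
basis `Φ ^ i (T - λ) ^ j v` with `i < n` and `j < m`, on which `Φ` is determined by `t`, `n`, `λ`
and `m`. The module `E(c z^{t/n}) ⊗ U_m` has such a basis with `λ = κ c ^ n`, where `κ` is a power
of `q ^ (1 / n)` that depends only on `t` and `n`.
-/

noncomputable section

namespace QDiff

/-- The coefficient of `z ^ k` in `f`. -/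
def coef (f : K) (k : ℤ) : ℂ := (f : LaurentSeries ℂ).coeff k

theorem coef_ext {f g : K} (h : ∀ k, coef f k = coef g k) : f = g :=
  Subtype.ext (HahnSeries.ext (funext h))

@[simp] theorem coef_zero (k : ℤ) : coef 0 k = 0 := rfl

@[simp] theorem coef_add (f g : K) (k : ℤ) : coef (f + g) k = coef f k + coef g k := rfl

@[simp] theorem coef_sub (f g : K) (k : ℤ) : coef (f - g) k = coef f k - coef g k := rfl

theorem coef_sum {ι : Type*} (s : Finset ι) (f : ι → K) (k : ℤ) :
    coef (∑ i ∈ s, f i) k = ∑ i ∈ s, coef (f i) k :=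
  map_sum (AddMonoidHom.mk' (coef · k) fun _ _ => rfl) f s

@[simp] theorem coef_dilate (a : ℂˣ) (f : K) (k : ℤ) :
    coef (dilate a f) k = (a : ℂ) ^ k * coef f k :=
  rfl

theorem coef_monomial (j : ℤ) (c : ℂ) (k : ℤ) : coef (monomial j c) k = if k = j then c else 0 := by
  change (HahnSeries.single j c).coeff k = _
  rw [HahnSeries.coeff_single]
  congr

theorem coef_monomial_mul (j : ℤ) (c : ℂ) (f : K) (k : ℤ) :
    coef (monomial j c * f) k = c * coef f (k - j) :=
  HahnSeries.coeff_single_mul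

theorem monomial_mul_monomial (j k : ℤ) (a b : ℂ) :
    monomial j a * monomial k b = monomial (j + k) (a * b) :=
  Subtype.ext HahnSeries.single_mul_single

theorem monomial_zero_one : monomial 0 1 = 1 := rfl

theorem monomial_ne_zero (k : ℤ) {c : ℂ} (hc : c ≠ 0) : monomial k c ≠ 0 := fun h =>
  hc (by simpa [coef_monomial] using congrArg (coef · k) h)

theorem dilate_monomial (a : ℂˣ) (k : ℤ) (c : ℂ) :
    dilate a (monomial k c) = monomial k ((a : ℂ) ^ k * c) := by
  refine coef_ext fun j => ?_
  rw [coef_dilate, coef_monomial, coef_monomial]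
  split_ifs with h <;> simp [h]

theorem dilate_dilate (a b : ℂˣ) (f : K) : dilate a (dilate b f) = dilate (a * b) f := by
  refine coef_ext fun k => ?_
  simp only [coef_dilate, Units.val_mul, mul_zpow]
  ring

theorem dilate_one (f : K) : dilate 1 f = f :=
  coef_ext fun k => by simp

theorem dilate_inv_dilate (a : ℂˣ) (f : K) : dilate a (dilate a⁻¹ f) = f := by
  rw [dilate_dilate, mul_inv_cancel, dilate_one]

/-- The inclusion of the constants `ℂ` in `K`. -/
def constHom : ℂ →+* K where
  toFun c := monomial 0 c
  map_one' := rfl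
  map_mul' a b := by rw [monomial_mul_monomial, add_zero]
  map_zero' := coef_ext fun k => by simp [coef_monomial]
  map_add' a b := coef_ext fun k => by
    rw [coef_add, coef_monomial, coef_monomial, coef_monomial]
    split_ifs <;> simp

instance : Algebra ℂ K := constHom.toAlgebra

theorem algebraMap_eq (c : ℂ) : algebraMap ℂ K c = monomial 0 c := rfl

@[simp] theorem coef_smul (c : ℂ) (f : K) (k : ℤ) : coef (c • f) k = c * coef f k := by
  rw [Algebra.smul_def, algebraMap_eq, coef_monomial_mul, sub_zero]

theorem smul_monomial (a : ℂ) (k : ℤ) (b : ℂ) : a • monomial k b = monomial k (a * b) := by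
  rw [Algebra.smul_def, algebraMap_eq, monomial_mul_monomial, zero_add]

theorem dilate_algebraMap (a : ℂˣ) (c : ℂ) : dilate a (algebraMap ℂ K c) = algebraMap ℂ K c := by
  rw [algebraMap_eq, dilate_monomial, zpow_zero, one_mul]

theorem algebraMap_coef_zero {f : K} (h : ∀ k ≠ 0, coef f k = 0) :
    algebraMap ℂ K (coef f 0) = f := by
  refine coef_ext fun k => ?_
  rw [algebraMap_eq, coef_monomial]
  split_ifs with hk
  · rw [hk]
  · exact (h k hk).symm

section NilpotentChains

variable {k E : Type*} [Field k] [AddCommGroup E] [Module k E] {N : Module.End k E} {m : ℕ} {v : E}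

-- The matrix `(ℓ (N ^ (i + j) v))` is triangular with respect to the antidiagonal.
theorem eq_zero_of_forall_apply_chain_eq_zero {ℓ : Module.Dual k E} (hv : (N ^ m) v = 0)
    (hℓ : ℓ ((N ^ (m - 1)) v) ≠ 0) {a : Fin m → k}
    (ha : ∀ i < m, ℓ ((N ^ i) (∑ j, a j • (N ^ (j : ℕ)) v)) = 0) : a = 0 := by
  suffices ∀ j (hj : j < m), a ⟨j, hj⟩ = 0 from funext fun j => this j j.2
  intro j hj
  induction j using Nat.strong_induction_on with
  | _ j ih =>
    have h := ha (m - 1 - j) (by omega)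
    rw [map_sum, map_sum, Finset.sum_eq_single ⟨j, hj⟩ _ (by simp)] at h
    · rw [map_smul, map_smul, ← Module.End.mul_apply, ← pow_add, Nat.sub_add_cancel (by omega)] at h
      exact (smul_eq_zero.1 h).resolve_right hℓ
    · intro i _ hi
      rcases lt_or_gt_of_ne (Fin.val_ne_of_ne hi) with hij | hij
      · rw [show a i = 0 from ih i hij i.2, zero_smul, map_zero, map_zero]
      · rw [map_smul, ← Module.End.mul_apply, ← pow_add,
          Module.End.pow_map_zero_of_le (by simp only at hij; omega) hv, smul_zero, map_zero]

theorem linearIndependent_chain (hv : (N ^ m) v = 0) (hne : (N ^ (m - 1)) v ≠ 0) :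
    LinearIndependent k fun j : Fin m => (N ^ (j : ℕ)) v := by
  obtain ⟨ℓ, hℓ⟩ := not_forall.1 ((Module.forall_dual_apply_eq_zero_iff k _).not.2 hne)
  refine Fintype.linearIndependent_iff.2 fun a ha => congrFun ?_
  exact eq_zero_of_forall_apply_chain_eq_zero hv hℓ fun i _ => by rw [ha, map_zero, map_zero]

theorem exists_isCompl_span_chain (hN : N ^ m = 0) (hne : (N ^ (m - 1)) v ≠ 0) :
    ∃ W : Submodule k E, (∀ x ∈ W, N x ∈ W) ∧
      IsCompl (Submodule.span k (Set.range fun j : Fin m => (N ^ (j : ℕ)) v)) W := by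
  obtain ⟨ℓ, hℓ⟩ := not_forall.1 ((Module.forall_dual_apply_eq_zero_iff k _).not.2 hne)
  let Ψ : E →ₗ[k] Fin m → k := LinearMap.pi fun i => ℓ ∘ₗ N ^ (i : ℕ)
  let S : (Fin m → k) →ₗ[k] E := Fintype.linearCombination k fun j => (N ^ (j : ℕ)) v
  have hinj : Function.Injective (Ψ ∘ₗ S) := (injective_iff_map_eq_zero _).2 fun a ha =>
    eq_zero_of_forall_apply_chain_eq_zero (by rw [hN, LinearMap.zero_apply]) hℓ fun i hi =>
      congrFun ha ⟨i, hi⟩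
  have hker : ∀ x, x ∈ LinearMap.ker Ψ ↔ ∀ i < m, ℓ ((N ^ i) x) = 0 := fun x =>
    ⟨fun h i hi => congrFun (LinearMap.mem_ker.1 h) ⟨i, hi⟩, fun h => funext fun i => h i i.2⟩
  refine ⟨LinearMap.ker Ψ, fun x hx => (hker _).2 fun i hi => ?_, ?_⟩
  · rw [← Module.End.mul_apply, ← pow_succ]
    rcases eq_or_lt_of_le (Nat.add_one_le_of_lt hi) with h | h
    · rw [h, hN, LinearMap.zero_apply, map_zero]
    · exact (hker x).1 hx _ h
  · rw [← Fintype.range_linearCombination]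
    constructor
    · rw [Submodule.disjoint_def]
      rintro _ ⟨a, rfl⟩ ha
      rw [(injective_iff_map_eq_zero _).1 hinj a ha, map_zero]
    · refine codisjoint_iff.2 (eq_top_iff.2 fun x _ => ?_)
      obtain ⟨a, ha⟩ := LinearMap.injective_iff_surjective.1 hinj (Ψ x)
      exact Submodule.mem_sup.2 ⟨S a, ⟨a, rfl⟩, x - S a,
        by rw [LinearMap.mem_ker, map_sub, ← LinearMap.comp_apply, ha, sub_self],
        add_sub_cancel _ _⟩

theorem span_chain_le_comap (hv : (N ^ m) v = 0) :
    Submodule.span k (Set.range fun j : Fin m => (N ^ (j : ℕ)) v) ≤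
      (Submodule.span k (Set.range fun j : Fin m => (N ^ (j : ℕ)) v)).comap N := by
  rw [Submodule.span_le]
  rintro _ ⟨j, rfl⟩
  rw [SetLike.mem_coe, Submodule.mem_comap, ← Module.End.mul_apply, ← pow_succ']
  rcases eq_or_lt_of_le (Nat.add_one_le_of_lt j.2) with h | h
  · rw [h, hv]
    exact Submodule.zero_mem _
  · exact Submodule.subset_span ⟨⟨j + 1, h⟩, rfl⟩

theorem exists_span_chain_eq_top [Nontrivial E] (hN : IsNilpotent N)
    (hind : ∀ U W : Submodule k E, (∀ x ∈ U, N x ∈ U) → (∀ x ∈ W, N x ∈ W) → IsCompl U W →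
      U = ⊤ ∨ W = ⊤) :
    ∃ (m : ℕ) (v : E), N ^ m = 0 ∧ (N ^ (m - 1)) v ≠ 0 ∧
      Submodule.span k (Set.range fun j : Fin m => (N ^ (j : ℕ)) v) = ⊤ := by
  obtain ⟨v, hv⟩ : ∃ v, (N ^ (nilpotencyClass N - 1)) v ≠ 0 :=
    not_forall.1 fun h => pow_pred_nilpotencyClass hN (LinearMap.ext h)
  have hN' := pow_nilpotencyClass hN
  refine ⟨_, v, hN', hv, ?_⟩
  obtain ⟨W, hW, hcompl⟩ := exists_isCompl_span_chain hN' hv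
  have hstable := span_chain_le_comap (v := v) (by rw [hN', LinearMap.zero_apply])
  refine (hind _ W hstable hW hcompl).resolve_right fun htop => hv ?_
  have h := hcompl.inf_eq_bot
  rw [htop, inf_top_eq, Submodule.span_eq_bot] at h
  exact h _ ⟨⟨nilpotencyClass N - 1, Nat.sub_one_lt (pos_nilpotencyClass_iff.2 hN).ne'⟩, rfl⟩

theorem eq_top_or_eq_top_of_codisjoint_of_chain [Module.Finite k E] (hN : IsNilpotent N)
    (hv : (N ^ (m - 1)) v ≠ 0) (hm : Module.finrank k E ≤ m) {U W : Submodule k E}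
    (hU : ∀ x ∈ U, N x ∈ U) (hW : ∀ x ∈ W, N x ∈ W) (hUW : Codisjoint U W) : U = ⊤ ∨ W = ⊤ := by
  have hNm (x : E) : (N ^ m) x = 0 := by
    obtain ⟨r, hr⟩ := hN
    rw [← LinearMap.mem_ker, Module.End.ker_pow_eq_ker_pow_finrank_of_le hm]
    exact Module.End.ker_pow_le_ker_pow_finrank N r (by simp [hr])
  have eq_top {P : Submodule k E} (hP : ∀ x ∈ P, N x ∈ P) {u : E} (hu : u ∈ P)
      (hne : (N ^ (m - 1)) u ≠ 0) : P = ⊤ := by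
    have hle : Submodule.span k (Set.range fun j : Fin m => (N ^ (j : ℕ)) u) ≤ P := by
      rw [Submodule.span_le]
      rintro _ ⟨j, rfl⟩
      exact Module.End.pow_apply_mem_of_forall_mem (p := P) j hP u hu
    refine Submodule.eq_top_of_finrank_eq (le_antisymm P.finrank_le (hm.trans ?_))
    simpa [finrank_span_eq_card (linearIndependent_chain (hNm u) hne)] using
      Submodule.finrank_mono hle
  obtain ⟨u, hu, w, hw, rfl⟩ := Submodule.mem_sup.1 (hUW.eq_top ▸ Submodule.mem_top : v ∈ U ⊔ W)
  by_cases h : (N ^ (m - 1)) u = 0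
  · rw [map_add, h, zero_add] at hv
    exact Or.inr (eq_top hW hw hv)
  · exact Or.inl (eq_top hU hu h)

end NilpotentChains

theorem linearIndependent_of_mem_span {k L M ι κ : Type*} [Field k] [Field L] [Algebra k L]
    [AddCommGroup M] [Module k M] [Module L M] [IsScalarTower k L M] [Finite κ] {b : κ → M}
    {w : ι → M} (hb : LinearIndependent L b) (hw : LinearIndependent k w)
    (hwb : ∀ i, w i ∈ Submodule.span k (Set.range b)) : LinearIndependent L w := by
  have := Fintype.ofFinite κ
  choose A hA using fun i => (Submodule.mem_span_range_iff_exists_fun k).1 (hwb i)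
  have hAw : LinearIndependent k A :=
    LinearIndependent.of_comp (Fintype.linearCombination k b) (by simpa [Function.comp_def,
      Fintype.linearCombination_apply, hA] using hw)
  have h := ((linearIndependent_algebraMap_comp_iff (S := L)).2 hAw).map'
    (Fintype.linearCombination L b) (LinearMap.ker_eq_bot.2 hb.fintypeLinearCombination_injective)
  rwa [show Fintype.linearCombination L b ∘ (fun i => algebraMap k L ∘ A i) = w from
    funext fun i => by simp [Fintype.linearCombination_apply, hA]] at h

/-- The sum of the generalized eigenspaces of `T` for the eigenvalues in `S`. -/
def genSum {M : Type*} [AddCommGroup M] [Module ℂ M] (T : Module.End ℂ M) (S : Set ℂ) :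
    Submodule ℂ M :=
  ⨆ μ : S, T.maxGenEigenspace μ

theorem maxGenEigenspace_le_genSum {M : Type*} [AddCommGroup M] [Module ℂ M] (T : Module.End ℂ M)
    {S : Set ℂ} {μ : ℂ} (hμ : μ ∈ S) : T.maxGenEigenspace μ ≤ genSum T S :=
  le_iSup (fun μ : S => T.maxGenEigenspace μ) ⟨μ, hμ⟩

theorem mem_of_eigenvector_mem_genSum {M : Type*} [AddCommGroup M] [Module ℂ M]
    {T : Module.End ℂ M} {S : Set ℂ} {μ : ℂ} {u : M} (hu : u ∈ genSum T S) (h0 : u ≠ 0)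
    (h : T u = μ • u) : μ ∈ S := by
  by_contra hμ
  refine h0 (Submodule.disjoint_def.1 (T.independent_maxGenEigenspace μ) u ?_ ?_)
  · exact (Module.End.mem_maxGenEigenspace _ _ _).2 ⟨1, by simp [h]⟩
  · refine (iSup_le fun ν => ?_ : genSum T S ≤ _) hu
    exact le_iSup₂ (f := fun ν (_ : ν ≠ μ) => T.maxGenEigenspace ν) (ν : ℂ)
      fun h => hμ (h ▸ ν.2)

/-- `T` is semilinear with respect to the dilation `z ↦ p z` of `K`. Such operators are bundled as
`ℂ`-linear endomorphisms, since it is their spectral theory over `ℂ` that matters. -/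
def IsDilationSemilinear {M : Type*} [AddCommGroup M] [Module K M] [Module ℂ M] (p : ℂˣ)
    (T : Module.End ℂ M) : Prop :=
  ∀ (f : K) (x : M), T (f • x) = dilate p f • T x

/-- No two different elements of `S` differ by a power of `p`, nor does `p ^ k` with `k ≠ 0` fix an
element of `S`; in particular `0 ∉ S`. -/
def IsInequivalent (p : ℂˣ) (S : Set ℂ) : Prop :=
  ∀ (μ : ℂ) (k : ℤ), μ ∈ S → (p : ℂ) ^ k * μ ∈ S → k = 0

section Independence

variable {M : Type*} [AddCommGroup M] [Module K M] [Module ℂ M] [IsScalarTower ℂ K M]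
  {p : ℂˣ} {T : Module.End ℂ M} {S : Set ℂ}

theorem IsDilationSemilinear.exists_apply_sum_eq {ι : Type*} [Fintype ι] {b : ι → M}
    (hT : IsDilationSemilinear p T) (hTb : ∀ i, T (b i) ∈ Submodule.span ℂ (Set.range b))
    (f : ι → K) : ∃ g : ι → K, T (∑ i, f i • b i) = ∑ i, g i • b i ∧
      ∀ k, ∑ i, coef (g i) k • b i = (p : ℂ) ^ k • T (∑ i, coef (f i) k • b i) := by
  choose A hA using fun i => (Submodule.mem_span_range_iff_exists_fun ℂ).1 (hTb i)
  refine ⟨fun i => ∑ j, A j i • dilate p (f j), ?_, fun k => ?_⟩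
  · simp only [map_sum, hT _ _, ← hA, Finset.sum_smul, Finset.smul_sum]
    rw [Finset.sum_comm]
    exact Finset.sum_congr rfl fun i _ => Finset.sum_congr rfl fun j _ => by
      rw [smul_assoc, smul_comm]
  · simp only [map_sum, map_smul, ← hA, Finset.smul_sum, coef_sum, coef_smul, coef_dilate,
      Finset.sum_smul, smul_smul]
    rw [Finset.sum_comm]
    exact Finset.sum_congr rfl fun i _ => Finset.sum_congr rfl fun j _ => by
      congr 1
      ring

theorem IsDilationSemilinear.notMem_span_of_eigenvector_modulo {ι : Type*} [Finite ι] {b : ι → M}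
    (hT : IsDilationSemilinear p T) (hb : LinearIndependent K b)
    (hTb : ∀ i, T (b i) ∈ Submodule.span ℂ (Set.range b)) {v : M} {μ : ℂ}
    (hv : (T - μ • 1) v ∈ Submodule.span ℂ (Set.range b))
    (hvb : v ∉ Submodule.span ℂ (Set.range b))
    (H : ∀ k : ℤ, k ≠ 0 → ∀ u ∈ Submodule.span ℂ (Set.range b), T u = ((p : ℂ) ^ k * μ) • u →
      u = 0) : v ∉ Submodule.span K (Set.range b) := by
  intro hvK
  have := Fintype.ofFinite ι
  obtain ⟨f, rfl⟩ := (Submodule.mem_span_range_iff_exists_fun K).1 hvK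
  obtain ⟨a, ha⟩ := (Submodule.mem_span_range_iff_exists_fun ℂ).1 hv
  obtain ⟨g, hTf, hg⟩ := hT.exists_apply_sum_eq hTb f
  have hgf : ∀ i, g i - μ • f i - algebraMap ℂ K (a i) = 0 := by
    refine Fintype.linearIndependent_iff.1 hb _ ?_
    simp only [sub_smul, Finset.sum_sub_distrib, algebraMap_smul, smul_assoc]
    rw [ha, ← hTf, ← Finset.smul_sum, LinearMap.sub_apply, LinearMap.smul_apply,
      Module.End.one_apply, sub_self]
  have hconst : ∀ k : ℤ, k ≠ 0 → ∑ i, coef (f i) k • b i = 0 := by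
    refine fun k hk => H (-k) (neg_ne_zero.2 hk) _ (Submodule.sum_mem _ fun i _ =>
      Submodule.smul_mem _ _ (Submodule.subset_span ⟨i, rfl⟩)) ?_
    have hgk : ∀ i, coef (g i) k = μ * coef (f i) k := fun i => by
      simpa [algebraMap_eq, coef_monomial, hk, sub_eq_zero] using congrArg (coef · k) (hgf i)
    have h := hg k
    simp only [hgk, mul_smul, ← Finset.smul_sum] at h
    rw [mul_smul, h, smul_smul, ← zpow_add₀ p.ne_zero, neg_add_cancel, zpow_zero, one_smul]
  refine hvb (Submodule.sum_mem _ fun i _ => ?_)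
  rw [← algebraMap_coef_zero fun k hk => Fintype.linearIndependent_iff.1
    (hb.restrict_scalars' ℂ) _ (hconst k hk) i, algebraMap_smul]
  exact Submodule.smul_mem _ _ (Submodule.subset_span ⟨i, rfl⟩)

/-- A finite `K`-linearly independent set in the sum of the generalized eigenspaces of `T` for the
eigenvalues in `S` whose span over the constants is stable under `T`. -/
structure IsFrame (T : Module.End ℂ M) (S : Set ℂ) (s : Set M) : Prop where
  finite : s.Finite
  linearIndepOn : LinearIndepOn K id s
  map_mem : ∀ x ∈ s, T x ∈ Submodule.span ℂ s
  mem_genSum : ∀ x ∈ s, x ∈ genSum T S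

theorem IsFrame.exists_insert (hT : IsDilationSemilinear p T) (hS : IsInequivalent p S) {s : Set M}
    (hs : IsFrame T S s) {μ : ℂ} (hμ : μ ∈ S) {v : M} (hvS : v ∈ genSum T S)
    (hv : (T - μ • 1) v ∈ Submodule.span ℂ s) :
    ∃ s', IsFrame T S s' ∧ s ⊆ s' ∧ v ∈ Submodule.span ℂ s' := by
  by_cases hvs : v ∈ Submodule.span ℂ s
  · exact ⟨s, hs, subset_rfl, hvs⟩
  have := hs.finite.fintype
  have hvK : v ∉ Submodule.span K s := by
    have h := hT.notMem_span_of_eigenvector_modulo (b := ((↑) : s → M)) (v := v) (μ := μ)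
      hs.linearIndepOn
    rw [Subtype.range_coe] at h
    refine h (fun i => hs.map_mem i i.2) hv hvs fun k hk u hu hTu => ?_
    by_contra hu0
    exact hk (hS μ k hμ (mem_of_eigenvector_mem_genSum
      (Submodule.span_le.2 hs.mem_genSum hu) hu0 hTu))
  have hle : Submodule.span ℂ s ≤ Submodule.span ℂ (insert v s) :=
    Submodule.span_mono (Set.subset_insert v s)
  have hmem : v ∈ Submodule.span ℂ (insert v s) := Submodule.subset_span (Set.mem_insert v s)
  refine ⟨insert v s, ⟨hs.finite.insert v, ?_, ?_, ?_⟩, Set.subset_insert v s, hmem⟩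
  · exact hs.linearIndepOn.id_insert hvK
  · rintro x (rfl | hx)
    · rw [← sub_add_cancel (T x) (μ • x)]
      exact Submodule.add_mem _ (hle hv) (Submodule.smul_mem _ _ hmem)
    · exact hle (hs.map_mem x hx)
  · rintro x (rfl | hx)
    exacts [hvS, hs.mem_genSum x hx]

theorem IsFrame.exists_of_pow_apply_eq_zero (hT : IsDilationSemilinear p T)
    (hS : IsInequivalent p S) {s : Set M} (hs : IsFrame T S s) {μ : ℂ} (hμ : μ ∈ S) {v : M} {n : ℕ}
    (hv : ((T - μ • 1) ^ n) v = 0) : ∃ s', IsFrame T S s' ∧ s ⊆ s' ∧ v ∈ Submodule.span ℂ s' := by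
  induction n generalizing v with
  | zero => exact ⟨s, hs, subset_rfl, (show v = 0 from hv) ▸ Submodule.zero_mem _⟩
  | succ n ih =>
    obtain ⟨s₁, hs₁, hss₁, hmem⟩ := ih (v := (T - μ • 1) v) hv
    obtain ⟨s₂, hs₂, hss₂, hmem'⟩ := hs₁.exists_insert hT hS hμ (maxGenEigenspace_le_genSum T hμ
      ((Module.End.mem_maxGenEigenspace _ _ _).2 ⟨n + 1, hv⟩)) hmem
    exact ⟨s₂, hs₂, hss₁.trans hss₂, hmem'⟩

theorem IsFrame.exists_of_mem_genSum (hT : IsDilationSemilinear p T) (hS : IsInequivalent p S)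
    {s : Set M} (hs : IsFrame T S s) {v : M} (hv : v ∈ genSum T S) :
    ∃ s', IsFrame T S s' ∧ s ⊆ s' ∧ v ∈ Submodule.span ℂ s' := by
  unfold genSum at hv
  induction hv using Submodule.iSup_induction' generalizing s with
  | mem μ x hx =>
    obtain ⟨n, hn⟩ := (Module.End.mem_maxGenEigenspace _ _ _).1 hx
    exact hs.exists_of_pow_apply_eq_zero hT hS μ.2 hn
  | zero => exact ⟨s, hs, subset_rfl, Submodule.zero_mem _⟩
  | add x y _ _ hx hy =>
    obtain ⟨s₁, hs₁, hss₁, hx₁⟩ := hx hs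
    obtain ⟨s₂, hs₂, hss₂, hy₂⟩ := hy hs₁
    exact ⟨s₂, hs₂, hss₁.trans hss₂, Submodule.add_mem _ (Submodule.span_mono hss₂ hx₁) hy₂⟩

theorem exists_isFrame_of_finset (hT : IsDilationSemilinear p T) (hS : IsInequivalent p S)
    {ι : Type*} (w : ι → M) (hw : ∀ i, w i ∈ genSum T S) (t : Finset ι) :
    ∃ s, IsFrame T S s ∧ ∀ i ∈ t, w i ∈ Submodule.span ℂ s := by
  classical
  induction t using Finset.induction_on with
  | empty => exact ⟨∅, ⟨Set.finite_empty, linearIndepOn_empty K id, by simp, by simp⟩, by simp⟩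
  | insert i t _ ih =>
    obtain ⟨s, hs, hmem⟩ := ih
    obtain ⟨s', hs', hss', hi⟩ := hs.exists_of_mem_genSum hT hS (hw i)
    refine ⟨s', hs', fun j hj => ?_⟩
    rcases Finset.mem_insert.1 hj with rfl | hj
    exacts [hi, Submodule.span_mono hss' (hmem j hj)]

theorem IsDilationSemilinear.linearIndependent_of_mem_genSum (hT : IsDilationSemilinear p T)
    (hS : IsInequivalent p S) {ι : Type*} {w : ι → M} (hw : LinearIndependent ℂ w)
    (hwS : ∀ i, w i ∈ genSum T S) : LinearIndependent K w := by
  refine linearIndependent_iff_finset_linearIndependent.2 fun t => ?_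
  obtain ⟨s, hs, hmem⟩ := exists_isFrame_of_finset hT hS w hwS t
  have := hs.finite.fintype
  refine linearIndependent_of_mem_span hs.linearIndepOn (hw.comp _ Subtype.val_injective)
    fun i => ?_
  simpa using hmem i i.2

theorem IsDilationSemilinear.disjoint_span (hT : IsDilationSemilinear p T)
    (hS : IsInequivalent p S) {U W : Submodule ℂ M} (hU : U ≤ genSum T S) (hW : W ≤ genSum T S)
    (h : Disjoint U W) :
    Disjoint (Submodule.span K (U : Set M)) (Submodule.span K (W : Set M)) := by
  obtain ⟨s, -, rfl, hs⟩ := U.span_eq ▸ exists_linearIndependent ℂ (U : Set M)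
  obtain ⟨t, -, rfl, ht⟩ := W.span_eq ▸ exists_linearIndependent ℂ (W : Set M)
  have hst : LinearIndependent ℂ (Sum.elim ((↑) : s → M) ((↑) : t → M)) :=
    hs.sum_type ht (by rwa [Subtype.range_coe, Subtype.range_coe])
  have hstK := hT.linearIndependent_of_mem_genSum hS hst (by
    rintro (i | i)
    exacts [hU (Submodule.subset_span i.2), hW (Submodule.subset_span i.2)])
  simpa [Submodule.span_span_of_tower] using (linearIndependent_sum.1 hstK).2.2

/-- The `K`-span of the generalized eigenspace of `T` for the eigenvalue `μ`. -/
def eigenspan (T : Module.End ℂ M) (μ : ℂ) : Submodule K M :=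
  Submodule.span K (T.maxGenEigenspace μ : Set M)

theorem IsDilationSemilinear.iSupIndep_eigenspan (hT : IsDilationSemilinear p T)
    (hp : ¬ IsOfFinOrder p) :
    iSupIndep fun c : ℂˣ ⧸ Subgroup.zpowers p => eigenspan T (c.out : ℂ) := by
  have hS : IsInequivalent p
      (Set.range fun c : ℂˣ ⧸ Subgroup.zpowers p => (c.out : ℂ)) := by
    rintro _ k ⟨c, rfl⟩ ⟨d, hd⟩
    have hd' : d.out = p ^ k * c.out := Units.ext (by simpa using hd)
    have hdc : d = c := by
      rw [← QuotientGroup.out_eq' d, ← QuotientGroup.out_eq' c, hd', mul_comm]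
      exact QuotientGroup.mk_mul_of_mem _ (Subgroup.zpow_mem_zpowers p k)
    rw [hdc, eq_comm, mul_eq_right] at hd'
    by_contra hk
    exact hp (isOfFinOrder_iff_zpow_eq_one.2 ⟨k, hk, hd'⟩)
  intro c
  have h := hT.disjoint_span hS (maxGenEigenspace_le_genSum T ⟨c, rfl⟩)
    (W := ⨆ (d) (_ : d ≠ c), T.maxGenEigenspace d.out)
    (iSup₂_le fun d _ => maxGenEigenspace_le_genSum T ⟨d, rfl⟩)
    ((T.independent_maxGenEigenspace c.out).mono_right (iSup₂_le fun d hd =>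
      le_iSup₂ (f := fun ν (_ : ν ≠ (c.out : ℂ)) => T.maxGenEigenspace ν) (d.out : ℂ)
        fun h => hd (Quotient.out_injective (Units.ext h))))
  refine h.mono_right (iSup₂_le fun d hd => Submodule.span_mono ?_)
  exact le_iSup₂ (f := fun d (_ : d ≠ c) => T.maxGenEigenspace (d.out : ℂ)) d hd

end Independence

theorem exists_powerSeries {f : K} {a : ℤ} (hf : ∀ k < a, coef f k = 0) :
    ∃ P : PowerSeries ℂ, (∀ l : ℕ, PowerSeries.coeff l P = coef f (a + l)) ∧
      (f : LaurentSeries ℂ) = HahnSeries.single a 1 * HahnSeries.ofPowerSeries ℤ ℂ P := by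
  refine ⟨PowerSeries.mk fun l => coef f (a + l), fun l => PowerSeries.coeff_mk _ _, ?_⟩
  ext k
  rw [HahnSeries.coeff_single_mul, one_mul, PowerSeries.coeff_coe]
  split_ifs with h
  · exact hf k (by lia)
  · rw [PowerSeries.coeff_mk, Int.natAbs_of_nonneg (not_lt.1 h), add_sub_cancel]
    rfl

theorem exists_powerSeries_mul {f g : K} {a b : ℤ} (hf : ∀ k < a, coef f k = 0)
    (hg : ∀ k < b, coef g k = 0) :
    ∃ P Q : PowerSeries ℂ, (∀ l : ℕ, PowerSeries.coeff l P = coef f (a + l)) ∧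
      (∀ l : ℕ, PowerSeries.coeff l Q = coef g (b + l)) ∧
      ((f * g : K) : LaurentSeries ℂ) =
        HahnSeries.single (a + b) 1 * HahnSeries.ofPowerSeries ℤ ℂ (P * Q) := by
  obtain ⟨P, hPf, hP⟩ := exists_powerSeries hf
  obtain ⟨Q, hQg, hQ⟩ := exists_powerSeries hg
  refine ⟨P, Q, hPf, hQg, ?_⟩
  rw [Subfield.coe_mul, hP, hQ, map_mul, ← one_mul (1 : ℂ), ← HahnSeries.single_mul_single, one_mul]
  ring

theorem coef_mul_of_lt {f g : K} {a b : ℤ} (hf : ∀ k < a, coef f k = 0)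
    (hg : ∀ k < b, coef g k = 0) {k : ℤ} (hk : k < a + b) : coef (f * g) k = 0 := by
  obtain ⟨P, Q, -, -, h⟩ := exists_powerSeries_mul hf hg
  rw [coef, h, HahnSeries.coeff_single_mul, PowerSeries.coeff_coe, if_pos (by lia), mul_zero]

theorem coef_mul {f g : K} {a b : ℤ} (hf : ∀ k < a, coef f k = 0)
    (hg : ∀ k < b, coef g k = 0) (k : ℕ) :
    coef (f * g) (a + b + k) =
      ∑ l ∈ Finset.range (k + 1), coef f (a + ((k - l : ℕ) : ℤ)) * coef g (b + l) := by
  obtain ⟨P, Q, hP, hQ, h⟩ := exists_powerSeries_mul hf hg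
  rw [coef, h, HahnSeries.coeff_single_mul, one_mul, add_sub_cancel_left,
    LaurentSeries.coeff_coe_powerSeries, mul_comm P Q, PowerSeries.coeff_mul,
    Finset.Nat.sum_antidiagonal_eq_sum_range_succ_mk]
  exact Finset.sum_congr rfl fun l _ => by rw [hP, hQ, mul_comm]

theorem exists_norm_coef_le {ι : Type*} [Finite ι] (F : ι → K) :
    ∃ C r : ℝ, 0 ≤ C ∧ 0 < r ∧ ∀ i, ∀ k : ℕ, ‖coef (F i) k‖ ≤ C * r ^ k := by
  have := Fintype.ofFinite ι
  choose C r hC hr h using fun i => (isConvergent_iff (F i : LaurentSeries ℂ)).1 (F i).2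
  have hr' : ∀ i, r i ≤ ∑ i, r i := fun i =>
    Finset.single_le_sum (fun i _ => (hr i).le) (Finset.mem_univ i)
  refine ⟨∑ i, C i, 1 + ∑ i, r i, Finset.sum_nonneg fun i _ => hC i,
    add_pos_of_pos_of_nonneg one_pos (Finset.sum_nonneg fun i _ => (hr i).le), fun i k => ?_⟩
  have hCi : C i ≤ ∑ i, C i := Finset.single_le_sum (fun i _ => hC i) (Finset.mem_univ i)
  calc ‖coef (F i) k‖ ≤ C i * r i ^ k := h i k
    _ ≤ (∑ i, C i) * (1 + ∑ i, r i) ^ k := by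
      have := hC i
      have := (hr i).le
      gcongr <;> linarith [hr' i]

theorem exists_coef_eq {y : ℕ → ℂ} {C r : ℝ} (hr : 0 < r) (h : ∀ k, ‖y k‖ ≤ C * r ^ k) :
    ∃ f : K, (∀ k < 0, coef f k = 0) ∧ ∀ k : ℕ, coef f k = y k := by
  have hC : 0 ≤ C := by simpa using (norm_nonneg _).trans (h 0)
  refine ⟨⟨HahnSeries.ofPowerSeries ℤ ℂ (PowerSeries.mk y), (isConvergent_ofPowerSeries_iff _).2
    ⟨C, r, hC, hr, fun n => by rw [PowerSeries.coeff_mk]; exact h n⟩⟩, fun k hk => ?_, fun k => ?_⟩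
  · rw [coef, PowerSeries.coeff_coe, if_pos hk]
  · rw [coef, LaurentSeries.coeff_coe_powerSeries, PowerSeries.coeff_mk]

section TriangularSystems

variable {𝕜 V : Type*} [NormedField 𝕜] [NormedAddCommGroup V] [NormedSpace 𝕜 V]

theorem mul_norm_le_norm_sub_smul {F : Module.End 𝕜 V} {D : ℝ} (hF : ∀ y, ‖F y‖ ≤ D * ‖y‖) {μ : 𝕜}
    (hμ : 2 * D + 1 ≤ ‖μ‖) (y : V) : (D + 1) * ‖y‖ ≤ ‖F y - μ • y‖ := by
  have h : (2 * D + 1) * ‖y‖ ≤ ‖μ • y‖ := by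
    rw [norm_smul]
    gcongr
  rw [norm_sub_rev]
  linarith [norm_sub_norm_le (μ • y) (F y), hF y]

theorem surjective_sub_smul_one [FiniteDimensional 𝕜 V] {F : Module.End 𝕜 V} {D : ℝ} (hD : 0 ≤ D)
    (hF : ∀ y, ‖F y‖ ≤ D * ‖y‖) {μ : 𝕜} (hμ : 2 * D + 1 ≤ ‖μ‖) :
    Function.Surjective (F - μ • 1 : Module.End 𝕜 V) := by
  refine LinearMap.injective_iff_surjective.1 ((injective_iff_map_eq_zero _).2 fun y hy => ?_)
  have h := mul_norm_le_norm_sub_smul hF hμ y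
  rw [show F y - μ • y = 0 from hy, norm_zero] at h
  exact norm_le_zero_iff.1 (nonpos_of_mul_nonpos_right h (by linarith))

variable {B : ℕ → ℕ → Module.End 𝕜 V} {D r G : ℝ} {μ : 𝕜} {g : ℕ → V}

theorem exists_triangular_solution [FiniteDimensional 𝕜 V] (hD : 0 ≤ D)
    (hB : ∀ k y, ‖B k k y‖ ≤ D * ‖y‖) (hμ : 2 * D + 1 ≤ ‖μ‖) (g : ℕ → V) :
    ∃ y : ℕ → V, ∀ k, ∑ j ∈ Finset.range (k + 1), B k j (y j) - μ • y k = g k := by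
  choose S hS using fun k => surjective_sub_smul_one hD (hB k) hμ
  let y : ℕ → V := wellFounded_lt.fix fun k y => S k (g k - ∑ j : Fin k, B k j (y j j.2))
  have hy : ∀ k, y k = S k (g k - ∑ j : Fin k, B k j (y j)) := fun k =>
    WellFounded.fix_eq _ _ k
  refine ⟨y, fun k => ?_⟩
  have h : B k k (y k) - μ • y k = g k - ∑ j : Fin k, B k j (y j) := by
    rw [hy k]
    exact hS k _
  rw [Fin.sum_univ_eq_sum_range (fun j => B k j (y j))] at h
  rw [Finset.sum_range_succ, add_sub_assoc, h, add_sub_cancel]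

theorem norm_triangular_solution_le (hD : 0 ≤ D) (hr : 0 ≤ r)
    (hB : ∀ k, ∀ j ≤ k, ∀ y, ‖B k j y‖ ≤ D * r ^ (k - j) * ‖y‖) (hμ : 2 * D + 1 ≤ ‖μ‖)
    (hg : ∀ k, ‖g k‖ ≤ G * r ^ k) {y : ℕ → V}
    (hy : ∀ k, ∑ j ∈ Finset.range (k + 1), B k j (y j) - μ • y k = g k) (k : ℕ) :
    ‖y k‖ ≤ G * (2 * r) ^ k := by
  have hG : 0 ≤ G := by simpa using (norm_nonneg _).trans (hg 0)
  induction k using Nat.strong_induction_on with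
  | _ k ih =>
    have hlow : (D + 1) * ‖y k‖ ≤ ‖g k - ∑ j ∈ Finset.range k, B k j (y j)‖ := by
      rw [← hy k, Finset.sum_range_succ, add_sub_assoc, add_sub_cancel_left]
      exact mul_norm_le_norm_sub_smul (by simpa using hB k k le_rfl) hμ (y k)
    have hsum : ‖∑ j ∈ Finset.range k, B k j (y j)‖ ≤ D * (G * (2 * r) ^ k) := by
      calc _ ≤ ∑ j ∈ Finset.range k, D * G * r ^ k * 2 ^ j := by
            refine norm_sum_le_of_le _ fun j hj => ?_
            have hj := Finset.mem_range.1 hj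
            calc ‖B k j (y j)‖ ≤ D * r ^ (k - j) * (G * (2 * r) ^ j) :=
                  (hB k j hj.le _).trans (by gcongr; exact ih j hj)
              _ = D * G * (r ^ (k - j) * r ^ j) * 2 ^ j := by rw [mul_pow]; ring
              _ = _ := by rw [← pow_add, Nat.sub_add_cancel hj.le]
        _ = D * G * r ^ k * (2 ^ k - 1) := by
            rw [← Finset.mul_sum, geom_sum_eq (by norm_num)]
            norm_num
        _ ≤ D * G * r ^ k * 2 ^ k := by gcongr; linarith
        _ = _ := by rw [mul_pow]; ring
    have hgk : ‖g k‖ ≤ G * (2 * r) ^ k := (hg k).trans (by gcongr; linarith)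
    have h : (D + 1) * ‖y k‖ ≤ (D + 1) * (G * (2 * r) ^ k) := by
      linarith [norm_sub_le_of_le hgk hsum]
    exact le_of_mul_le_mul_left h (by linarith)

end TriangularSystems

theorem norm_mulVec_le {ι : Type*} [Fintype ι] {A : Matrix ι ι ℂ} {c : ℝ} (hc : 0 ≤ c)
    (hA : ∀ i j, ‖A i j‖ ≤ c) (y : ι → ℂ) : ‖A.mulVec y‖ ≤ Fintype.card ι * c * ‖y‖ := by
  rw [pi_norm_le_iff_of_nonneg (by positivity)]
  intro i
  calc ‖∑ j, A i j * y j‖ ≤ ∑ _j : ι, c * ‖y‖ := by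
        refine norm_sum_le_of_le _ fun j _ => ?_
        rw [norm_mul]
        gcongr
        exacts [hA i j, norm_le_pi_norm y j]
    _ = _ := by rw [Finset.sum_const, Finset.card_univ, nsmul_eq_mul, mul_assoc]

section Lattice

variable {M : Type*} [AddCommGroup M] [Module K M] {ι : Type*} (b : Module.Basis ι K M)

/-- The vector of the coefficients of `z ^ k` of the coordinates of `x` in the basis `b`. -/
def vcoef (x : M) (k : ℤ) : ι → ℂ := fun i => coef (b.repr x i) k

/-- `x` lies in `z ^ j • Λ`, where `Λ` is the lattice of the vectors whose coordinates in the basis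
`b` have no pole at `z = 0`. -/
def InLattice (j : ℤ) (x : M) : Prop := ∀ k < j, vcoef b x k = 0

@[simp] theorem vcoef_add (x y : M) (k : ℤ) : vcoef b (x + y) k = vcoef b x k + vcoef b y k := by
  funext i
  simp [vcoef]

@[simp] theorem vcoef_sub (x y : M) (k : ℤ) : vcoef b (x - y) k = vcoef b x k - vcoef b y k := by
  funext i
  simp [vcoef]

@[simp] theorem vcoef_zero (k : ℤ) : vcoef b 0 k = 0 := by
  funext i
  simp [vcoef]

theorem vcoef_monomial_smul (l : ℤ) (c : ℂ) (x : M) (k : ℤ) :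
    vcoef b (monomial l c • x) k = c • vcoef b x (k - l) := by
  funext i
  simp [vcoef, coef_monomial_mul]

variable {b}

theorem eq_of_vcoef {x y : M} (h : ∀ k, vcoef b x k = vcoef b y k) : x = y :=
  b.ext_elem fun i => coef_ext fun k => congrFun (h k) i

theorem InLattice.coef_repr {j : ℤ} {x : M} (hx : InLattice b j x) (i : ι) :
    ∀ k < j, coef (b.repr x i) k = 0 :=
  fun k hk => congrFun (hx k hk) i

theorem InLattice.mono {j k : ℤ} {x : M} (h : InLattice b j x) (hk : k ≤ j) : InLattice b k x :=
  fun l hl => h l (by lia)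

theorem InLattice.add {j : ℤ} {x y : M} (hx : InLattice b j x) (hy : InLattice b j y) :
    InLattice b j (x + y) := fun k hk => by rw [vcoef_add, hx k hk, hy k hk, add_zero]

theorem InLattice.sub {j : ℤ} {x y : M} (hx : InLattice b j x) (hy : InLattice b j y) :
    InLattice b j (x - y) := fun k hk => by rw [vcoef_sub, hx k hk, hy k hk, sub_zero]

theorem InLattice.monomial_smul {j : ℤ} {x : M} (hx : InLattice b j x) (l : ℤ) (c : ℂ) :
    InLattice b (j + l) (monomial l c • x) := fun k hk => by
  rw [vcoef_monomial_smul, hx _ (by lia), smul_zero]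

theorem InLattice.succ {j : ℤ} {x : M} (hx : InLattice b j x) (h : vcoef b x j = 0) :
    InLattice b (j + 1) x := fun k hk => by
  rcases lt_or_eq_of_le (Int.lt_add_one_iff.1 hk) with h' | rfl
  exacts [hx k h', h]

theorem inLattice_basis (i : ι) : InLattice b 0 (b i) := fun k hk => by
  classical
  funext j
  rw [vcoef, b.repr_self, Finsupp.single_apply]
  split_ifs
  · rw [← monomial_zero_one, coef_monomial, if_neg hk.ne, Pi.zero_apply]
  · rw [coef_zero, Pi.zero_apply]

theorem vcoef_sum_smul [Fintype ι] (f : ι → K) (k : ℤ) :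
    vcoef b (∑ i, f i • b i) k = fun i => coef (f i) k := by
  funext i
  rw [vcoef, b.repr_sum_self]

theorem exists_vcoef_eq [Finite ι] (v : ι → ℂ) : ∃ x : M, InLattice b 0 x ∧ vcoef b x 0 = v := by
  have := Fintype.ofFinite ι
  refine ⟨∑ i, monomial 0 (v i) • b i, fun k hk => ?_, ?_⟩ <;> rw [vcoef_sum_smul] <;> funext i
  · rw [coef_monomial, if_neg hk.ne, Pi.zero_apply]
  · rw [coef_monomial, if_pos rfl]

theorem coef_ord_ne_zero {f : K} (hf : f ≠ 0) : coef f (ord f) ≠ 0 :=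
  HahnSeries.coeff_order_eq_zero.not.2 (by simpa using hf)

theorem coef_eq_zero_of_lt_ord {f : K} {k : ℤ} (hk : k < ord f) : coef f k = 0 :=
  HahnSeries.coeff_eq_zero_of_lt_order hk

theorem exists_inLattice [Finite ι] (x : M) : ∃ j, InLattice b j x := by
  obtain ⟨j, hj⟩ := Finite.exists_ge fun i => ord (b.repr x i)
  exact ⟨j, fun k hk => funext fun i => coef_eq_zero_of_lt_ord (hk.trans_le (hj i))⟩

theorem coef_dilate_eq_zero (a : ℂˣ) {f : K} {j : ℤ} (hf : ∀ k < j, coef f k = 0) :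
    ∀ k < j, coef (dilate a f) k = 0 :=
  fun k hk => by rw [coef_dilate, hf k hk, mul_zero]

theorem vcoef_smul_eq {f : K} {y : M} {k : ℤ} (hf : ∀ l < k, coef f l = 0)
    (hy : InLattice b 0 y) : vcoef b (f • y) k = coef f k • vcoef b y 0 := by
  funext i
  simpa [vcoef] using coef_mul hf (hy.coef_repr i) 0

theorem linearIndependent_of_vcoef {κ : Type*} {y : κ → M} (hy : ∀ i, InLattice b 0 (y i))
    (hy0 : LinearIndependent ℂ fun i => vcoef b (y i) 0) : LinearIndependent K y := by
  classical
  rw [linearIndependent_iff'] at hy0 ⊢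
  intro s f hf
  by_contra! ⟨i₀, hi₀s, hi₀⟩
  obtain ⟨i, hi, hmin⟩ := Finset.exists_min_image (s.filter fun i => f i ≠ 0) (fun i => ord (f i))
    ⟨i₀, Finset.mem_filter.2 ⟨hi₀s, hi₀⟩⟩
  obtain ⟨his, hi⟩ := Finset.mem_filter.1 hi
  have hlow : ∀ j ∈ s, ∀ k < ord (f i), coef (f j) k = 0 := by
    intro j hj k hk
    by_cases hfj : f j = 0
    · rw [hfj, coef_zero]
    · exact coef_eq_zero_of_lt_ord (hk.trans_le (hmin j (Finset.mem_filter.2 ⟨hj, hfj⟩)))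
  have h : ∑ j ∈ s, coef (f j) (ord (f i)) • vcoef b (y j) 0 = 0 := by
    rw [← vcoef_zero b (ord (f i)), ← hf, ← Finset.sum_congr rfl fun j hj =>
      vcoef_smul_eq (hlow j hj) (hy j)]
    exact (map_sum (AddMonoidHom.mk' (vcoef b · (ord (f i))) fun x y => vcoef_add b x y _) _ _).symm
  exact coef_ord_ne_zero hi (hy0 s _ h i his)

theorem eq_top_of_forall_exists_vcoef_eq [Finite ι] {P : Submodule K M}
    (h : ∀ v, ∃ x ∈ P, InLattice b 0 x ∧ vcoef b x 0 = v) : P = ⊤ := by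
  have := Fintype.ofFinite ι
  have := Module.Finite.of_basis b
  choose y hyP hy hy0 using fun i => h (Pi.basisFun ℂ ι i)
  have hli : LinearIndependent K y := linearIndependent_of_vcoef hy (by
    simpa only [hy0] using (Pi.basisFun ℂ ι).linearIndependent)
  rw [eq_top_iff, ← hli.span_eq_top_of_card_eq_finrank' (Module.finrank_eq_card_basis b).symm]
  exact Submodule.span_le.2 (Set.range_subset_iff.2 hyP)

end Lattice

section LatticeOperators

variable {M : Type*} [AddCommGroup M] [Module K M] [Module ℂ M]
  {ι : Type*} {b : Module.Basis ι K M} {p : ℂˣ} {T : Module.End ℂ M}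

theorem vcoef_smul [IsScalarTower ℂ K M] (c : ℂ) (x : M) (k : ℤ) :
    vcoef b (c • x) k = c • vcoef b x k := by
  rw [← algebraMap_smul K c x, algebraMap_eq, vcoef_monomial_smul, sub_zero]

theorem InLattice.smul [IsScalarTower ℂ K M] {j : ℤ} {x : M} (hx : InLattice b j x) (c : ℂ) :
    InLattice b j (c • x) := fun k hk => by rw [vcoef_smul, hx k hk, smul_zero]

/-- `T` maps the lattice spanned by the basis `b` to itself. -/
def PreservesLattice (b : Module.Basis ι K M) (T : Module.End ℂ M) : Prop :=
  ∀ x, InLattice b 0 x → InLattice b 0 (T x)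

/-- The contribution of the coefficient of `z ^ j` of `x` to the coefficient of `z ^ (j + l)` of
`T x`, where `T` is semilinear with respect to `z ↦ p z`. -/
def coefOperator [Fintype ι] (b : Module.Basis ι K M) (p : ℂˣ) (T : Module.End ℂ M) (l j : ℤ) :
    Module.End ℂ (ι → ℂ) :=
  (p : ℂ) ^ j • (Matrix.of fun i i' => coef (b.repr (T (b i')) i) l).mulVecLin

theorem coefOperator_apply [Fintype ι] (l j : ℤ) (y : ι → ℂ) (i : ι) :
    coefOperator b p T l j y i = (p : ℂ) ^ j * ∑ i', coef (b.repr (T (b i')) i) l * y i' :=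
  rfl

theorem norm_coefOperator_le [Fintype ι] {C r : ℝ} (hC : 0 ≤ C) (hr : 0 ≤ r)
    (hT : ∀ i i' (l : ℕ), ‖coef (b.repr (T (b i')) i) l‖ ≤ C * r ^ l) (hp : ‖(p : ℂ)‖ ≤ 1)
    (l j : ℕ) (y : ι → ℂ) : ‖coefOperator b p T l j y‖ ≤ Fintype.card ι * C * r ^ l * ‖y‖ := by
  have hpj : ‖(p : ℂ) ^ j‖ ≤ 1 := by
    rw [norm_pow]
    exact pow_le_one₀ (norm_nonneg _) hp
  rw [coefOperator, LinearMap.smul_apply, norm_smul, zpow_natCast, mul_assoc _ C]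
  exact (mul_le_of_le_one_left (norm_nonneg _) hpj).trans
    (norm_mulVec_le (by positivity) (fun i i' => hT i i' l) y)

theorem PreservesLattice.coef_repr_apply (hL : PreservesLattice b T) (i j : ι) :
    ∀ k < 0, coef (b.repr (T (b j)) i) k = 0 :=
  (hL _ (inLattice_basis j)).coef_repr i

theorem IsDilationSemilinear.repr_apply [Fintype ι] (hT : IsDilationSemilinear p T) (x : M)
    (i : ι) : b.repr (T x) i = ∑ j, b.repr (T (b j)) i * dilate p (b.repr x j) := by
  conv_lhs => rw [← b.sum_repr x, map_sum, map_sum, Finsupp.finsetSum_apply]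
  refine Finset.sum_congr rfl fun j _ => ?_
  rw [hT, map_smul, Finsupp.smul_apply, smul_eq_mul, mul_comm]

theorem vcoef_apply [Fintype ι] (hT : IsDilationSemilinear p T) (hL : PreservesLattice b T) {a : ℤ}
    {x : M} (hx : InLattice b a x) (k : ℕ) : vcoef b (T x) (a + k) =
      ∑ l ∈ Finset.range (k + 1), coefOperator b p T (k - l : ℕ) (a + l) (vcoef b x (a + l)) := by
  funext i
  have h : ∀ j, coef (b.repr (T (b j)) i * dilate p (b.repr x j)) (a + k) =
      ∑ l ∈ Finset.range (k + 1), coef (b.repr (T (b j)) i) ((k - l : ℕ) : ℤ) *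
        ((p : ℂ) ^ (a + l) * vcoef b x (a + l) j) := fun j => by
    simpa [vcoef] using coef_mul (hL.coef_repr_apply i j)
      (coef_dilate_eq_zero p (hx.coef_repr j)) k
  rw [vcoef, hT.repr_apply, coef_sum, Finset.sum_congr rfl fun j _ => h j, Finset.sum_comm,
    Finset.sum_apply]
  refine Finset.sum_congr rfl fun l _ => ?_
  rw [coefOperator_apply, Finset.mul_sum]
  exact Finset.sum_congr rfl fun j _ => mul_left_comm _ _ _

theorem IsDilationSemilinear.inLattice_apply [Finite ι] (hT : IsDilationSemilinear p T)
    (hb : ∀ j, InLattice b 0 (T (b j))) {a : ℤ} {x : M} (hx : InLattice b a x) :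
    InLattice b a (T x) := by
  have := Fintype.ofFinite ι
  intro k hk
  funext i
  rw [vcoef, hT.repr_apply, coef_sum]
  exact Finset.sum_eq_zero fun j _ => coef_mul_of_lt ((hb j).coef_repr i)
    (coef_dilate_eq_zero p (hx.coef_repr j)) (by lia)

theorem PreservesLattice.apply [Finite ι] (hL : PreservesLattice b T)
    (hT : IsDilationSemilinear p T) {a : ℤ} {x : M} (hx : InLattice b a x) :
    InLattice b a (T x) :=
  hT.inLattice_apply (fun j => hL _ (inLattice_basis j)) hx

theorem IsDilationSemilinear.eq_zero_of_pow_apply_eq_smul [Finite ι]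
    (hT : IsDilationSemilinear p T) (hb : ∀ j, InLattice b 0 (T (b j))) {k : ℕ} {a : ℤ}
    (ha : a < 0) {c : ℂ} (hc : c ≠ 0) {u : M} (hu : (T ^ k) u = monomial a c • u) : u = 0 := by
  have hpow {j : ℤ} (hj : InLattice b j u) : InLattice b j ((T ^ k) u) := by
    rw [Module.End.coe_pow]
    exact Function.Iterate.rec (InLattice b j) hj (fun _ => hT.inLattice_apply hb) k
  have hsucc {j : ℤ} (hj : InLattice b j u) : InLattice b (j + 1) u := by
    have h := (hpow hj).monomial_smul (-a) c⁻¹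
    rw [hu, smul_smul, monomial_mul_monomial, neg_add_cancel, inv_mul_cancel₀ hc,
      monomial_zero_one, one_smul] at h
    exact h.mono (by lia)
  obtain ⟨j, hj⟩ := exists_inLattice (b := b) u
  refine eq_of_vcoef (b := b) fun k => ?_
  rw [vcoef_zero]
  have hall : ∀ l : ℕ, InLattice b (j + l) u := fun l => by
    induction l with
    | zero => simpa using hj
    | succ l ih => simpa [add_assoc] using hsucc ih
  exact hall (k + 1 - j).toNat k (by lia)

theorem coefOperator_injective [Fintype ι] (hT : IsDilationSemilinear p T)
    (hL : PreservesLattice b T) (hinj : ∀ x, InLattice b 0 x → InLattice b 1 (T x) →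
      InLattice b 1 x) : Function.Injective (coefOperator b p T 0 0) := by
  refine (injective_iff_map_eq_zero _).2 fun v hv => ?_
  obtain ⟨x, hx, rfl⟩ := exists_vcoef_eq (b := b) v
  have h : vcoef b (T x) 0 = coefOperator b p T 0 0 (vcoef b x 0) := by
    simpa using vcoef_apply hT hL hx 0
  exact hinj x hx ((hL x hx).succ (h.trans hv)) 0 one_pos

end LatticeOperators

section LatticeSpectrum

variable {M : Type*} [AddCommGroup M] [Module K M] [Module ℂ M] [IsScalarTower ℂ K M]
  {ι : Type*} {b : Module.Basis ι K M} {p : ℂˣ} {T : Module.End ℂ M}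

theorem exists_sub_smul_eq [Finite ι] (hT : IsDilationSemilinear p T)
    (hL : PreservesLattice b T) (hp : ‖(p : ℂ)‖ ≤ 1) :
    ∃ R : ℝ, ∀ μ : ℂ, R ≤ ‖μ‖ → ∀ g, InLattice b 0 g →
      ∃ x, InLattice b 0 x ∧ T x - μ • x = g := by
  have := Fintype.ofFinite ι
  obtain ⟨C, r, hC, hr, hA⟩ := exists_norm_coef_le fun ij : ι × ι => b.repr (T (b ij.2)) ij.1
  refine ⟨2 * (Fintype.card ι * C) + 1, fun μ hμ g hg => ?_⟩
  obtain ⟨G, s, hG, hs, hgb⟩ := exists_norm_coef_le fun i => b.repr g i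
  have hB : ∀ k, ∀ j ≤ k, ∀ y, ‖coefOperator b p T (k - j : ℕ) j y‖ ≤
      Fintype.card ι * C * max r s ^ (k - j) * ‖y‖ := fun k j _ y =>
    norm_coefOperator_le hC (by positivity) (fun i i' l =>
      (hA (i, i') l).trans (by gcongr; exact le_max_left _ _)) hp (k - j) j y
  have hg' : ∀ k : ℕ, ‖vcoef b g k‖ ≤ G * max r s ^ k := fun k =>
    (pi_norm_le_iff_of_nonneg (by positivity)).2 fun i =>
      (hgb i k).trans (by gcongr; exact le_max_right _ _)
  obtain ⟨y, hy⟩ := exists_triangular_solution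
    (B := fun k j => coefOperator b p T (k - j : ℕ) j) (by positivity)
    (fun k y => by simpa using hB k k le_rfl y) hμ fun k => vcoef b g k
  have hyb := norm_triangular_solution_le (by positivity) (by positivity) hB hμ hg' hy
  choose f hf0 hf using fun i => exists_coef_eq (y := fun k => y k i) (C := G)
    (r := 2 * max r s) (by positivity) fun k => (norm_le_pi_norm (y k) i).trans (hyb k)
  have hx0 : InLattice b 0 (∑ i, f i • b i) := fun k hk => by
    rw [vcoef_sum_smul]
    exact funext fun i => hf0 i k hk
  have hx : ∀ k : ℕ, vcoef b (∑ i, f i • b i) (k : ℤ) = y k := fun k => by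
    rw [vcoef_sum_smul]
    exact funext fun i => hf i k
  refine ⟨∑ i, f i • b i, hx0, eq_of_vcoef (b := b) fun k => ?_⟩
  rcases lt_or_ge k 0 with hk | hk
  · rw [hg k hk]
    exact ((hL _ hx0).sub (hx0.smul μ)) k hk
  · lift k to ℕ using hk
    have h := vcoef_apply hT hL hx0 k
    simp only [zero_add, hx] at h
    rw [vcoef_sub, vcoef_smul, h, hx, hy]

theorem IsDilationSemilinear.map_monomial_smul (hT : IsDilationSemilinear p T) (k : ℤ) (x : M) :
    T (monomial k 1 • x) = (p : ℂ) ^ k • monomial k 1 • T x := by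
  rw [hT, dilate_monomial, mul_one, ← smul_assoc, smul_monomial, mul_one]

theorem eventually_surjOn_sub_smul [Finite ι] (hT : IsDilationSemilinear p T)
    (hL : PreservesLattice b T) (hp : ‖(p : ℂ)‖ < 1) {lam : ℂ} (hlam : lam ≠ 0) :
    ∀ᶠ N : ℕ in Filter.atTop,
      Set.SurjOn (T - lam • 1 : Module.End ℂ M) {x | InLattice b N x} {x | InLattice b N x} := by
  obtain ⟨R, hR⟩ := exists_sub_smul_eq hT hL hp.le
  have hlim : Filter.Tendsto (fun N : ℕ => R * ‖(p : ℂ)‖ ^ N) Filter.atTop (nhds 0) := by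
    simpa using (tendsto_pow_atTop_nhds_zero_of_lt_one (norm_nonneg _) hp).const_mul R
  filter_upwards [hlim.eventually_lt_const (norm_pos_iff.2 hlam)] with N hN g hg
  have hpN : (p : ℂ) ^ N ≠ 0 := pow_ne_zero _ p.ne_zero
  obtain ⟨y, hy, hyg⟩ := hR (lam / (p : ℂ) ^ N)
    (by rw [norm_div, norm_pow, le_div_iff₀ (pow_pos (norm_pos_iff.2 p.ne_zero) N)]; exact hN.le)
    (((p : ℂ) ^ N)⁻¹ • monomial (-N) 1 • g)
    (by simpa using (hg.monomial_smul (-N) 1).smul ((p : ℂ) ^ N)⁻¹)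
  have hg' : g = (p : ℂ) ^ N • monomial N 1 • (T y - (lam / (p : ℂ) ^ N) • y) := by
    rw [hyg, smul_comm (monomial N 1) (_ : ℂ), smul_inv_smul₀ hpN, smul_smul,
      monomial_mul_monomial, add_neg_cancel, mul_one, monomial_zero_one, one_smul]
  refine ⟨monomial N 1 • y, by simpa using hy.monomial_smul N 1, ?_⟩
  rw [hg', smul_sub, smul_comm (monomial N 1) (_ : ℂ), smul_sub, smul_smul, mul_div_cancel₀ _ hpN,
    LinearMap.sub_apply, hT.map_monomial_smul, zpow_natCast]
  rfl

theorem sub_smul_pow_apply [Fintype ι] (hT : IsDilationSemilinear p T)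
    (hL : PreservesLattice b T) (lam : ℂ) {j : ℤ} {x : M} (hx : InLattice b j x) (k : ℕ) :
    InLattice b j (((T - lam • 1) ^ k) x) ∧ vcoef b (((T - lam • 1) ^ k) x) j =
      ((coefOperator b p T 0 j - lam • 1) ^ k) (vcoef b x j) := by
  induction k with
  | zero => exact ⟨hx, rfl⟩
  | succ k ih =>
    have h : vcoef b (T (((T - lam • 1) ^ k) x)) j =
        coefOperator b p T 0 j (vcoef b (((T - lam • 1) ^ k) x) j) := by
      simpa using vcoef_apply hT hL ih.1 0
    rw [pow_succ', pow_succ', Module.End.mul_apply, Module.End.mul_apply, ← ih.2]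
    refine ⟨(hL.apply hT ih.1).sub (ih.1.smul lam), ?_⟩
    rw [LinearMap.sub_apply, vcoef_sub, h, LinearMap.smul_apply, Module.End.one_apply, vcoef_smul]
    rfl

theorem exists_pow_add_apply_eq {k V : Type*} [Field k] [AddCommGroup V] [Module k V]
    [Module.Finite k V] (F : Module.End k V) :
    ∃ D : ℕ, ∀ (a : ℕ) (w : V), ∃ u, (F ^ (D + a)) u = (F ^ D) w := by
  obtain ⟨D, hD⟩ := IsArtinian.monotone_stabilizes (LinearMap.iterateRange F)
  have h : ∀ a, LinearMap.range (F ^ D) = LinearMap.range (F ^ (D + a)) :=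
    fun a => hD (D + a) (Nat.le_add_right D a)
  exact ⟨D, fun a w => LinearMap.mem_range.1 (h a ▸ LinearMap.mem_range_self (F ^ D) w)⟩

theorem exists_lift_modulo [Fintype ι] (hT : IsDilationSemilinear p T) (hL : PreservesLattice b T)
    {lam : ℂ} {v : ι → ℂ} (hv : v ∈ (coefOperator b p T 0 0).maxGenEigenspace lam) (j : ℕ) :
    ∃ (x : M) (a : ℕ), InLattice b 0 x ∧ vcoef b x 0 = v ∧
      InLattice b (j + 1) (((T - lam • 1) ^ a) x) := by
  induction j with
  | zero =>
    obtain ⟨k, hk⟩ := (Module.End.mem_maxGenEigenspace _ _ _).1 hv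
    obtain ⟨x, hx, rfl⟩ := exists_vcoef_eq (b := b) v
    obtain ⟨h₁, h₂⟩ := sub_smul_pow_apply hT hL lam hx k
    exact ⟨x, k, hx, rfl, h₁.succ (h₂.trans hk)⟩
  | succ j ih =>
    obtain ⟨x, a, hx, hxv, hxa⟩ := ih
    obtain ⟨D, hD⟩ := exists_pow_add_apply_eq (coefOperator b p T 0 (j + 1) - lam • 1)
    obtain ⟨u, hu⟩ := hD a (vcoef b (((T - lam • 1) ^ a) x) (j + 1))
    obtain ⟨y, hy, rfl⟩ := exists_vcoef_eq (b := b) u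
    have hz : InLattice b (j + 1) (monomial (j + 1) 1 • y) := by
      simpa using hy.monomial_smul (j + 1) 1
    have hzy : vcoef b (monomial (j + 1) 1 • y) (j + 1) = vcoef b y 0 := by
      rw [vcoef_monomial_smul, one_smul, sub_self]
    obtain ⟨h₁, h₂⟩ := sub_smul_pow_apply hT hL lam hz (D + a)
    obtain ⟨h₃, h₄⟩ := sub_smul_pow_apply hT hL lam hxa D
    refine ⟨x - monomial (j + 1) 1 • y, D + a, hx.sub (hz.mono (by lia)), ?_, ?_⟩
    · rw [vcoef_sub, hz 0 (by lia), sub_zero, hxv]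
    · rw [map_sub]
      nth_rw 1 [pow_add]
      exact_mod_cast (h₃.sub h₁).succ (by rw [vcoef_sub, h₄, h₂, hzy, hu, sub_self])

theorem exists_mem_maxGenEigenspace_vcoef_eq [Fintype ι] (hT : IsDilationSemilinear p T)
    (hL : PreservesLattice b T) (hp : ‖(p : ℂ)‖ < 1) {lam : ℂ} (hlam : lam ≠ 0) {v : ι → ℂ}
    (hv : v ∈ (coefOperator b p T 0 0).maxGenEigenspace lam) :
    ∃ x ∈ T.maxGenEigenspace lam, InLattice b 0 x ∧ vcoef b x 0 = v := by
  obtain ⟨N, hN, hN1⟩ := ((eventually_surjOn_sub_smul hT hL hp hlam).and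
    (Filter.eventually_ge_atTop 1)).exists
  obtain ⟨N, rfl⟩ := Nat.exists_eq_add_of_le' hN1
  obtain ⟨x, a, hx, hxv, hxa⟩ := exists_lift_modulo hT hL hv N
  obtain ⟨y, hy, hya⟩ := hN.iterate a (by exact_mod_cast hxa)
  rw [← Module.End.coe_pow] at hya
  refine ⟨x - y, (Module.End.mem_maxGenEigenspace _ _ _).2 ⟨a, ?_⟩, hx.sub (hy.mono (by lia)), ?_⟩
  · rw [map_sub, hya, sub_self]
  · rw [vcoef_sub, hy 0 (by lia), sub_zero, hxv]

/-- The leading coefficients of the elements of `P` that lie in the lattice. -/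
def leadingCoeffs (b : Module.Basis ι K M) (P : Submodule K M) : Submodule ℂ (ι → ℂ) where
  carrier := {v | ∃ x ∈ P, InLattice b 0 x ∧ vcoef b x 0 = v}
  add_mem' := by
    rintro _ _ ⟨x, hxP, hx, rfl⟩ ⟨y, hyP, hy, rfl⟩
    exact ⟨x + y, P.add_mem hxP hyP, hx.add hy, vcoef_add b x y 0⟩
  zero_mem' := ⟨0, P.zero_mem, fun k _ => vcoef_zero b k, vcoef_zero b 0⟩
  smul_mem' := by
    rintro c _ ⟨x, hxP, hx, rfl⟩
    exact ⟨c • x, P.smul_of_tower_mem c hxP, hx.smul c, vcoef_smul c x 0⟩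

theorem iSup_eigenspan_eq_top [Finite ι] (hT : IsDilationSemilinear p T)
    (hL : PreservesLattice b T) (hp : ‖(p : ℂ)‖ < 1)
    (hinj : ∀ x, InLattice b 0 x → InLattice b 1 (T x) → InLattice b 1 x) :
    ⨆ (μ : ℂ) (_ : μ ≠ 0), eigenspan T μ = ⊤ := by
  have := Fintype.ofFinite ι
  have htop : leadingCoeffs b (⨆ (μ : ℂ) (_ : μ ≠ 0), eigenspan T μ) = ⊤ := by
    rw [eq_top_iff, ← Module.End.iSup_maxGenEigenspace_eq_top (coefOperator b p T 0 0)]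
    refine iSup_le fun μ v hv => ?_
    rcases eq_or_ne μ 0 with rfl | hμ
    · obtain ⟨k, hk⟩ := (Module.End.mem_maxGenEigenspace _ _ _).1 hv
      rw [zero_smul, sub_zero, Module.End.pow_apply] at hk
      rw [(coefOperator_injective hT hL hinj).iterate k (hk.trans (iterate_map_zero _ k).symm)]
      exact Submodule.zero_mem _
    · obtain ⟨x, hx, hx0, hxv⟩ := exists_mem_maxGenEigenspace_vcoef_eq hT hL hp hμ hv
      exact ⟨x, le_iSup₂ (f := fun μ (_ : μ ≠ 0) => eigenspan T μ) μ hμ (Submodule.subset_span hx),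
        hx0, hxv⟩
  exact eq_top_of_forall_exists_vcoef_eq fun v => htop ▸ Submodule.mem_top (x := v)

end LatticeSpectrum

theorem norm_qpow_lt_one {τ : ℂ} (hτ : 0 < τ.im) : ‖(qpow τ 1 : ℂ)‖ < 1 := by
  rw [qpow, Units.val_mk0, Complex.norm_exp, Real.exp_lt_one_iff]
  simpa using (by positivity : 0 < 2 * Real.pi * τ.im)

theorem qpow_zpow_eq_one {τ : ℂ} (hτ : 0 < τ.im) {a : ℤ} (h : (qpow τ 1 : ℂ) ^ a = 1) : a = 0 := by
  have h1 := congrArg norm h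
  rw [norm_zpow, norm_one] at h1
  exact (zpow_eq_one_iff_right₀ (norm_nonneg _) (norm_qpow_lt_one hτ).ne).1 h1

theorem not_isOfFinOrder_qpow_pow {τ : ℂ} (hτ : 0 < τ.im) {n : ℕ} (hn : n ≠ 0) :
    ¬ IsOfFinOrder (qpow τ 1 ^ n) := by
  rw [isOfFinOrder_pow, or_iff_left hn, isOfFinOrder_iff_zpow_eq_one]
  rintro ⟨a, ha, h⟩
  exact ha (qpow_zpow_eq_one hτ (by simpa using congrArg Units.val h))

section GeneralizedEigenspaces

variable {V : Type*} [AddCommGroup V] [Module ℂ V] {T A : Module.End ℂ V} {a : ℂ}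

theorem sub_smul_one_pow_apply_of_quasicommute (h : ∀ x, T (A x) = a • A (T x)) (μ : ℂ) (k : ℕ)
    (x : V) : ((T - (a * μ) • 1) ^ k) (A x) = a ^ k • A (((T - μ • 1) ^ k) x) := by
  induction k with
  | zero => simp
  | succ k ih =>
    rw [pow_succ', Module.End.mul_apply, ih, pow_succ' (T - μ • 1), Module.End.mul_apply]
    simp [h, smul_sub, pow_succ, mul_smul, smul_comm a]

theorem apply_mem_maxGenEigenspace_iff (h : ∀ x, T (A x) = a • A (T x)) (ha : a ≠ 0)
    (hA : Function.Injective A) {μ : ℂ} {x : V} :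
    A x ∈ T.maxGenEigenspace (a * μ) ↔ x ∈ T.maxGenEigenspace μ := by
  simp only [Module.End.mem_maxGenEigenspace, sub_smul_one_pow_apply_of_quasicommute h,
    smul_eq_zero_iff_right (pow_ne_zero _ ha), map_eq_zero_iff A hA]

end GeneralizedEigenspaces

section DilationSemilinear

variable {M : Type*} [AddCommGroup M] [Module K M] [Module ℂ M] [IsScalarTower ℂ K M]
  {p : ℂˣ} {T : Module.End ℂ M}

theorem IsDilationSemilinear.monomial_smul_mem_maxGenEigenspace_iff
    (hT : IsDilationSemilinear p T) {k : ℤ} {μ : ℂ} {x : M} :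
    monomial k (1 : ℂ) • x ∈ T.maxGenEigenspace ((p : ℂ) ^ k * μ) ↔ x ∈ T.maxGenEigenspace μ :=
  apply_mem_maxGenEigenspace_iff (A := Algebra.lsmul ℂ ℂ M (monomial k (1 : ℂ)))
    (hT.map_monomial_smul k) (zpow_ne_zero _ p.ne_zero)
    (smul_right_injective M (monomial_ne_zero k one_ne_zero))

theorem IsDilationSemilinear.eigenspan_zpow_mul (hT : IsDilationSemilinear p T) (k : ℤ) (μ : ℂ) :
    eigenspan T ((p : ℂ) ^ k * μ) = eigenspan T μ := by
  have hle : ∀ (k : ℤ) (μ : ℂ), eigenspan T μ ≤ eigenspan T ((p : ℂ) ^ k * μ) := by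
    refine fun k μ => Submodule.span_le.2 fun x hx => ?_
    have hmem : monomial k (1 : ℂ) • x ∈ eigenspan T ((p : ℂ) ^ k * μ) :=
      Submodule.subset_span (hT.monomial_smul_mem_maxGenEigenspace_iff.2 hx)
    exact (Submodule.smul_mem_iff _ (monomial_ne_zero k one_ne_zero)).1 hmem
  refine le_antisymm ((hle (-k) _).trans_eq ?_) (hle k μ)
  rw [← mul_assoc, ← zpow_add₀ p.ne_zero, neg_add_cancel, zpow_zero, one_mul]

end DilationSemilinear

section SlopeOperator

variable {τ : ℂ} {M : Type*} [AddCommGroup M] [Module K M] [Module ℂ M] [IsScalarTower ℂ K M]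
  (Φ : M →ₛₗ[φ τ] M) (t : ℤ) (n : ℕ)

theorem φ_apply (τ : ℂ) (f : K) : φ τ f = dilate (qpow τ 1) f := rfl

/-- `Φ` as a `ℂ`-linear map, so that its powers and its commutators with scalars make sense in the
endomorphism ring. -/
def complexEnd : Module.End ℂ M where
  toFun := Φ
  map_add' := map_add Φ
  map_smul' c x := by
    rw [← algebraMap_smul K c x, map_smulₛₗ, φ_apply, dilate_algebraMap, algebraMap_smul]
    rfl

@[simp] theorem complexEnd_apply (x : M) : complexEnd Φ x = Φ x := rfl

theorem complexEnd_pow_apply (i : ℕ) (x : M) : (complexEnd Φ ^ i) x = Φ^[i] x := by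
  rw [Module.End.coe_pow]
  rfl

theorem complexEnd_pow_succ_apply (i : ℕ) (x : M) :
    (complexEnd Φ ^ (i + 1)) x = Φ ((complexEnd Φ ^ i) x) := by
  rw [pow_succ', Module.End.mul_apply, complexEnd_apply]

variable {Φ} in
theorem complexEnd_pow_injective (hΦ : Function.Injective Φ) (i : ℕ) :
    Function.Injective (complexEnd Φ ^ i) := by
  rw [Module.End.coe_pow]
  exact hΦ.iterate i

theorem isDilationSemilinear_complexEnd_pow (i : ℕ) :
    IsDilationSemilinear (qpow τ 1 ^ i) (complexEnd Φ ^ i) := by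
  intro f x
  induction i with
  | zero => rw [pow_zero, pow_zero, dilate_one]; rfl
  | succ i ih =>
    rw [complexEnd_pow_succ_apply, ih, map_smulₛₗ, φ_apply, dilate_dilate, ← pow_succ',
      complexEnd_pow_succ_apply]

/-- The operator `z ^ (-t) Φ ^ n`; its eigenvalues are nonzero constants when `Φ` has slope
`t / n`. -/
def slopeOperator : Module.End ℂ M := Algebra.lsmul ℂ ℂ M (monomial (-t) 1) * complexEnd Φ ^ n

theorem slopeOperator_apply (x : M) :
    slopeOperator Φ t n x = monomial (-t) (1 : ℂ) • (complexEnd Φ ^ n) x :=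
  rfl

theorem complexEnd_pow_eq_smul_slopeOperator (x : M) :
    (complexEnd Φ ^ n) x = monomial t (1 : ℂ) • slopeOperator Φ t n x := by
  rw [slopeOperator_apply, smul_smul, monomial_mul_monomial, add_neg_cancel, mul_one,
    monomial_zero_one, one_smul]

theorem isDilationSemilinear_slopeOperator :
    IsDilationSemilinear (qpow τ 1 ^ n) (slopeOperator Φ t n) := fun f x => by
  rw [slopeOperator_apply, isDilationSemilinear_complexEnd_pow, slopeOperator_apply, smul_comm]

theorem slopeOperator_complexEnd_pow (i : ℕ) (x : M) :
    slopeOperator Φ t n ((complexEnd Φ ^ i) x) =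
      (qpow τ 1 : ℂ) ^ (t * i) • (complexEnd Φ ^ i) (slopeOperator Φ t n x) := by
  rw [slopeOperator_apply, slopeOperator_apply,
    (isDilationSemilinear_complexEnd_pow Φ i).map_monomial_smul, smul_smul, ← Module.End.mul_apply,
    ← Module.End.mul_apply, ← pow_add, ← pow_add, add_comm i, Units.val_pow_eq_pow_val,
    ← zpow_natCast, ← zpow_mul, ← zpow_add₀ (Units.ne_zero _),
    show t * i + i * -t = 0 by ring, zpow_zero, one_smul]

theorem slopeOperator_pow_apply (k : ℕ) (x : M) :
    (slopeOperator Φ t n ^ k) x =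
      monomial (-(t * k)) (∏ l ∈ Finset.range k, (qpow τ 1 : ℂ) ^ (-(n * t * l))) •
        (complexEnd Φ ^ (n * k)) x := by
  induction k with
  | zero => simp [monomial_zero_one]
  | succ k ih =>
    rw [pow_succ', Module.End.mul_apply, ih, isDilationSemilinear_slopeOperator, dilate_monomial,
      slopeOperator_apply, smul_smul, monomial_mul_monomial, mul_one, ← Module.End.mul_apply,
      ← pow_add, Finset.prod_range_succ_comm, Units.val_pow_eq_pow_val, ← zpow_natCast, ← zpow_mul,
      mul_neg, ← mul_assoc, Nat.mul_succ, add_comm (n * k)]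
    congr 2
    push_cast
    ring

theorem exists_slopeOperator_pow_apply_eq (t' : ℤ) (n' : ℕ) (x : M) :
    ∃ c : ℂ, c ≠ 0 ∧ (slopeOperator Φ t n ^ n') x =
      monomial (t' * n - t * n') c • (slopeOperator Φ t' n' ^ n) x := by
  have hne (t : ℤ) (n k : ℕ) : ∏ l ∈ Finset.range k, (qpow τ 1 : ℂ) ^ (-(n * t * l)) ≠ 0 :=
    Finset.prod_ne_zero_iff.2 fun _ _ => zpow_ne_zero _ (Units.ne_zero _)
  refine ⟨_, div_ne_zero (hne t n n') (hne t' n' n), ?_⟩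
  rw [slopeOperator_pow_apply, slopeOperator_pow_apply, smul_smul, monomial_mul_monomial,
    div_mul_cancel₀ _ (hne t' n' n), mul_comm n]
  congr 2
  ring

variable {Φ t n}

theorem complexEnd_pow_mem_maxGenEigenspace_iff (hΦ : Function.Injective Φ) {i : ℕ} {μ : ℂ}
    {x : M} :
    (complexEnd Φ ^ i) x ∈ (slopeOperator Φ t n).maxGenEigenspace ((qpow τ 1 : ℂ) ^ (t * i) * μ) ↔
      x ∈ (slopeOperator Φ t n).maxGenEigenspace μ :=
  apply_mem_maxGenEigenspace_iff (slopeOperator_complexEnd_pow Φ t n i)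
    (zpow_ne_zero _ (Units.ne_zero _)) (complexEnd_pow_injective hΦ i)

theorem map_complexEnd_pow_maxGenEigenspace (hΦ : Function.Bijective Φ) (i : ℕ) (μ : ℂ) :
    ((slopeOperator Φ t n).maxGenEigenspace μ).map (complexEnd Φ ^ i) =
      (slopeOperator Φ t n).maxGenEigenspace ((qpow τ 1 : ℂ) ^ (t * i) * μ) := by
  refine le_antisymm (Submodule.map_le_iff_le_comap.2 fun x =>
    (complexEnd_pow_mem_maxGenEigenspace_iff hΦ.1).2) fun y hy => ?_
  obtain ⟨x, rfl⟩ := hΦ.2.iterate i y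
  rw [← complexEnd_pow_apply] at hy ⊢
  exact ⟨x, (complexEnd_pow_mem_maxGenEigenspace_iff hΦ.1).1 hy, rfl⟩

end SlopeOperator

section NewtonPolygon

variable {L : Polynomial K}

theorem exists_isSlope_of_coeff_zero (h0 : L.coeff 0 ≠ 0) (hd : 0 < L.natDegree) :
    ∃ s, IsSlope L s ∧ ∀ k ∈ L.support, (ord (L.coeff 0) : ℚ) ≤ ord (L.coeff k) + s * k := by
  have hdeg : L.natDegree ∈ L.support :=
    Polynomial.natDegree_mem_support_of_nonzero (by rintro rfl; simp at hd)
  obtain ⟨j, hj, hmax⟩ := Finset.exists_max_image (L.support.erase 0)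
    (fun k => ((ord (L.coeff 0) : ℚ) - ord (L.coeff k)) / k)
    ⟨L.natDegree, Finset.mem_erase.2 ⟨hd.ne', hdeg⟩⟩
  obtain ⟨hj0, hjL⟩ := Finset.mem_erase.1 hj
  set s := ((ord (L.coeff 0) : ℚ) - ord (L.coeff j)) / j
  have hle : ∀ k ∈ L.support, (ord (L.coeff 0) : ℚ) ≤ ord (L.coeff k) + s * k := by
    intro k hk
    rcases Nat.eq_zero_or_pos k with rfl | hk0
    · simp
    · have := hmax k (Finset.mem_erase.2 ⟨hk0.ne', hk⟩)
      rw [div_le_iff₀ (by exact_mod_cast hk0)] at this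
      linarith
  refine ⟨s, ⟨0, Polynomial.mem_support_iff.2 h0, j, hjL, Nat.pos_of_ne_zero hj0, ?_, ?_⟩, hle⟩
  · have hjs : s * j = ord (L.coeff 0) - ord (L.coeff j) :=
      div_mul_cancel₀ _ (by exact_mod_cast hj0)
    simp [hjs]
  · simpa using hle

theorem exists_isSlope_of_natDegree (h0 : L.coeff 0 ≠ 0) (hd : 0 < L.natDegree) :
    ∃ s, IsSlope L s ∧ ∀ k ∈ L.support,
      ord (L.coeff L.natDegree) + s * L.natDegree ≤ ord (L.coeff k) + s * k := by
  have hdeg : L.natDegree ∈ L.support :=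
    Polynomial.natDegree_mem_support_of_nonzero (by rintro rfl; simp at hd)
  obtain ⟨i, hi, hmin⟩ := Finset.exists_min_image (L.support.erase L.natDegree)
    (fun k => ((ord (L.coeff k) : ℚ) - ord (L.coeff L.natDegree)) / (L.natDegree - k))
    ⟨0, Finset.mem_erase.2 ⟨hd.ne, Polynomial.mem_support_iff.2 h0⟩⟩
  obtain ⟨hid, hiL⟩ := Finset.mem_erase.1 hi
  have hlt : ∀ k ∈ L.support, k ≠ L.natDegree → (0 : ℚ) < L.natDegree - k := fun k hk hkd =>
    sub_pos.2 (by exact_mod_cast lt_of_le_of_ne (Polynomial.le_natDegree_of_mem_supp k hk) hkd)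
  set s := ((ord (L.coeff i) : ℚ) - ord (L.coeff L.natDegree)) / (L.natDegree - i)
  have his : s * (L.natDegree - i) = ord (L.coeff i) - ord (L.coeff L.natDegree) :=
    div_mul_cancel₀ _ (hlt i hiL hid).ne'
  have hle : ∀ k ∈ L.support,
      ord (L.coeff L.natDegree) + s * L.natDegree ≤ ord (L.coeff k) + s * k := by
    intro k hk
    by_cases hkd : k = L.natDegree
    · rw [hkd]
    · have := hmin k (Finset.mem_erase.2 ⟨hkd, hk⟩)
      rw [le_div_iff₀ (hlt k hk hkd)] at this
      linarith
  have hi' : (ord (L.coeff i) : ℚ) + s * i = ord (L.coeff L.natDegree) + s * L.natDegree := by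
    linarith
  exact ⟨s, ⟨i, hiL, L.natDegree, hdeg,
    lt_of_le_of_ne (Polynomial.le_natDegree_of_mem_supp i hiL) hid, hi', hi' ▸ hle⟩, hle⟩

end NewtonPolygon

/-- The series in which all coefficients of `z ^ k` with `k < r` vanish. -/
def coefFiltration (r : ℚ) : Submodule ℂ K where
  carrier := {f | ∀ k : ℤ, (k : ℚ) < r → coef f k = 0}
  add_mem' hf hg k hk := by rw [coef_add, hf k hk, hg k hk, add_zero]
  zero_mem' _ _ := rfl
  smul_mem' c f hf k hk := by rw [coef_smul, hf k hk, mul_zero]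

theorem mem_coefFiltration {r : ℚ} {f : K} :
    f ∈ coefFiltration r ↔ ∀ k : ℤ, (k : ℚ) < r → coef f k = 0 :=
  Iff.rfl

theorem mul_mem_coefFiltration {r s : ℚ} {f g : K} (hf : f ∈ coefFiltration r)
    (hg : g ∈ coefFiltration s) : f * g ∈ coefFiltration (r + s) := fun k hk =>
  coef_mul_of_lt (a := ⌈r⌉) (b := ⌈s⌉) (fun k hk => hf k (Int.lt_ceil.1 hk))
    (fun k hk => hg k (Int.lt_ceil.1 hk)) (by
      have := Int.le_ceil r
      have := Int.le_ceil s
      rw [← Int.cast_lt (R := ℚ)]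
      push_cast
      linarith)

theorem dilate_mem_coefFiltration {r : ℚ} {f : K} (hf : f ∈ coefFiltration r) (a : ℂˣ) :
    dilate a f ∈ coefFiltration r := fun k hk => by rw [coef_dilate, hf k hk, mul_zero]

theorem mem_coefFiltration_of_le_ord {r : ℚ} {f : K} (h : r ≤ ord f) : f ∈ coefFiltration r :=
  fun _ hk => coef_eq_zero_of_lt_ord (by exact_mod_cast hk.trans_le h)

theorem monomial_mul_mem_coefFiltration_iff {r : ℚ} {l : ℤ} {f : K} :
    monomial l 1 * f ∈ coefFiltration r ↔ f ∈ coefFiltration (r - l) := by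
  simp only [mem_coefFiltration, coef_monomial_mul, one_mul]
  refine ⟨fun h k hk => ?_, fun h k hk => h _ (by push_cast; linarith)⟩
  simpa using h (k + l) (by push_cast; linarith)

theorem ord_monomial (k : ℤ) {c : ℂ} (hc : c ≠ 0) : ord (monomial k c) = k :=
  HahnSeries.order_single hc

theorem ord_one : ord 1 = 0 := HahnSeries.order_one

theorem ord_inv {f : K} (hf : f ≠ 0) : ord f⁻¹ = -ord f := by
  have h := congrArg (fun g : K => ord g) (mul_inv_cancel₀ hf)
  simp only [ord_one] at h
  rw [eq_neg_iff_add_eq_zero, add_comm, ← h]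
  exact (HahnSeries.order_mul (by simpa using hf) (by simpa using hf)).symm

section WeightFiltration

variable {τ : ℂ} {M : Type*} [AddCommGroup M] [Module K M] [Module ℂ M] [IsScalarTower ℂ K M]
  {d : ℕ} (B : Module.Basis (Fin d) K M) (s : ℚ)

/-- The filtration of `M` for which `z` has weight `1` and the `i`-th basis vector has weight
`s * i`. The lines of slope `-s` in the Newton polygon are its level sets. -/
def weightFiltration (r : ℚ) : Submodule ℂ M :=
  ⨅ i : Fin d, (coefFiltration (r - s * (i : ℕ))).comap ((B.coord i).restrictScalars ℂ)

variable {B s}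

theorem mem_weightFiltration {r : ℚ} {x : M} : x ∈ weightFiltration B s r ↔
    ∀ i : Fin d, B.repr x i ∈ coefFiltration (r - s * (i : ℕ)) := by
  simp [weightFiltration]

theorem smul_basis_mem_weightFiltration {r : ℚ} {f : K} {i : Fin d}
    (hf : f ∈ coefFiltration (r - s * (i : ℕ))) : f • B i ∈ weightFiltration B s r := by
  classical
  refine mem_weightFiltration.2 fun j => ?_
  rw [map_smul, Finsupp.smul_apply, B.repr_self, Finsupp.single_apply]
  split_ifs with h
  · simpa [← h] using hf
  · simp

theorem monomial_smul_mem_weightFiltration_iff {r : ℚ} {l : ℤ} {x : M} :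
    monomial l (1 : ℂ) • x ∈ weightFiltration B s r ↔ x ∈ weightFiltration B s (r - l) := by
  simp only [mem_weightFiltration, map_smul, Finsupp.smul_apply, smul_eq_mul,
    monomial_mul_mem_coefFiltration_iff, sub_right_comm]

theorem exists_basis_inLattice_iff_mem_weightFiltration (B : Module.Basis (Fin d) K M) (s : ℚ) :
    ∃ b : Module.Basis (Fin d) K M,
      ∀ (j : ℤ) (x : M), InLattice b j x ↔ x ∈ weightFiltration B s j := by
  let w : Fin d → Kˣ := fun i => Units.mk (monomial (-⌊s * (i : ℕ)⌋) 1) (monomial ⌊s * (i : ℕ)⌋ 1)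
    (by rw [monomial_mul_monomial, neg_add_cancel, mul_one, monomial_zero_one])
    (by rw [monomial_mul_monomial, add_neg_cancel, mul_one, monomial_zero_one])
  have hw : ∀ x k i, vcoef (B.unitsSMul w) x k i = coef (B.repr x i) (k - ⌊s * (i : ℕ)⌋) := by
    intro x k i
    rw [vcoef, Module.Basis.repr_unitsSMul, Units.smul_def, smul_eq_mul]
    exact (coef_monomial_mul _ _ _ _).trans (one_mul _)
  refine ⟨B.unitsSMul w, fun j x => ⟨fun h => mem_weightFiltration.2 fun i k hk => ?_,
    fun h k hk => funext fun i => ?_⟩⟩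
  · have hfloor := Int.floor_le (s * (i : ℕ))
    have hlt : ((k + ⌊s * (i : ℕ)⌋ : ℤ) : ℚ) < j := by push_cast; linarith
    simpa [hw] using congrFun (h (k + ⌊s * (i : ℕ)⌋) (by exact_mod_cast hlt)) i
  · have hfloor := Int.lt_floor_add_one (s * (i : ℕ))
    have hle : (k : ℚ) + 1 ≤ j := by exact_mod_cast hk
    rw [hw]
    exact mem_weightFiltration.1 h i _ (by push_cast; linarith)

/-- The vectors `e, Φ e, …, Φ ^ (d - 1) e` form the basis `B`, and `∑ a_i Φ ^ i e = 0` where all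
points `(i, v(a_i))` lie above the line of slope `-s` through the endpoints `(0, v(a_0))` and
`(d, 0)`. -/
structure IsIsoclinicRelation (Φ : M →ₛₗ[φ τ] M) (B : Module.Basis (Fin d) K M) (s : ℚ) (e : M)
    (a : ℕ → K) : Prop where
  basis_eq : ∀ i : Fin d, B i = (complexEnd Φ ^ (i : ℕ)) e
  leading_eq_one : a d = 1
  relation : ∑ i ∈ Finset.range (d + 1), a i • (complexEnd Φ ^ i) e = 0
  coeff_mem : ∀ k ≤ d, a k ∈ coefFiltration (s * (d - k))
  coeff_zero_ne_zero : a 0 ≠ 0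
  inv_coeff_zero_mem : (a 0)⁻¹ ∈ coefFiltration (-(s * d))

namespace IsIsoclinicRelation

variable {Φ : M →ₛₗ[φ τ] M} {e : M} {a : ℕ → K} (h : IsIsoclinicRelation Φ B s e a)
include h

theorem smul_pow_apply_mem {r : ℚ} {i : ℕ} (hi : i ≤ d) {f : K}
    (hf : f ∈ coefFiltration (r - s * i)) :
    f • (complexEnd Φ ^ i) e ∈ weightFiltration B s r := by
  rcases lt_or_eq_of_le hi with hid | rfl
  · simpa only [h.basis_eq] using smul_basis_mem_weightFiltration (B := B) (i := ⟨i, hid⟩) hf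
  · have hrel := h.relation
    rw [Finset.sum_range_succ, h.leading_eq_one, one_smul] at hrel
    rw [eq_neg_of_add_eq_zero_right hrel, smul_neg, Finset.smul_sum]
    refine Submodule.neg_mem _ (Submodule.sum_mem _ fun k hk => ?_)
    have hki := Finset.mem_range.1 hk
    rw [smul_smul, ← h.basis_eq ⟨k, hki⟩]
    refine smul_basis_mem_weightFiltration ?_
    convert mul_mem_coefFiltration hf (h.coeff_mem k hki.le) using 2
    ring

theorem map_weightFiltration_le (r : ℚ) :
    (weightFiltration B s r).map (complexEnd Φ) ≤ weightFiltration B s (r + s) := by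
  rw [Submodule.map_le_iff_le_comap]
  intro x hx
  rw [Submodule.mem_comap, complexEnd_apply, ← B.sum_repr x, map_sum]
  refine Submodule.sum_mem _ fun i _ => ?_
  rw [map_smulₛₗ, φ_apply, h.basis_eq, ← complexEnd_pow_succ_apply]
  refine h.smul_pow_apply_mem i.2 ?_
  convert dilate_mem_coefFiltration (mem_weightFiltration.1 hx i) (qpow τ 1) using 2
  push_cast
  ring

theorem smul_pow_succ_apply_mem_map {r : ℚ} {i : ℕ} (hi : i < d) {f : K}
    (hf : f ∈ coefFiltration (r - s * i)) :
    f • (complexEnd Φ ^ (i + 1)) e ∈ (weightFiltration B s r).map (complexEnd Φ) :=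
  ⟨dilate (qpow τ 1)⁻¹ f • (complexEnd Φ ^ i) e,
    h.smul_pow_apply_mem hi.le (dilate_mem_coefFiltration hf _), by
      rw [complexEnd_apply, map_smulₛₗ, φ_apply, dilate_inv_dilate, complexEnd_pow_succ_apply]⟩

theorem smul_mem_map {r : ℚ} {f : K} (hf : f ∈ coefFiltration (r + s)) :
    f • e ∈ (weightFiltration B s r).map (complexEnd Φ) := by
  have he : e = -∑ k ∈ Finset.range d, ((a 0)⁻¹ * a (k + 1)) • (complexEnd Φ ^ (k + 1)) e := by
    have hrel := h.relation
    rw [Finset.sum_range_succ', pow_zero, Module.End.one_apply] at hrel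
    simp only [mul_smul, ← Finset.smul_sum]
    rw [← smul_neg, ← eq_neg_of_add_eq_zero_right hrel, smul_smul,
      inv_mul_cancel₀ h.coeff_zero_ne_zero, one_smul]
  rw [he, smul_neg, Finset.smul_sum]
  refine Submodule.neg_mem _ (Submodule.sum_mem _ fun k hk => ?_)
  have hkd := Finset.mem_range.1 hk
  rw [smul_smul]
  refine h.smul_pow_succ_apply_mem_map hkd ?_
  convert mul_mem_coefFiltration hf
    (mul_mem_coefFiltration h.inv_coeff_zero_mem (h.coeff_mem (k + 1) hkd)) using 2
  push_cast
  ring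

theorem map_weightFiltration (r : ℚ) :
    (weightFiltration B s r).map (complexEnd Φ) = weightFiltration B s (r + s) := by
  refine le_antisymm (h.map_weightFiltration_le r) fun x hx => ?_
  rw [← B.sum_repr x]
  refine Submodule.sum_mem _ fun i _ => ?_
  have hf := mem_weightFiltration.1 hx i
  rw [h.basis_eq]
  rcases Nat.eq_zero_or_pos (i : ℕ) with hi | hi
  · rw [hi, pow_zero, Module.End.one_apply]
    exact h.smul_mem_map (by simpa [hi] using hf)
  · obtain ⟨k, hk⟩ := Nat.exists_eq_add_of_le' hi
    rw [hk]
    refine h.smul_pow_succ_apply_mem_map (by lia) ?_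
    convert hf using 2
    rw [hk]
    push_cast
    ring

theorem pow_apply_mem_weightFiltration_iff (hΦ : Function.Injective Φ) (i : ℕ) (r : ℚ) (x : M) :
    (complexEnd Φ ^ i) x ∈ weightFiltration B s (r + s * i) ↔ x ∈ weightFiltration B s r := by
  induction i generalizing r with
  | zero => simp
  | succ i ih =>
    rw [complexEnd_pow_succ_apply, Nat.cast_succ, mul_add, mul_one, ← add_assoc,
      ← h.map_weightFiltration, ← complexEnd_apply, Submodule.mem_map, ← ih r]
    exact ⟨fun ⟨y, hy, hyx⟩ => hΦ hyx ▸ hy, fun hx => ⟨_, hx, rfl⟩⟩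

theorem slopeOperator_mem_weightFiltration_iff (hΦ : Function.Injective Φ) {t : ℤ} {n : ℕ}
    (hst : s * n = t) (r : ℚ) (x : M) :
    slopeOperator Φ t n x ∈ weightFiltration B s r ↔ x ∈ weightFiltration B s r := by
  rw [slopeOperator_apply, monomial_smul_mem_weightFiltration_iff, Int.cast_neg, sub_neg_eq_add,
    ← hst, h.pow_apply_mem_weightFiltration_iff hΦ]

theorem iSup_eigenspan_slopeOperator_eq_top (hτ : 0 < τ.im) (hΦ : Function.Injective Φ) {t : ℤ}
    {n : ℕ} (hn : n ≠ 0) (hst : s * n = t) :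
    ⨆ (μ : ℂ) (_ : μ ≠ 0), eigenspan (slopeOperator Φ t n) μ = ⊤ := by
  obtain ⟨b, hb⟩ := exists_basis_inLattice_iff_mem_weightFiltration B s
  have hT := h.slopeOperator_mem_weightFiltration_iff hΦ hst
  refine iSup_eigenspan_eq_top (b := b) (isDilationSemilinear_slopeOperator Φ t n)
    (fun x => ?_) ?_ (fun x _ => ?_)
  · rw [hb, hb, hT]
    exact id
  · rw [Units.val_pow_eq_pow_val, norm_pow]
    exact pow_lt_one₀ (norm_nonneg _) (norm_qpow_lt_one hτ) hn
  · rw [hb, hb, hT]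
    exact id

end IsIsoclinicRelation

theorem IsPresentedBy.exists_isIsoclinicRelation {Φ : M →ₛₗ[φ τ] M} {L : Polynomial K}
    (hL : IsPresentedBy Φ L) (hd : 0 < L.natDegree) (hs : ∀ s', IsSlope L s' → s' = s) :
    ∃ (B : Module.Basis (Fin L.natDegree) K M) (e : M), IsIsoclinicRelation Φ B s e L.coeff := by
  obtain ⟨hmon, h0, e, hli, hspan, hrel⟩ := hL
  obtain ⟨s₀, hs₀, hfirst⟩ := exists_isSlope_of_coeff_zero h0 hd
  obtain ⟨s₁, hs₁, hlast⟩ := exists_isSlope_of_natDegree h0 hd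
  rw [hs s₀ hs₀] at hfirst
  rw [hs s₁ hs₁, hmon.coeff_natDegree, ord_one] at hlast
  refine ⟨Module.Basis.mk hli hspan.ge, e, fun i => ?_, hmon.coeff_natDegree, ?_, fun k _ => ?_, h0,
    mem_coefFiltration_of_le_ord ?_⟩
  · rw [Module.Basis.mk_apply, complexEnd_pow_apply]
  · simpa only [complexEnd_pow_apply] using hrel
  · by_cases hk : L.coeff k = 0
    · rw [hk]
      exact Submodule.zero_mem _
    · refine mem_coefFiltration_of_le_ord ?_
      have := hlast k (Polynomial.mem_support_iff.2 hk)
      push_cast at this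
      linarith
  · have := hfirst _ (Polynomial.natDegree_mem_support_of_nonzero hmon.ne_zero)
    rw [hmon.coeff_natDegree, ord_one, Int.cast_zero, zero_add] at this
    rw [ord_inv h0, Int.cast_neg]
    linarith

end WeightFiltration

section Translates

variable {τ : ℂ} {t : ℤ} {n : ℕ} {lam : ℂ}

theorem exists_eq_mul_add_mul (hcop : IsCoprime t (n : ℤ)) (hn : n ≠ 0) (k : ℤ) :
    ∃ (i : Fin n) (l : ℤ), k = n * l + t * (i : ℕ) := by
  obtain ⟨a, b, hab⟩ := hcop
  have hpos : (0 : ℤ) < n := by lia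
  refine ⟨⟨(k * a % n).toNat, ?_⟩, k * b + t * (k * a / n), ?_⟩
  · have := Int.emod_lt_of_pos (k * a) hpos
    lia
  · have hdiv := Int.emod_add_mul_ediv (k * a) n
    rw [Int.toNat_of_nonneg (Int.emod_nonneg _ hpos.ne')]
    linear_combination (-k) * hab - t * hdiv

theorem eq_of_qpow_zpow_mul_eq (hτ : 0 < τ.im) (hcop : IsCoprime t (n : ℤ)) (hlam : lam ≠ 0)
    {i j : Fin n} {k : ℤ}
    (h : ((qpow τ 1 ^ n : ℂˣ) : ℂ) ^ k * ((qpow τ 1 : ℂ) ^ (t * (i : ℕ)) * lam) =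
      (qpow τ 1 : ℂ) ^ (t * (j : ℕ)) * lam) : i = j ∧ k = 0 := by
  have hexp : n * k + t * (i : ℕ) - t * (j : ℕ) = 0 := by
    refine qpow_zpow_eq_one hτ ?_
    rw [zpow_sub₀ (Units.ne_zero _), zpow_add₀ (Units.ne_zero _), zpow_mul, zpow_natCast,
      ← Units.val_pow_eq_pow_val, div_eq_one_iff_eq (zpow_ne_zero _ (Units.ne_zero _))]
    exact mul_right_cancel₀ hlam (by rw [mul_assoc, h])
  have hdvd : (n : ℤ) ∣ (j : ℕ) - (i : ℕ) :=
    hcop.symm.dvd_of_dvd_mul_left ⟨k, by linear_combination -hexp⟩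
  have hij : i = j := by
    obtain ⟨hi, hj⟩ := And.intro i.2 j.2
    have := Int.eq_zero_of_abs_lt_dvd hdvd (by clear hdvd hexp; rw [abs_lt]; omega)
    exact Fin.ext (by omega)
  subst hij
  have hn : (n : ℤ) ≠ 0 := by have := i.pos; lia
  exact ⟨rfl, (mul_eq_zero.1 (by linear_combination hexp : (n : ℤ) * k = 0)).resolve_left hn⟩

theorem qpow_zpow_mul_injective (hτ : 0 < τ.im) (hcop : IsCoprime t (n : ℤ)) (hlam : lam ≠ 0) :
    Function.Injective fun i : Fin n => (qpow τ 1 : ℂ) ^ (t * (i : ℕ)) * lam := fun i j h =>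
  (eq_of_qpow_zpow_mul_eq hτ hcop hlam (k := 0) (by simpa using h)).1

theorem isInequivalent_range_qpow_zpow_mul (hτ : 0 < τ.im) (hcop : IsCoprime t (n : ℤ))
    (hlam : lam ≠ 0) : IsInequivalent (qpow τ 1 ^ n)
      (Set.range fun i : Fin n => (qpow τ 1 : ℂ) ^ (t * (i : ℕ)) * lam) := by
  rintro _ k ⟨i, rfl⟩ ⟨j, hj⟩
  exact (eq_of_qpow_zpow_mul_eq hτ hcop hlam hj.symm).2

variable {M : Type*} [AddCommGroup M] [Module K M] [Module ℂ M] [IsScalarTower ℂ K M]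
  {Φ : M →ₛₗ[φ τ] M} {U W : Submodule ℂ M}

theorem linearIndependent_complexEnd_pow (hτ : 0 < τ.im) (hΦ : Function.Injective Φ)
    (hcop : IsCoprime t (n : ℤ)) (hlam : lam ≠ 0) {κ : Type*} {v : κ → M}
    (hv : LinearIndependent ℂ v) (hvlam : ∀ j, v j ∈ (slopeOperator Φ t n).maxGenEigenspace lam) :
    LinearIndependent K fun ij : Fin n × κ => (complexEnd Φ ^ (ij.1 : ℕ)) (v ij.2) := by
  have hmem : ∀ (i : Fin n) (j : κ), (complexEnd Φ ^ (i : ℕ)) (v j) ∈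
      (slopeOperator Φ t n).maxGenEigenspace ((qpow τ 1 : ℂ) ^ (t * (i : ℕ)) * lam) := fun i j =>
    (complexEnd_pow_mem_maxGenEigenspace_iff hΦ).2 (hvlam j)
  have hle : ∀ i : Fin n, Submodule.span ℂ (Set.range fun j => (complexEnd Φ ^ (i : ℕ)) (v j)) ≤
      (slopeOperator Φ t n).maxGenEigenspace ((qpow τ 1 : ℂ) ^ (t * (i : ℕ)) * lam) := fun i =>
    Submodule.span_le.2 (Set.range_subset_iff.2 (hmem i))
  have hind := (slopeOperator Φ t n).independent_maxGenEigenspace.comp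
    (qpow_zpow_mul_injective hτ hcop hlam)
  have hli : LinearIndependent ℂ fun ij : Σ _ : Fin n, κ =>
      (complexEnd Φ ^ (ij.1 : ℕ)) (v ij.2) :=
    linearIndependent_iUnion_finite (f := fun (i : Fin n) j => (complexEnd Φ ^ (i : ℕ)) (v j))
      (fun i => hv.map' _ (LinearMap.ker_eq_bot.2 (complexEnd_pow_injective hΦ i)))
      (fun i s _ hi => (hind.disjoint_biSup hi).mono (hle i) (iSup₂_mono fun j _ => hle j))
  refine (isDilationSemilinear_slopeOperator Φ t n).linearIndependent_of_mem_genSum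
    (isInequivalent_range_qpow_zpow_mul hτ hcop hlam)
    ((linearIndependent_equiv (Equiv.sigmaEquivProd (Fin n) κ)).1 hli) fun ij => ?_
  exact maxGenEigenspace_le_genSum _ (Set.mem_range_self ij.1) (hmem ij.1 ij.2)

theorem finite_maxGenEigenspace [Module.Finite K M] (hτ : 0 < τ.im) (hΦ : Function.Injective Φ)
    (hcop : IsCoprime t (n : ℤ)) (hn : n ≠ 0) (hlam : lam ≠ 0) :
    Module.Finite ℂ ((slopeOperator Φ t n).maxGenEigenspace lam) ∧
      n * Module.finrank ℂ ((slopeOperator Φ t n).maxGenEigenspace lam) ≤ Module.finrank K M := by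
  obtain ⟨κ, b⟩ := Module.Free.exists_basis ℂ ((slopeOperator Φ t n).maxGenEigenspace lam)
  have hli := linearIndependent_complexEnd_pow hτ hΦ hcop hlam
    (b.linearIndependent.map' _ (Submodule.ker_subtype _)) fun j => (b j).2
  have : Nonempty (Fin n) := ⟨⟨0, Nat.pos_of_ne_zero hn⟩⟩
  have := hli.finite
  have : Finite κ := Finite.prod_right (Fin n)
  have := Fintype.ofFinite κ
  refine ⟨Module.Finite.of_basis b, ?_⟩
  simpa [Module.finrank_eq_card_basis b] using hli.fintype_card_le_finrank

/-- The `K`-span of `U, Φ U, …, Φ ^ (n - 1) U`. For `U` stable under `z ^ (-t) Φ ^ n` this is a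
difference submodule, the one induced from `U`. -/
def translateSpan (Φ : M →ₛₗ[φ τ] M) (n : ℕ) (U : Submodule ℂ M) : Submodule K M :=
  ⨆ i : Fin n, Submodule.span K (U.map (complexEnd Φ ^ (i : ℕ)) : Set M)

theorem translateSpan_le {P : Submodule K M} :
    translateSpan Φ n U ≤ P ↔ ∀ i < n, ∀ x ∈ U, (complexEnd Φ ^ i) x ∈ P := by
  simp only [translateSpan, iSup_le_iff, Submodule.span_le, Submodule.map_coe, Set.image_subset_iff,
    Fin.forall_iff]
  rfl

theorem complexEnd_pow_mem_translateSpan {i : ℕ} (hi : i < n) {x : M} (hx : x ∈ U) :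
    (complexEnd Φ ^ i) x ∈ translateSpan Φ n U :=
  translateSpan_le.1 le_rfl i hi x hx

theorem apply_mem_translateSpan (hU : ∀ x ∈ U, slopeOperator Φ t n x ∈ U) {x : M}
    (hx : x ∈ translateSpan Φ n U) : Φ x ∈ translateSpan Φ n U := by
  suffices h : translateSpan Φ n U ≤ (translateSpan Φ n U).comap Φ from h hx
  refine translateSpan_le.2 fun i hi x hx => ?_
  rw [Submodule.mem_comap, ← complexEnd_pow_succ_apply]
  rcases lt_or_eq_of_le (show i + 1 ≤ n from hi) with h | h
  · exact complexEnd_pow_mem_translateSpan h hx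
  · rw [h, complexEnd_pow_eq_smul_slopeOperator Φ t n]
    exact Submodule.smul_mem _ _
      (complexEnd_pow_mem_translateSpan (i := 0) (Nat.zero_lt_of_lt hi) (hU x hx))

theorem translateSpan_sup_le :
    translateSpan Φ n (U ⊔ W) ≤ translateSpan Φ n U ⊔ translateSpan Φ n W :=
  translateSpan_le.2 fun i hi x hx => by
    obtain ⟨u, hu, w, hw, rfl⟩ := Submodule.mem_sup.1 hx
    rw [map_add]
    exact Submodule.add_mem_sup (complexEnd_pow_mem_translateSpan hi hu)
      (complexEnd_pow_mem_translateSpan hi hw)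

theorem translateSpan_span_range {κ : Type*} (v : κ → M) :
    translateSpan Φ n (Submodule.span ℂ (Set.range v)) =
      Submodule.span K (Set.range fun ij : Fin n × κ => (complexEnd Φ ^ (ij.1 : ℕ)) (v ij.2)) := by
  refine le_antisymm (translateSpan_le.2 fun i hi x hx => ?_) (Submodule.span_le.2 ?_)
  · let P := Submodule.span K
      (Set.range fun ij : Fin n × κ => (complexEnd Φ ^ (ij.1 : ℕ)) (v ij.2))
    suffices h : Submodule.span ℂ (Set.range v) ≤ (P.restrictScalars ℂ).comap (complexEnd Φ ^ i)
      from h hx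
    refine Submodule.span_le.2 (Set.range_subset_iff.2 fun j => ?_)
    exact Submodule.subset_span ⟨(⟨i, hi⟩, j), rfl⟩
  · rintro _ ⟨⟨i, j⟩, rfl⟩
    exact complexEnd_pow_mem_translateSpan i.2 (Submodule.subset_span ⟨j, rfl⟩)

theorem translateSpan_maxGenEigenspace (hΦ : Function.Bijective Φ) :
    translateSpan Φ n ((slopeOperator Φ t n).maxGenEigenspace lam) =
      ⨆ i : Fin n, eigenspan (slopeOperator Φ t n) ((qpow τ 1 : ℂ) ^ (t * (i : ℕ)) * lam) := by
  simp only [translateSpan, map_complexEnd_pow_maxGenEigenspace hΦ, eigenspan]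

theorem disjoint_translateSpan (hτ : 0 < τ.im) (hΦ : Function.Injective Φ)
    (hcop : IsCoprime t (n : ℤ)) (hlam : lam ≠ 0)
    (hU : U ≤ (slopeOperator Φ t n).maxGenEigenspace lam)
    (hW : W ≤ (slopeOperator Φ t n).maxGenEigenspace lam) (hUW : Disjoint U W) :
    Disjoint (translateSpan Φ n U) (translateSpan Φ n W) := by
  obtain ⟨κ, b⟩ := Module.Free.exists_basis ℂ U
  obtain ⟨ι, d⟩ := Module.Free.exists_basis ℂ W
  have hspan (P : Submodule ℂ M) {κ : Type _} (b : Module.Basis κ ℂ P) :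
      Submodule.span ℂ (Set.range (P.subtype ∘ b)) = P := by
    rw [Set.range_comp, Submodule.span_image, b.span_eq, Submodule.map_top, Submodule.range_subtype]
  have hli := linearIndependent_complexEnd_pow hτ hΦ hcop hlam
    ((b.linearIndependent.map' _ (Submodule.ker_subtype U)).sum_type
      (d.linearIndependent.map' _ (Submodule.ker_subtype W)) (by rwa [hspan U b, hspan W d]))
    (Sum.rec (fun j => hU (b j).2) fun j => hW (d j).2)
  have := (linearIndependent_sum.1 ((linearIndependent_equiv
    (Equiv.prodSumDistrib (Fin n) κ ι).symm).2 hli)).2.2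
  rw [← hspan U b, ← hspan W d, translateSpan_span_range, translateSpan_span_range]
  exact this

end Translates

section NilpotentPart

variable {k E : Type*} [Field k] [AddCommGroup E] [Module k E] (T : Module.End k E) (lam : k)

theorem sub_smul_one_apply_mem_maxGenEigenspace {x : E} (hx : x ∈ T.maxGenEigenspace lam) :
    (T - lam • 1) x ∈ T.maxGenEigenspace lam :=
  T.mapsTo_maxGenEigenspace_of_comm (Algebra.mul_sub_algebraMap_commutes T lam) lam hx

/-- The restriction of `T - λ` to the generalized eigenspace of `T` for `λ`. -/
def nilpotentPart : Module.End k (T.maxGenEigenspace lam) :=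
  (T - lam • 1).restrict fun _ => sub_smul_one_apply_mem_maxGenEigenspace T lam

theorem coe_nilpotentPart_pow_apply (j : ℕ) (x : T.maxGenEigenspace lam) :
    ((nilpotentPart T lam ^ j) x : E) = ((T - lam • 1) ^ j) x := by
  rw [nilpotentPart, Module.End.pow_restrict]
  rfl

theorem isNilpotent_nilpotentPart [Module.Finite k (T.maxGenEigenspace lam)] :
    IsNilpotent (nilpotentPart T lam) :=
  Module.End.isNilpotent_iff_of_finite.2 fun x => by
    obtain ⟨j, hj⟩ := (T.mem_maxGenEigenspace lam _).1 x.2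
    exact ⟨j, Subtype.ext ((coe_nilpotentPart_pow_apply T lam j x).trans hj)⟩

theorem apply_sub_smul_one_pow_apply (j : ℕ) (v : E) :
    T (((T - lam • 1) ^ j) v) = ((T - lam • 1) ^ (j + 1)) v + lam • ((T - lam • 1) ^ j) v := by
  rw [pow_succ', Module.End.mul_apply]
  exact (sub_add_cancel _ _).symm

variable {T lam}

theorem exists_span_chain_eq_maxGenEigenspace [Module.Finite k (T.maxGenEigenspace lam)]
    [Nontrivial (T.maxGenEigenspace lam)]
    (hind : ∀ U W : Submodule k E, (∀ x ∈ U, T x ∈ U) → (∀ x ∈ W, T x ∈ W) → Disjoint U W →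
      U ⊔ W = T.maxGenEigenspace lam → U = T.maxGenEigenspace lam ∨ W = T.maxGenEigenspace lam) :
    ∃ m v, ((T - lam • 1) ^ m) v = 0 ∧ ((T - lam • 1) ^ (m - 1)) v ≠ 0 ∧
      Submodule.span k (Set.range fun j : Fin m => ((T - lam • 1) ^ (j : ℕ)) v) =
        T.maxGenEigenspace lam := by
  set V := T.maxGenEigenspace lam
  have hT {U : Submodule k V} (hU : ∀ x ∈ U, nilpotentPart T lam x ∈ U) :
      ∀ x ∈ U.map V.subtype, T x ∈ U.map V.subtype := by
    rintro _ ⟨x, hx, rfl⟩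
    refine ⟨nilpotentPart T lam x + lam • x, U.add_mem (hU x hx) (U.smul_mem _ hx), ?_⟩
    exact sub_add_cancel (T x) (lam • (x : E))
  have heq {U : Submodule k V} (hU : U.map V.subtype = V) : U = ⊤ :=
    Submodule.map_injective_of_injective V.subtype_injective (by simpa using hU)
  obtain ⟨m, v, hm, hv, hspan⟩ := exists_span_chain_eq_top (isNilpotent_nilpotentPart T lam)
    fun U W hU hW hUW =>
      (hind _ _ (hT hU) (hT hW) (Submodule.disjoint_map V.subtype_injective hUW.disjoint) (by
        rw [← Submodule.map_sup, hUW.sup_eq_top, Submodule.map_subtype_top])).imp heq heq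
  refine ⟨m, v, by rw [← coe_nilpotentPart_pow_apply, hm]; rfl,
    fun h => hv (Subtype.ext ((coe_nilpotentPart_pow_apply T lam _ v).trans h)), ?_⟩
  have := congrArg (Submodule.map V.subtype) hspan
  rw [Submodule.map_span, ← Set.range_comp, Submodule.map_subtype_top] at this
  simpa only [Function.comp_def, Submodule.subtype_apply, coe_nilpotentPart_pow_apply] using this

theorem mem_maxGenEigenspace_of_add_mem {U W : Submodule k E} (hU : ∀ x ∈ U, T x ∈ U)
    (hW : ∀ x ∈ W, T x ∈ W) (hUW : Disjoint U W) {u w : E} (hu : u ∈ U) (hw : w ∈ W)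
    (h : u + w ∈ T.maxGenEigenspace lam) : u ∈ T.maxGenEigenspace lam := by
  rw [Module.End.mem_maxGenEigenspace] at h ⊢
  obtain ⟨j, hj⟩ := h
  have hpow {P : Submodule k E} (hP : ∀ x ∈ P, T x ∈ P) {x : E} (hx : x ∈ P) :
      ((T - lam • 1) ^ j) x ∈ P :=
    Module.End.pow_apply_mem_of_forall_mem (p := P) j
      (fun x hx => P.sub_mem (hP x hx) (P.smul_mem _ hx)) x hx
  rw [map_add] at hj
  exact ⟨j, Submodule.disjoint_def.1 hUW _ (hpow hU hu)
    (eq_neg_of_add_eq_zero_left hj ▸ W.neg_mem (hpow hW hw))⟩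

theorem maxGenEigenspace_le_or_le [Module.Finite k (T.maxGenEigenspace lam)] {m : ℕ} {v : E}
    (hv : ((T - lam • 1) ^ m) v = 0) (hne : ((T - lam • 1) ^ (m - 1)) v ≠ 0)
    (hm : Module.finrank k (T.maxGenEigenspace lam) ≤ m) {U W : Submodule k E}
    (hU : ∀ x ∈ U, T x ∈ U) (hW : ∀ x ∈ W, T x ∈ W) (hUW : IsCompl U W) :
    T.maxGenEigenspace lam ≤ U ∨ T.maxGenEigenspace lam ≤ W := by
  set V := T.maxGenEigenspace lam
  have hstable {P : Submodule k E} (hP : ∀ x ∈ P, T x ∈ P) (x : V)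
      (hx : x ∈ P.comap V.subtype) : nilpotentPart T lam x ∈ P.comap V.subtype :=
    P.sub_mem (hP x hx) (P.smul_mem _ hx)
  have hsup : U.comap V.subtype ⊔ W.comap V.subtype = ⊤ := by
    refine (Submodule.eq_top_iff').2 fun ⟨x, hx⟩ => ?_
    obtain ⟨u, hu, w, hw, rfl⟩ := Submodule.mem_sup.1
      (hUW.sup_eq_top.ge (Submodule.mem_top (x := x)))
    have huV := mem_maxGenEigenspace_of_add_mem hU hW hUW.disjoint hu hw hx
    exact Submodule.mem_sup.2 ⟨⟨u, huV⟩, hu, ⟨w, (V.add_mem_iff_right huV).1 hx⟩, hw, rfl⟩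
  have hvV : v ∈ V := (T.mem_maxGenEigenspace lam v).2 ⟨m, hv⟩
  refine (eq_top_or_eq_top_of_codisjoint_of_chain (isNilpotent_nilpotentPart T lam)
    (v := ⟨v, hvV⟩) (fun h => hne ?_) hm (hstable hU) (hstable hW) (codisjoint_iff.2 hsup)).imp
    Submodule.comap_subtype_eq_top.1 Submodule.comap_subtype_eq_top.1
  rw [← coe_nilpotentPart_pow_apply T lam _ ⟨v, hvV⟩, h, Submodule.coe_zero]

end NilpotentPart

section Splitting

variable {τ : ℂ} {M : Type*} [AddCommGroup M] [Module K M] {Φ : M →ₛₗ[φ τ] M}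

theorem IsIndecomposable.eq_top_or_eq_top (hind : IsIndecomposable Φ) (hΦ : Function.Injective Φ)
    {V W : Submodule K M} (hV : ∀ x ∈ V, Φ x ∈ V) (hW : ∀ x ∈ W, Φ x ∈ W) (hVW : IsCompl V W) :
    V = ⊤ ∨ W = ⊤ := by
  have hstable {V W : Submodule K M} (hV : ∀ x ∈ V, Φ x ∈ V) (hW : ∀ x ∈ W, Φ x ∈ W)
      (hVW : IsCompl V W) : IsDifferenceSubmodule Φ V := by
    refine fun x => ⟨fun hx => ?_, hV x⟩
    obtain ⟨v, hv, w, hw, rfl⟩ :=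
      Submodule.mem_sup.1 (hVW.sup_eq_top.ge (Submodule.mem_top (x := x)))
    have hΦw : Φ w = 0 := Submodule.disjoint_def.1 hVW.disjoint _
      ((V.add_mem_iff_right (hV v hv)).1 (by rwa [← map_add])) (hW w hw)
    rwa [hΦ (hΦw.trans (map_zero Φ).symm), add_zero]
  exact hind.2 V W (hstable hV hW hVW) (hstable hW hV hVW.symm) hVW

variable [Module ℂ M] [IsScalarTower ℂ K M] {t : ℤ} {n : ℕ}

/-- The sum of the `eigenspan`s of `z ^ (-t) Φ ^ n` for the eigenvalues whose class modulo `q ^ ℤ`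
lies in `A`. -/
def spectralPart (Φ : M →ₛₗ[φ τ] M) (t : ℤ) (n : ℕ)
    (A : Set (ℂˣ ⧸ Subgroup.zpowers (qpow τ 1))) : Submodule K M :=
  ⨆ (μ : ℂˣ) (_ : (μ : ℂˣ ⧸ Subgroup.zpowers (qpow τ 1)) ∈ A), eigenspan (slopeOperator Φ t n) μ

variable {A B : Set (ℂˣ ⧸ Subgroup.zpowers (qpow τ 1))}

theorem zpow_mul_eq_coe (g x : ℂˣ) (k : ℤ) :
    ((g ^ k * x : ℂˣ) : ℂˣ ⧸ Subgroup.zpowers g) = x :=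
  QuotientGroup.eq.2 ⟨-k, by simp⟩

theorem apply_mem_spectralPart (hΦ : Function.Injective Φ) {x : M}
    (hx : x ∈ spectralPart Φ t n A) : Φ x ∈ spectralPart Φ t n A := by
  suffices h : spectralPart Φ t n A ≤ (spectralPart Φ t n A).comap Φ from h hx
  refine iSup₂_le fun μ hμ => Submodule.span_le.2 fun x hx => ?_
  have hle := le_iSup₂_of_le (f := fun (μ : ℂˣ) (_ : (μ : ℂˣ ⧸ Subgroup.zpowers (qpow τ 1)) ∈ A) =>
    eigenspan (slopeOperator Φ t n) μ) (qpow τ 1 ^ t * μ) (by rwa [zpow_mul_eq_coe]) le_rfl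
  refine hle (Submodule.subset_span ?_)
  simpa using (complexEnd_pow_mem_maxGenEigenspace_iff hΦ (i := 1)).2 hx

theorem disjoint_spectralPart (hτ : 0 < τ.im) (hn : n ≠ 0) (hAB : Disjoint A B) :
    Disjoint (spectralPart Φ t n A) (spectralPart Φ t n B) := by
  have hT := isDilationSemilinear_slopeOperator Φ t n
  have hle : Subgroup.zpowers (qpow τ 1 ^ n) ≤ Subgroup.zpowers (qpow τ 1) :=
    Subgroup.zpowers_le.2 (Subgroup.npow_mem_zpowers _ _)
  have hrefine (A : Set (ℂˣ ⧸ Subgroup.zpowers (qpow τ 1))) : spectralPart Φ t n A ≤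
      ⨆ c ∈ Subgroup.quotientMapOfLE hle ⁻¹' A, eigenspan (slopeOperator Φ t n) (c.out : ℂ) := by
    refine iSup₂_le fun μ hμ => le_iSup₂_of_le
      (μ : ℂˣ ⧸ Subgroup.zpowers (qpow τ 1 ^ n)) hμ (le_of_eq ?_)
    obtain ⟨⟨_, k, rfl⟩, hk⟩ := QuotientGroup.mk_out_eq_mul (Subgroup.zpowers (qpow τ 1 ^ n)) μ
    rw [hk, mul_comm, Units.val_mul, Units.val_zpow_eq_zpow_val, hT.eigenspan_zpow_mul]
  exact ((hT.iSupIndep_eigenspan (not_isOfFinOrder_qpow_pow hτ hn)).disjoint_biSup_biSup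
    (hAB.preimage _)).mono (hrefine A) (hrefine B)

theorem spectralPart_singleton (hΦ : Function.Bijective Φ) (hcop : IsCoprime t (n : ℤ))
    (hn : n ≠ 0) (lam : ℂˣ) : spectralPart Φ t n {(lam : ℂˣ ⧸ Subgroup.zpowers (qpow τ 1))} =
      translateSpan Φ n ((slopeOperator Φ t n).maxGenEigenspace lam) := by
  rw [translateSpan_maxGenEigenspace hΦ]
  refine le_antisymm (iSup₂_le fun μ hμ => ?_) (iSup_le fun i => ?_)
  · obtain ⟨k, hk⟩ := QuotientGroup.eq.1 (Set.mem_singleton_iff.1 hμ).symm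
    obtain ⟨i, l, rfl⟩ := exists_eq_mul_add_mul hcop hn k
    obtain rfl : μ = (qpow τ 1 ^ n) ^ l * (qpow τ 1 ^ (t * (i : ℕ)) * lam) := by
      rw [← zpow_natCast (qpow τ 1) n, ← zpow_mul, ← mul_assoc, ← zpow_add]
      exact (eq_inv_mul_iff_mul_eq.1 hk).symm.trans (mul_comm _ _)
    rw [Units.val_mul, Units.val_zpow_eq_zpow_val,
      (isDilationSemilinear_slopeOperator Φ t n).eigenspan_zpow_mul]
    exact le_iSup_of_le i (by simp)
  · exact le_iSup₂_of_le (qpow τ 1 ^ (t * (i : ℕ)) * lam) (zpow_mul_eq_coe _ _ _) (by simp)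

theorem IsIndecomposable.exists_spectralPart_eq_top (hind : IsIndecomposable Φ) (hτ : 0 < τ.im)
    (hΦ : Function.Injective Φ) (hn : n ≠ 0)
    (htop : ⨆ (μ : ℂ) (_ : μ ≠ 0), eigenspan (slopeOperator Φ t n) μ = ⊤) :
    ∃ c, spectralPart Φ t n {c} = ⊤ := by
  have hnt := hind.1
  have hle {μ : ℂ} (hμ : μ ≠ 0) {A} (hA : (Units.mk0 μ hμ : ℂˣ ⧸ Subgroup.zpowers (qpow τ 1)) ∈ A) :
      eigenspan (slopeOperator Φ t n) μ ≤ spectralPart Φ t n A :=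
    le_iSup₂_of_le (Units.mk0 μ hμ) hA le_rfl
  obtain ⟨μ, hμ, hne⟩ : ∃ μ : ℂ, μ ≠ 0 ∧ eigenspan (slopeOperator Φ t n) μ ≠ ⊥ := by
    by_contra! h
    exact bot_ne_top ((iSup₂_eq_bot.2 h).symm.trans htop)
  let c : ℂˣ ⧸ Subgroup.zpowers (qpow τ 1) := (Units.mk0 μ hμ : ℂˣ)
  have hdisj : Disjoint (spectralPart Φ t n {c}) (spectralPart Φ t n {c}ᶜ) :=
    disjoint_spectralPart hτ hn disjoint_compl_right
  have hcodisj : Codisjoint (spectralPart Φ t n {c}) (spectralPart Φ t n {c}ᶜ) := by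
    refine codisjoint_iff.2 (top_le_iff.1 (htop.ge.trans (iSup₂_le fun ν hν => ?_)))
    by_cases h : ((Units.mk0 ν hν : ℂˣ) : ℂˣ ⧸ Subgroup.zpowers (qpow τ 1)) = c
    · exact (hle hν h).trans le_sup_left
    · exact (hle hν h).trans le_sup_right
  refine ⟨c, (hind.eq_top_or_eq_top hΦ (fun _ => apply_mem_spectralPart hΦ)
    (fun _ => apply_mem_spectralPart hΦ) ⟨hdisj, hcodisj⟩).resolve_right fun h => hne ?_⟩
  rw [h, disjoint_top] at hdisj
  exact le_bot_iff.1 ((hle hμ (A := {c}) rfl).trans_eq hdisj)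

theorem IsIndecomposable.eq_maxGenEigenspace_or_eq_maxGenEigenspace (hind : IsIndecomposable Φ)
    (hτ : 0 < τ.im) (hΦ : Function.Injective Φ) (hcop : IsCoprime t (n : ℤ)) (hn : n ≠ 0) {lam : ℂ}
    (hlam : lam ≠ 0) (htop : translateSpan Φ n ((slopeOperator Φ t n).maxGenEigenspace lam) = ⊤)
    {U W : Submodule ℂ M} (hU : ∀ x ∈ U, slopeOperator Φ t n x ∈ U)
    (hW : ∀ x ∈ W, slopeOperator Φ t n x ∈ W) (hUW : Disjoint U W)
    (hsup : U ⊔ W = (slopeOperator Φ t n).maxGenEigenspace lam) :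
    U = (slopeOperator Φ t n).maxGenEigenspace lam ∨
      W = (slopeOperator Φ t n).maxGenEigenspace lam := by
  have hdisj := disjoint_translateSpan hτ hΦ hcop hlam (hsup.symm ▸ le_sup_left)
    (hsup.symm ▸ le_sup_right) hUW
  have hcodisj : Codisjoint (translateSpan Φ n U) (translateSpan Φ n W) :=
    codisjoint_iff.2 (top_le_iff.1 (by rw [← htop, ← hsup]; exact translateSpan_sup_le))
  have hbot {P : Submodule ℂ M} (h : translateSpan Φ n P = ⊥) : P = ⊥ :=
    (Submodule.eq_bot_iff P).2 fun x hx => (Submodule.mem_bot K).1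
      (h ▸ complexEnd_pow_mem_translateSpan (Nat.pos_of_ne_zero hn) hx)
  rcases hind.eq_top_or_eq_top hΦ (fun _ => apply_mem_translateSpan hU)
    (fun _ => apply_mem_translateSpan hW) ⟨hdisj, hcodisj⟩ with h | h
  · rw [h, top_disjoint] at hdisj
    rw [hbot hdisj, sup_bot_eq] at hsup
    exact Or.inl hsup
  · rw [h, disjoint_top] at hdisj
    rw [hbot hdisj, bot_sup_eq] at hsup
    exact Or.inr hsup

end Splitting

section JordanGenerators

variable {τ : ℂ} {M : Type*} [AddCommGroup M] [Module K M] [Module ℂ M] [IsScalarTower ℂ K M]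
  {N : Type*} [AddCommGroup N] [Module K N] [Module ℂ N] [IsScalarTower ℂ K N]

/-- The vectors `Φ ^ i (T - λ) ^ j v` for `T = z ^ (-t) Φ ^ n`. -/
def jordanVec (Φ : M →ₛₗ[φ τ] M) (t : ℤ) (n : ℕ) (lam : ℂ) (v : M) (i j : ℕ) : M :=
  (complexEnd Φ ^ i) (((slopeOperator Φ t n - lam • 1) ^ j) v)

/-- `v` is killed by `(T - λ) ^ m`, where `T = z ^ (-t) Φ ^ n`, and the vectors
`Φ ^ i (T - λ) ^ j v` with `i < n` and `j < m` are a basis of `M`. This determines `(M, Φ)` up to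
isomorphism. -/
structure IsJordanGenerator (Φ : M →ₛₗ[φ τ] M) (t : ℤ) (n : ℕ) (lam : ℂ) (m : ℕ) (v : M) :
    Prop where
  pow_eq_zero : ((slopeOperator Φ t n - lam • 1) ^ m) v = 0
  linearIndependent :
    LinearIndependent K fun ij : Fin n × Fin m => jordanVec Φ t n lam v ij.1 ij.2
  span_eq_top :
    Submodule.span K (Set.range fun ij : Fin n × Fin m => jordanVec Φ t n lam v ij.1 ij.2) = ⊤

variable {Φ : M →ₛₗ[φ τ] M} {Ψ : N →ₛₗ[φ τ] N} {t : ℤ} {n : ℕ} {lam : ℂ} {m : ℕ} {v : M}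

theorem IsIndecomposable.exists_isJordanGenerator (hind : IsIndecomposable Φ) (hτ : 0 < τ.im)
    (hΦ : IsDifferenceModule Φ) (hcop : IsCoprime t (n : ℤ)) (hn : n ≠ 0) (hlam : lam ≠ 0)
    (htop : translateSpan Φ n ((slopeOperator Φ t n).maxGenEigenspace lam) = ⊤) :
    ∃ m v, 1 ≤ m ∧ IsJordanGenerator Φ t n lam m v := by
  have := hΦ.1
  have := hind.1
  have := (finite_maxGenEigenspace hτ hΦ.2.1 hcop hn hlam).1
  have : Nontrivial ((slopeOperator Φ t n).maxGenEigenspace lam) :=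
    Submodule.nontrivial_iff_ne_bot.2 fun h => bot_ne_top (top_le_iff.1 (htop.ge.trans
      (translateSpan_le.2 fun i _ x hx => by simp [(Submodule.mem_bot ℂ).1 (h ▸ hx)])))
  obtain ⟨m, v, hv, hne, hspan⟩ := exists_span_chain_eq_maxGenEigenspace fun U W =>
    hind.eq_maxGenEigenspace_or_eq_maxGenEigenspace hτ hΦ.2.1 hcop hn hlam htop
  refine ⟨m, v, Nat.one_le_iff_ne_zero.2 ?_, hv, ?_, ?_⟩
  · rintro rfl
    exact hne hv
  · exact linearIndependent_complexEnd_pow hτ hΦ.2.1 hcop hlam (linearIndependent_chain hv hne)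
      fun j => hspan ▸ Submodule.subset_span ⟨j, rfl⟩
  · rw [← htop, ← hspan, translateSpan_span_range]
    rfl

theorem map_jordanVec {e : M ≃ₗ[K] N} (he : ∀ x, e (Φ x) = Ψ (e x)) (i j : ℕ) :
    e (jordanVec Φ t n lam v i j) = jordanVec Ψ t n lam (e v) i j := by
  have hC (i : ℕ) (x : M) : e ((complexEnd Φ ^ i) x) = (complexEnd Ψ ^ i) (e x) := by
    rw [complexEnd_pow_apply, complexEnd_pow_apply]
    exact (Function.Semiconj.iterate_right (f := e) he i).eq x
  have hT : Function.Semiconj e (slopeOperator Φ t n - lam • 1 : Module.End ℂ M)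
      (slopeOperator Ψ t n - lam • 1 : Module.End ℂ N) := fun x => by
    change e (slopeOperator Φ t n x - lam • x) = slopeOperator Ψ t n (e x) - lam • e x
    rw [map_sub, slopeOperator_apply, map_smul, hC, slopeOperator_apply,
      ← algebraMap_smul K lam x, map_smul, algebraMap_smul]
  rw [jordanVec, jordanVec, hC, Module.End.coe_pow (_ - _), (hT.iterate_right j).eq,
    ← Module.End.coe_pow]

theorem IsJordanGenerator.map {e : M ≃ₗ[K] N} (he : ∀ x, e (Φ x) = Ψ (e x))
    (h : IsJordanGenerator Φ t n lam m v) : IsJordanGenerator Ψ t n lam m (e v) where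
  pow_eq_zero := by
    simpa [jordanVec, h.pow_eq_zero] using
      (map_jordanVec (t := t) (n := n) (lam := lam) (v := v) he 0 m).symm
  linearIndependent := by
    simpa only [Function.comp_def, LinearEquiv.coe_coe, map_jordanVec he] using
      h.linearIndependent.map' (e : M →ₗ[K] N) e.ker
  span_eq_top := by
    have := congrArg (Submodule.map (e : M →ₗ[K] N)) h.span_eq_top
    rw [Submodule.map_span, ← Set.range_comp, Submodule.map_top, LinearEquiv.range] at this
    simpa only [Function.comp_def, LinearEquiv.coe_coe, map_jordanVec he] using this

theorem apply_jordanVec (i j : ℕ) :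
    Φ (jordanVec Φ t n lam v i j) = jordanVec Φ t n lam v (i + 1) j := by
  rw [jordanVec, jordanVec, complexEnd_pow_succ_apply]

theorem jordanVec_last (j : ℕ) : jordanVec Φ t n lam v n j =
    monomial t (1 : ℂ) • (jordanVec Φ t n lam v 0 (j + 1) + lam • jordanVec Φ t n lam v 0 j) := by
  simp only [jordanVec, pow_zero, Module.End.one_apply]
  rw [complexEnd_pow_eq_smul_slopeOperator Φ t n, apply_sub_smul_one_pow_apply]

theorem slopeOperator_jordanVec (i j : ℕ) : slopeOperator Φ t n (jordanVec Φ t n lam v i j) =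
    (qpow τ 1 : ℂ) ^ (t * i) •
      (jordanVec Φ t n lam v i (j + 1) + lam • jordanVec Φ t n lam v i j) := by
  simp only [jordanVec]
  rw [slopeOperator_complexEnd_pow, apply_sub_smul_one_pow_apply, map_add,
    map_smul (complexEnd Φ ^ i)]

theorem complexEnd_pow_apply_mem {V : Submodule K M} (hV : ∀ x ∈ V, Φ x ∈ V) (i : ℕ) {x : M}
    (hx : x ∈ V) : (complexEnd Φ ^ i) x ∈ V :=
  Module.End.pow_apply_mem_of_forall_mem (p := V.restrictScalars ℂ) (f' := complexEnd Φ) i hV x hx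

theorem slopeOperator_apply_mem {V : Submodule K M} (hV : ∀ x ∈ V, Φ x ∈ V) {x : M}
    (hx : x ∈ V) : slopeOperator Φ t n x ∈ V :=
  V.smul_mem _ (complexEnd_pow_apply_mem hV n hx)

namespace IsJordanGenerator

variable (h : IsJordanGenerator Φ t n lam m v)
include h

theorem jordanVec_eq_zero (i : ℕ) {j : ℕ} (hj : m ≤ j) : jordanVec Φ t n lam v i j = 0 := by
  rw [jordanVec, Module.End.pow_map_zero_of_le hj h.pow_eq_zero, map_zero]

/-- The basis `Φ ^ i (T - λ) ^ j v` of the module generated by a Jordan generator `v`. -/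
def basis : Module.Basis (Fin n × Fin m) K M :=
  Module.Basis.mk h.linearIndependent h.span_eq_top.ge

theorem basis_apply (ij : Fin n × Fin m) : h.basis ij = jordanVec Φ t n lam v ij.1 ij.2 :=
  Module.Basis.mk_apply _ _ _

theorem finrank_eq : Module.finrank K M = n * m := by
  simp [Module.finrank_eq_card_basis h.basis]

theorem pow_pred_ne_zero (hn : n ≠ 0) (hm : m ≠ 0) :
    ((slopeOperator Φ t n - lam • 1) ^ (m - 1)) v ≠ 0 := by
  simpa [jordanVec] using
    h.linearIndependent.ne_zero (⟨0, Nat.pos_of_ne_zero hn⟩, ⟨m - 1, Nat.sub_one_lt hm⟩)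

theorem iso {w : N} (h' : IsJordanGenerator Ψ t n lam m w) : Iso Φ Ψ := by
  let e := h.basis.equiv h'.basis (Equiv.refl _)
  have he (i : ℕ) (hi : i < n) (j : ℕ) :
      e (jordanVec Φ t n lam v i j) = jordanVec Ψ t n lam w i j := by
    rcases lt_or_ge j m with hj | hj
    · have := h.basis.equiv_apply (⟨i, hi⟩, ⟨j, hj⟩) h'.basis (Equiv.refl _)
      rwa [basis_apply, Equiv.refl_apply, basis_apply] at this
    · rw [h.jordanVec_eq_zero _ hj, h'.jordanVec_eq_zero _ hj, map_zero]
  have hsucc (i : ℕ) (hi : i < n) (j : ℕ) :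
      e (jordanVec Φ t n lam v (i + 1) j) = jordanVec Ψ t n lam w (i + 1) j := by
    rcases lt_or_eq_of_le (Nat.succ_le_of_lt hi) with hi' | rfl
    · exact he _ hi' j
    · rw [jordanVec_last, jordanVec_last, map_smul, map_add, ← algebraMap_smul K lam, map_smul,
        he 0 (Nat.succ_pos i), he 0 (Nat.succ_pos i), algebraMap_smul]
  refine ⟨e, fun x => ?_⟩
  rw [← h.basis.sum_repr x]
  simp only [map_sum, map_smulₛₗ, RingHom.id_apply]
  refine Finset.sum_congr rfl fun ij _ => ?_
  rw [h.basis_apply, he _ ij.1.2, apply_jordanVec, apply_jordanVec, hsucc _ ij.1.2]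

theorem eq_top_of_mem {V : Submodule K M} (hV : ∀ x ∈ V, Φ x ∈ V) (hv : v ∈ V) : V = ⊤ := by
  rw [← top_le_iff, ← h.span_eq_top, Submodule.span_le]
  rintro _ ⟨ij, rfl⟩
  refine complexEnd_pow_apply_mem hV _
    (Module.End.pow_apply_mem_of_forall_mem (p := V.restrictScalars ℂ) _ (fun x hx => ?_) v hv)
  exact (V.restrictScalars ℂ).sub_mem (slopeOperator_apply_mem hV hx)
    ((V.restrictScalars ℂ).smul_mem lam hx)

theorem mem_maxGenEigenspace : v ∈ (slopeOperator Φ t n).maxGenEigenspace lam :=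
  ((slopeOperator Φ t n).mem_maxGenEigenspace lam v).2 ⟨m, h.pow_eq_zero⟩

theorem isIndecomposable (hτ : 0 < τ.im) (hΦ : Function.Injective Φ) (hcop : IsCoprime t (n : ℤ))
    (hn : n ≠ 0) (hm : m ≠ 0) (hlam : lam ≠ 0) : IsIndecomposable Φ := by
  have := Module.Finite.of_basis h.basis
  obtain ⟨hfin, hrank⟩ := finite_maxGenEigenspace hτ hΦ hcop hn hlam
  have hne := h.pow_pred_ne_zero hn hm
  refine ⟨⟨_, _, hne⟩, fun V W hV hW hVW => ?_⟩
  rw [h.finrank_eq] at hrank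
  have hcompl : IsCompl (V.restrictScalars ℂ) (W.restrictScalars ℂ) :=
    hVW.map (Submodule.restrictScalarsLatticeHom ℂ K M)
  exact (maxGenEigenspace_le_or_le h.pow_eq_zero hne
    (Nat.le_of_mul_le_mul_left hrank (Nat.pos_of_ne_zero hn))
    (fun _ => slopeOperator_apply_mem fun x => (hV x).2)
    (fun _ => slopeOperator_apply_mem fun x => (hW x).2) hcompl).imp
    (fun hle => h.eq_top_of_mem (fun x => (hV x).2) (hle h.mem_maxGenEigenspace))
    (fun hle => h.eq_top_of_mem (fun x => (hW x).2) (hle h.mem_maxGenEigenspace))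

theorem spectralPart_eq_top (hΦ : Function.Injective Φ) (hlam : lam ≠ 0) :
    spectralPart Φ t n {(Units.mk0 lam hlam : ℂˣ ⧸ Subgroup.zpowers (qpow τ 1))} = ⊤ :=
  h.eq_top_of_mem (fun _ => apply_mem_spectralPart hΦ) (Submodule.mem_iSup_of_mem
    (Units.mk0 lam hlam) (Submodule.mem_iSup_of_mem rfl
      (Submodule.subset_span h.mem_maxGenEigenspace)))

theorem coe_eq_coe [Nontrivial M] (hτ : 0 < τ.im) (hΦ : Function.Injective Φ) (hn : n ≠ 0)
    {lam' : ℂ} {m' : ℕ} {v' : M} (h' : IsJordanGenerator Φ t n lam' m' v') (hlam : lam ≠ 0)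
    (hlam' : lam' ≠ 0) : (Units.mk0 lam hlam : ℂˣ ⧸ Subgroup.zpowers (qpow τ 1)) =
      Units.mk0 lam' hlam' := by
  by_contra hne
  have hdisj := disjoint_spectralPart (Φ := Φ) (t := t) hτ hn (Set.disjoint_singleton.2 hne)
  rw [h.spectralPart_eq_top hΦ, h'.spectralPart_eq_top hΦ, disjoint_self] at hdisj
  exact top_ne_bot hdisj

theorem inLattice_slopeOperator_basis (ij : Fin n × Fin m) :
    InLattice h.basis 0 (slopeOperator Φ t n (h.basis ij)) := by
  obtain ⟨i, j⟩ := ij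
  have hmem (k : ℕ) : InLattice h.basis 0 (jordanVec Φ t n lam v i k) := by
    rcases lt_or_ge k m with hk | hk
    · exact h.basis_apply (i, ⟨k, hk⟩) ▸ inLattice_basis _
    · rw [h.jordanVec_eq_zero _ hk]
      exact fun l _ => vcoef_zero _ l
  rw [h.basis_apply, slopeOperator_jordanVec]
  exact ((hmem _).add ((hmem _).smul lam)).smul _

theorem mul_le_mul_of_isJordanGenerator {t' : ℤ} {n' : ℕ} {lam' : ℂ} {m' : ℕ} {v' : M}
    (h' : IsJordanGenerator Φ t' n' lam' m' v') (hn' : n' ≠ 0) (hm' : m' ≠ 0) (hlam' : lam' ≠ 0) :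
    t * n' ≤ t' * n := by
  by_contra! hlt
  have hne := h'.pow_pred_ne_zero hn' hm'
  set u := ((slopeOperator Φ t' n' - lam' • 1) ^ (m' - 1)) v'
  have hu : slopeOperator Φ t' n' u = lam' • u := by
    rw [apply_sub_smul_one_pow_apply, Nat.sub_add_cancel (Nat.one_le_iff_ne_zero.2 hm'),
      h'.pow_eq_zero, zero_add]
  obtain ⟨c, hc, hcu⟩ := exists_slopeOperator_pow_apply_eq Φ t n t' n' u
  have hev : (slopeOperator Φ t' n').HasEigenvector lam' u :=
    ⟨Module.End.mem_eigenspace_iff.2 hu, hne⟩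
  rw [hev.pow_apply, ← algebraMap_smul K (lam' ^ n) u, algebraMap_eq, smul_smul,
    monomial_mul_monomial, add_zero] at hcu
  exact hne ((isDilationSemilinear_slopeOperator Φ t n).eq_zero_of_pow_apply_eq_smul
    h.inLattice_slopeOperator_basis (by lia) (mul_ne_zero hc (pow_ne_zero n hlam')) hcu)

end IsJordanGenerator

end JordanGenerators

section Purity

open Polynomial (expand)

/-- The operator `∑ a_k z ^ (t (m - k)) Φ ^ (n k)`, `0 ≤ k ≤ m`. All the points of its Newton
polygon lie on a line of slope `-t / n`. -/
def slopePolynomial (t : ℤ) (n m : ℕ) (a : ℕ → ℂ) : Polynomial K :=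
  expand K n (∑ k ∈ Finset.range (m + 1), Polynomial.monomial k (monomial (t * (m - k)) (a k)))

variable {t : ℤ} {n m : ℕ} {a : ℕ → ℂ}

theorem coeff_slopePolynomial (hn : 0 < n) (i : ℕ) : (slopePolynomial t n m a).coeff i =
    if n ∣ i ∧ i / n ≤ m then monomial (t * (m - (i / n : ℕ))) (a (i / n)) else 0 := by
  simp only [slopePolynomial, Polynomial.coeff_expand hn, Polynomial.finsetSum_coeff,
    Polynomial.coeff_monomial, Finset.sum_ite_eq', Finset.mem_range, Nat.lt_succ_iff, ite_and]

theorem coeff_slopePolynomial_mul (hn : 0 < n) {k : ℕ} (hk : k ≤ m) :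
    (slopePolynomial t n m a).coeff (n * k) = monomial (t * (m - k)) (a k) := by
  rw [coeff_slopePolynomial hn, Nat.mul_div_cancel_left k hn, if_pos ⟨dvd_mul_right n k, hk⟩]

theorem natDegree_slopePolynomial (hn : 0 < n) (ha : a m ≠ 0) :
    (slopePolynomial t n m a).natDegree = n * m := by
  refine Polynomial.natDegree_eq_of_le_of_coeff_ne_zero ?_ ?_
  · rw [slopePolynomial, Polynomial.natDegree_expand, mul_comm n]
    refine Nat.mul_le_mul_right n (Polynomial.natDegree_sum_le_of_forall_le _ _ fun k hk => ?_)
    exact (Polynomial.natDegree_monomial_le _).trans (Finset.mem_range_succ_iff.1 hk)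
  · rw [coeff_slopePolynomial_mul hn le_rfl]
    exact monomial_ne_zero _ ha

theorem ord_coeff_slopePolynomial_add (hn : 0 < n) {i : ℕ}
    (hi : i ∈ (slopePolynomial t n m a).support) :
    (ord ((slopePolynomial t n m a).coeff i) : ℚ) + t / n * i = t * m := by
  rw [Polynomial.mem_support_iff, coeff_slopePolynomial hn] at hi
  rw [coeff_slopePolynomial hn]
  split_ifs at hi ⊢ with h
  · obtain ⟨⟨k, rfl⟩, -⟩ := h
    rw [Nat.mul_div_cancel_left k hn] at hi ⊢
    have hak : a k ≠ 0 := fun h0 => hi (coef_ext fun l => by simp [coef_monomial, coef_zero, h0])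
    rw [ord_monomial _ hak]
    push_cast
    field_simp
    ring
  · exact absurd rfl hi

theorem existsUnique_isSlope {L : Polynomial K} {s b : ℚ} (h0 : L.coeff 0 ≠ 0)
    (hd : 0 < L.natDegree) (h : ∀ i ∈ L.support, ord (L.coeff i) + s * i = b) :
    ∃! s, IsSlope L s := by
  have hL : L.natDegree ∈ L.support :=
    Polynomial.natDegree_mem_support_of_nonzero (Polynomial.ne_zero_of_natDegree_gt hd)
  have h0 : 0 ∈ L.support := Polynomial.mem_support_iff.2 h0
  refine ⟨s, ⟨0, h0, _, hL, hd, (h 0 h0).trans (h _ hL).symm, fun k hk =>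
    ((h 0 h0).trans (h k hk).symm).le⟩, fun s' ⟨i, hi, j, hj, hij, heq, _⟩ => ?_⟩
  have hij : (j : ℚ) - i ≠ 0 := sub_ne_zero.2 (by exact_mod_cast hij.ne')
  exact mul_right_cancel₀ hij (by linear_combination (h i hi).trans (h j hj).symm - heq)

variable {τ : ℂ} {M : Type*} [AddCommGroup M] [Module K M] {Φ : M →ₛₗ[φ τ] M} {v : M}

theorem sum_coeff_slopePolynomial_smul :
    ∑ i ∈ Finset.range ((slopePolynomial t n m a).natDegree + 1),
        (slopePolynomial t n m a).coeff i • Φ^[i] v =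
      ∑ k ∈ Finset.range (m + 1), monomial (t * (m - k)) (a k) • Φ^[n * k] v := by
  have hsum (p : Polynomial K) : ∑ i ∈ Finset.range (p.natDegree + 1), p.coeff i • Φ^[i] v =
      Polynomial.lsum (fun i => LinearMap.toSpanSingleton K M (Φ^[i] v)) p := by
    simp [Polynomial.lsum, Polynomial.sum_over_range]
  rw [hsum]
  simp [slopePolynomial, Polynomial.lsum, Polynomial.sum_monomial_index, mul_comm n]

theorem isPure_of_sum_eq_zero (hn : 0 < n) (hm : 0 < m) (h0 : a 0 ≠ 0) (ha : a m = 1)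
    (hrank : Module.finrank K M = n * m)
    (hspan : Submodule.span K (Set.range fun i : Fin (n * m) => Φ^[i] v) = ⊤)
    (hrel : ∑ k ∈ Finset.range (m + 1), monomial (t * (m - k)) (a k) • Φ^[n * k] v = 0) :
    IsPure Φ := by
  have hm0 : a m ≠ 0 := ha ▸ one_ne_zero
  have hdeg := natDegree_slopePolynomial (t := t) hn hm0
  have hL0 : (slopePolynomial t n m a).coeff 0 ≠ 0 := by
    rw [← mul_zero n, coeff_slopePolynomial_mul hn (Nat.zero_le m)]
    exact monomial_ne_zero _ h0
  refine ⟨slopePolynomial t n m a, ⟨?_, hL0, v, ?_, ?_, ?_⟩, existsUnique_isSlope hL0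
    (hdeg ▸ Nat.mul_pos hn hm) fun i => ord_coeff_slopePolynomial_add hn⟩
  · rw [Polynomial.Monic, Polynomial.leadingCoeff, hdeg, coeff_slopePolynomial_mul hn le_rfl, ha,
      sub_self, mul_zero, monomial_zero_one]
  · rw [hdeg]
    exact linearIndependent_of_top_le_span_of_card_eq_finrank hspan.ge (by simp [hrank])
  · rw [hdeg, hspan]
  · rw [sum_coeff_slopePolynomial_smul, hrel]

theorem sub_smul_one_pow_apply {V : Type*} [AddCommGroup V] [Module ℂ V] (T : Module.End ℂ V)
    (lam : ℂ) (j : ℕ) (x : V) : ((T - lam • 1) ^ j) x =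
      ∑ k ∈ Finset.range (j + 1), ((-lam) ^ (j - k) * (j.choose k : ℂ)) • (T ^ k) x := by
  have hcomm : Commute T ((-lam) • 1) := (Commute.one_right T).smul_right _
  rw [sub_eq_add_neg, ← neg_smul, hcomm.add_pow, LinearMap.sum_apply]
  refine Finset.sum_congr rfl fun k _ => ?_
  rw [smul_pow, one_pow, mul_smul_comm, mul_one, ← (Nat.cast_commute _ _).eq, ← nsmul_eq_mul,
    LinearMap.smul_apply, LinearMap.smul_apply, ← Nat.cast_smul_eq_nsmul ℂ, smul_smul, mul_comm]

variable [Module ℂ M] [IsScalarTower ℂ K M] {lam : ℂ}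

theorem IsJordanGenerator.span_iterate_eq_top (h : IsJordanGenerator Φ t n lam m v) :
    Submodule.span K (Set.range fun i : Fin (n * m) => Φ^[i] v) = ⊤ := by
  set P := Submodule.span K (Set.range fun i : Fin (n * m) => Φ^[i] v)
  have hmem (i : Fin n) {k : ℕ} (hk : k < m) :
      (complexEnd Φ ^ (i : ℕ)) ((slopeOperator Φ t n ^ k) v) ∈ P := by
    rw [slopeOperator_pow_apply, isDilationSemilinear_complexEnd_pow, ← Module.End.mul_apply,
      ← pow_add, complexEnd_pow_apply]
    refine P.smul_mem _ (Submodule.subset_span ⟨⟨i + n * k, ?_⟩, rfl⟩)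
    calc i + n * k < n + n * k := Nat.add_lt_add_right i.2 _
      _ = n * (k + 1) := by ring
      _ ≤ n * m := Nat.mul_le_mul_left n hk
  rw [eq_top_iff, ← h.span_eq_top, Submodule.span_le]
  rintro _ ⟨⟨i, j⟩, rfl⟩
  change jordanVec Φ t n lam v i j ∈ P
  rw [jordanVec, sub_smul_one_pow_apply, map_sum]
  refine P.sum_mem fun k hk => ?_
  rw [map_smul, ← algebraMap_smul K]
  exact P.smul_mem _ (hmem i ((Finset.mem_range_succ_iff.1 hk).trans_lt j.2))

theorem IsJordanGenerator.isPure (h : IsJordanGenerator Φ t n lam m v) (hlam : lam ≠ 0)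
    (hn : 0 < n) (hm : 0 < m) : IsPure Φ := by
  let γ (k : ℕ) : ℂ := ∏ l ∈ Finset.range k, (qpow τ 1 : ℂ) ^ (-(n * t * l))
  have hγ (k : ℕ) : γ k ≠ 0 :=
    Finset.prod_ne_zero_iff.2 fun _ _ => zpow_ne_zero _ (Units.ne_zero _)
  have hrel := congrArg (monomial (t * m) (γ m)⁻¹ • ·) h.pow_eq_zero
  simp only [smul_zero, sub_smul_one_pow_apply, slopeOperator_pow_apply, Finset.smul_sum] at hrel
  refine isPure_of_sum_eq_zero (t := t)
    (a := fun k => (γ m)⁻¹ * ((-lam) ^ (m - k) * (m.choose k : ℂ) * γ k)) hn hm ?_ ?_ h.finrank_eq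
    h.span_iterate_eq_top (hrel ▸ Finset.sum_congr rfl fun k _ => ?_)
  · simp [hγ, hlam]
  · simp [hγ]
  · rw [← complexEnd_pow_apply, ← algebraMap_smul K (_ * _) (_ : M), algebraMap_eq, smul_smul,
      smul_smul, monomial_mul_monomial, monomial_mul_monomial, add_zero, ← sub_eq_add_neg, mul_sub,
      mul_assoc (γ m)⁻¹]

end Purity

section KnBasis

variable {n : ℕ+}

theorem monomialKn_mul (j k : ℤ) (a b : ℂ) :
    monomialKn n j a * monomialKn n k b = monomialKn n (j + k) (a * b) :=
  monomial_mul_monomial j k a b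

theorem φn_monomialKn (τ : ℂ) (k : ℤ) (a : ℂ) :
    φn τ n (monomialKn n k a) = monomialKn n k ((qpow τ ((n : ℂ)⁻¹) : ℂ) ^ k * a) :=
  dilate_monomial _ k a

theorem monomial_smul_monomialKn (l k : ℤ) (a b : ℂ) :
    monomial l a • monomialKn n k b = monomialKn n (n * l + k) (a * b) := by
  have h : toKn n (monomial l a) = monomialKn n (n * l) a := Subtype.ext HahnSeries.embDomain_single
  rw [← monomialKn_mul, ← h]
  rfl

theorem coef_smul_monomialKn (g : K) (a j : ℤ) : coef (g • monomialKn n a 1 : Kn n) j =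
    if (n : ℤ) ∣ j - a then coef g ((j - a) / n) else 0 := by
  have h : coef (g • monomialKn n a 1 : Kn n) j = (substPow n g).coeff (j - a) := by
    rw [Algebra.smul_def, mul_comm]
    exact (coef_monomial_mul a 1 _ j).trans (one_mul _)
  rw [h]
  split_ifs with hd
  · obtain ⟨k, hk⟩ := hd
    rw [hk, coeff_substPow_mul, Int.mul_ediv_cancel_left _ (by exact_mod_cast n.ne_zero)]
    rfl
  · exact coeff_substPow_of_not_dvd n _ _ hd

theorem exists_coef_eq_coef_add_mul (f : K) (a : ℤ) {d : ℕ} (hd : d ≠ 0) :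
    ∃ g : K, ∀ k, coef g k = coef f (a + d * k) := by
  obtain ⟨C, r, hC, hr, hb⟩ := (isConvergent_iff _).1 f.2
  have hbdd : BddBelow (Function.support fun k : ℤ => coef f (a + d * k)) := by
    refine ⟨-|ord f - a|, fun k hk => ?_⟩
    have hle : ord f ≤ a + d * k := not_lt.1 fun h => hk (coef_eq_zero_of_lt_ord h)
    by_contra! hlt
    have hd1 : (1 : ℤ) ≤ d := by lia
    nlinarith [neg_abs_le (ord f - a), abs_nonneg (ord f - a)]
  refine ⟨⟨HahnSeries.ofSuppBddBelow _ hbdd, (isConvergent_iff _).2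
    ⟨C * r ^ a, r ^ d, by positivity, by positivity, fun k => (hb _).trans_eq ?_⟩⟩, fun k => rfl⟩
  rw [zpow_add₀ hr.ne', zpow_mul, zpow_natCast, mul_assoc]

theorem existsUnique_dvd_sub {d : ℕ} (hd : d ≠ 0) (j : ℤ) :
    ∃! a : Fin d, (d : ℤ) ∣ j - (a : ℕ) := by
  obtain ⟨a, l, h⟩ := exists_eq_mul_add_mul (isCoprime_one_left (x := (d : ℤ))) hd j
  have ha : (d : ℤ) ∣ j - (a : ℕ) := ⟨l, by rw [h]; ring⟩
  refine ⟨a, ha, fun b hb => Fin.ext (Nat.ModEq.eq_of_lt_of_lt ?_ b.2 a.2)⟩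
  exact Int.natCast_modEq_iff.1 ((Int.modEq_iff_dvd.2 hb).trans (Int.modEq_iff_dvd.2 ha).symm)

theorem coef_sum_smul_monomialKn (g : Fin n → K) (a : Fin n) (k : ℤ) :
    coef (∑ b, g b • monomialKn n (b : ℕ) 1 : Kn n) ((a : ℕ) + n * k) = coef (g a) k := by
  have hdvd : (n : ℤ) ∣ (a : ℕ) + n * k - (a : ℕ) := ⟨k, add_sub_cancel_left _ _⟩
  refine (coef_sum _ (fun b : Fin n => (g b • monomialKn n (b : ℕ) 1 : Kn n)) _).trans ?_
  rw [Finset.sum_eq_single a (fun b _ hb => ?_) (by simp)]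
  · rw [coef_smul_monomialKn, if_pos hdvd, add_sub_cancel_left,
      Int.mul_ediv_cancel_left _ (by exact_mod_cast n.ne_zero)]
  · rw [coef_smul_monomialKn,
      if_neg fun h => hb ((existsUnique_dvd_sub n.ne_zero _).unique h hdvd)]

variable (n)

theorem linearIndependent_monomialKn :
    LinearIndependent K fun a : Fin n => monomialKn n (a : ℕ) 1 := by
  refine Fintype.linearIndependent_iff.2 fun g hg a => coef_ext fun k => ?_
  rw [← coef_sum_smul_monomialKn, hg]
  rfl

theorem span_range_monomialKn :
    Submodule.span K (Set.range fun a : Fin n => monomialKn n (a : ℕ) 1) = ⊤ := by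
  refine eq_top_iff.2 fun f _ => ?_
  choose g hg using fun a : Fin n => exists_coef_eq_coef_add_mul f (a : ℕ) n.ne_zero
  suffices f = ∑ a : Fin n, g a • monomialKn n (a : ℕ) 1 from
    this ▸ Submodule.sum_mem _ fun a _ => Submodule.smul_mem _ _ (Submodule.subset_span ⟨a, rfl⟩)
  refine coef_ext fun j => ?_
  obtain ⟨a, ⟨k, hk⟩, -⟩ := existsUnique_dvd_sub n.ne_zero j
  rw [← add_eq_of_eq_sub' hk.symm]
  exact ((coef_sum_smul_monomialKn g a k).trans (hg a k)).symm

/-- The `K`-basis `1, z ^ (1 / n), …, z ^ ((n - 1) / n)` of `K_n`. -/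
def basisKn : Module.Basis (Fin n) K (Kn n) :=
  .mk (linearIndependent_monomialKn n) (span_range_monomialKn n).ge

theorem basisKn_apply (a : Fin n) : basisKn n a = monomialKn n (a : ℕ) 1 :=
  Module.Basis.mk_apply _ _ a

instance : Module.Finite K (Kn n) := .of_basis (basisKn n)

end KnBasis

section ShiftMatrix

variable {m : ℕ}

/-- The matrix with ones on the first superdiagonal. -/
def shiftMatrix (m : ℕ) : Matrix (Fin m) (Fin m) ℂ :=
  Matrix.of fun i j => if (i : ℕ) + 1 = j then 1 else 0

theorem shiftMatrix_pow_apply (k : ℕ) (i j : Fin m) :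
    (shiftMatrix m ^ k) i j = if (i : ℕ) + k = j then 1 else 0 := by
  induction k generalizing i with
  | zero => simp [Matrix.one_apply, Fin.ext_iff]
  | succ k ih =>
    rw [pow_succ', Matrix.mul_apply]
    by_cases hi : (i : ℕ) + 1 < m
    · rw [Finset.sum_eq_single ⟨i + 1, hi⟩ (fun l _ hl => ?_) (by simp)]
      · rw [ih]
        simp [shiftMatrix, add_assoc, add_comm 1]
      · simp [shiftMatrix, Fin.ext_iff.not.1 hl.symm]
    · rw [if_neg (by lia), Finset.sum_eq_zero fun l _ => ?_]
      simp [shiftMatrix, show (i : ℕ) + 1 ≠ l by lia]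

theorem shiftMatrix_pow_self : shiftMatrix m ^ m = 0 := by
  ext i j
  rw [shiftMatrix_pow_apply, if_neg (by lia), Matrix.zero_apply]

theorem shiftMatrix_pow_pred_ne_zero (hm : m ≠ 0) : shiftMatrix m ^ (m - 1) ≠ 0 := fun h => by
  have := congrFun₂ h ⟨0, by lia⟩ ⟨m - 1, by lia⟩
  simp [shiftMatrix_pow_apply] at this

theorem isUnit_one_add_shiftMatrix : IsUnit (1 + shiftMatrix m) :=
  IsNilpotent.isUnit_one_add ⟨m, shiftMatrix_pow_self⟩

theorem unipotentMatrix_eq : unipotentMatrix m = (1 + shiftMatrix m).map (algebraMap ℂ K) := by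
  ext i j : 1
  by_cases h : i = j
  · simp [unipotentMatrix, shiftMatrix, h]
  · simp [unipotentMatrix, shiftMatrix, h, apply_ite]

theorem exists_one_add_pow_sub_one_pow_eq {A : Type*} [Ring A] (s : A) (n k : ℕ) :
    ∃ w, ((1 + s) ^ n - 1) ^ k = (n : A) ^ k * s ^ k + w * s ^ (k + 1) := by
  suffices ∃ w, ((1 + .X) ^ n - 1) ^ k =
      (n : Polynomial ℤ) ^ k * .X ^ k + w * .X ^ (k + 1) by
    obtain ⟨w, hw⟩ := this
    exact ⟨Polynomial.aeval s w, by simpa using congrArg (Polynomial.aeval s) hw⟩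
  obtain ⟨g, hg⟩ := sq_dvd_add_pow_sub_sub (.X : Polynomial ℤ) 1 n
  obtain ⟨w, hw⟩ := sub_dvd_pow_sub_pow (n + .X * g) (n : Polynomial ℤ) k
  have h : (1 + .X : Polynomial ℤ) ^ n - 1 = .X * (n + .X * g) := by
    rw [one_pow, one_pow] at hg
    linear_combination hg
  refine ⟨g * w, ?_⟩
  rw [h, mul_pow]
  linear_combination .X ^ k * hw

theorem one_add_shiftMatrix_pow_sub_one_pow_self (n : ℕ) :
    ((1 + shiftMatrix m) ^ n - 1) ^ m = 0 := by
  obtain ⟨w, hw⟩ := exists_one_add_pow_sub_one_pow_eq (shiftMatrix m) n m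
  rw [hw, pow_succ, shiftMatrix_pow_self, zero_mul, mul_zero, mul_zero, add_zero]

theorem one_add_shiftMatrix_pow_sub_one_pow_pred_ne_zero {n : ℕ} (hn : n ≠ 0) (hm : m ≠ 0) :
    ((1 + shiftMatrix m) ^ n - 1) ^ (m - 1) ≠ 0 := by
  obtain ⟨w, hw⟩ := exists_one_add_pow_sub_one_pow_eq (shiftMatrix m) n (m - 1)
  rw [hw, Nat.sub_add_cancel (Nat.one_le_iff_ne_zero.2 hm), shiftMatrix_pow_self, mul_zero,
    add_zero, ← Nat.cast_pow, ← nsmul_eq_mul, ← Nat.cast_smul_eq_nsmul ℂ]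
  exact smul_ne_zero (Nat.cast_ne_zero.2 (pow_ne_zero _ hn)) (shiftMatrix_pow_pred_ne_zero hm)

theorem exists_span_mulVec_chain_eq_top {n : ℕ} (hn : n ≠ 0) (hm : m ≠ 0) :
    ∃ y : Fin m → ℂ, Submodule.span ℂ (Set.range fun j : Fin m =>
      (((1 + shiftMatrix m) ^ n - 1) ^ (j : ℕ)).mulVec y) = ⊤ := by
  obtain ⟨y, hy⟩ : ∃ y, (((1 + shiftMatrix m) ^ n - 1) ^ (m - 1)).mulVec y ≠ 0 := by
    by_contra! h
    exact one_add_shiftMatrix_pow_sub_one_pow_pred_ne_zero hn hm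
      (Matrix.ext_of_mulVec_single fun j => by rw [h, Matrix.zero_mulVec])
  have hli := linearIndependent_chain (m := m)
    (N := Matrix.toLin' ((1 + shiftMatrix m) ^ n - 1)) (v := y)
    (by rw [← Matrix.toLin'_pow, one_add_shiftMatrix_pow_sub_one_pow_self, map_zero,
      LinearMap.zero_apply]) (by rwa [← Matrix.toLin'_pow, Matrix.toLin'_apply])
  refine ⟨y, ?_⟩
  simpa only [← Matrix.toLin'_pow, Matrix.toLin'_apply] using
    hli.span_eq_top_of_card_eq_finrank' (by simp)

end ShiftMatrix

theorem injective_of_surjective_of_semilinear {k V : Type*} [Field k] [AddCommGroup V] [Module k V]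
    [Module.Finite k V] {σ : k →+* k} (f : V →ₛₗ[σ] V) (hf : Function.Surjective f) :
    Function.Injective f := by
  let b := Module.finBasis k V
  have hspan : ⊤ ≤ Submodule.span k (Set.range (f ∘ b)) := fun x _ => by
    obtain ⟨y, rfl⟩ := hf x
    rw [← b.sum_repr y, map_sum]
    refine Submodule.sum_mem _ fun i _ => ?_
    rw [map_smulₛₗ]
    exact Submodule.smul_mem _ _ (Submodule.subset_span ⟨i, rfl⟩)
  have hli := linearIndependent_of_top_le_span_of_card_eq_finrank hspan (by simp)
  refine (injective_iff_map_eq_zero f).2 fun x hx =>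
    b.repr.map_eq_zero_iff.1 (Finsupp.ext fun i => ?_)
  rw [← b.sum_repr x, map_sum] at hx
  simp only [map_smulₛₗ] at hx
  exact (map_eq_zero σ).1 (Fintype.linearIndependent_iff.1 hli _ hx i)

section Models

theorem ΦE_surjective (τ : ℂ) (t : ℤ) (n : ℕ+) {c : ℂ} (hc : c ≠ 0) :
    Function.Surjective (ΦE τ t n c) := by
  intro f
  have h : φn τ n (dilate (qpow τ ((n : ℂ)⁻¹))⁻¹ (f * monomialKn n (-t) c⁻¹)) =
      f * monomialKn n (-t) c⁻¹ := dilate_inv_dilate _ _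
  refine ⟨dilate (qpow τ ((n : ℂ)⁻¹))⁻¹ (f * monomialKn n (-t) c⁻¹), ?_⟩
  change φn τ n _ * monomialKn n t c = f
  rw [h, mul_assoc, monomialKn_mul, neg_add_cancel, inv_mul_cancel₀ hc]
  exact mul_one f

theorem ΦU_algebraMap_comp (τ : ℂ) {m : ℕ} (y : Fin m → ℂ) :
    ΦU τ m (algebraMap ℂ K ∘ y) = algebraMap ℂ K ∘ (1 + shiftMatrix m).mulVec y := by
  change (unipotentMatrix m).mulVec (fun i => φ τ (algebraMap ℂ K (y i))) = _
  simp only [φ_apply, dilate_algebraMap]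
  rw [unipotentMatrix_eq]
  exact funext fun i => (RingHom.map_mulVec _ _ _ i).symm

theorem ΦU_surjective (τ : ℂ) (m : ℕ) : Function.Surjective (ΦU τ m) := by
  intro Y
  have hU : IsUnit (unipotentMatrix m) := by
    rw [unipotentMatrix_eq]
    exact isUnit_one_add_shiftMatrix.map (algebraMap ℂ K).mapMatrix
  obtain ⟨Z, rfl⟩ := Matrix.mulVec_surjective_iff_isUnit.2 hU Y
  refine ⟨fun i => dilate (qpow τ 1)⁻¹ (Z i), ?_⟩
  change (unipotentMatrix m).mulVec (fun i => φ τ (dilate (qpow τ 1)⁻¹ (Z i))) = _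
  simp only [φ_apply, dilate_inv_dilate]

theorem ΦEU_surjective (τ : ℂ) (t : ℤ) (n : ℕ+) {c : ℂ} (hc : c ≠ 0) (m : ℕ) :
    Function.Surjective (ΦEU τ t n c m) := by
  intro x
  induction x using TensorProduct.induction_on with
  | zero => exact ⟨0, map_zero _⟩
  | tmul f Y =>
    obtain ⟨f, rfl⟩ := ΦE_surjective τ t n hc f
    obtain ⟨Y, rfl⟩ := ΦU_surjective τ m Y
    exact ⟨f ⊗ₜ Y, rfl⟩
  | add x y hx hy =>
    obtain ⟨x, rfl⟩ := hx
    obtain ⟨y, rfl⟩ := hy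
    exact ⟨x + y, map_add _ _ _⟩

theorem isDifferenceModule_ΦEU (τ : ℂ) (t : ℤ) (n : ℕ+) {c : ℂ} (hc : c ≠ 0) (m : ℕ) :
    IsDifferenceModule (ΦEU τ t n c m) :=
  have hsurj := ΦEU_surjective τ t n hc m
  ⟨inferInstance, injective_of_surjective_of_semilinear _ hsurj, hsurj⟩

variable (τ : ℂ) (t : ℤ) (n : ℕ+) (c : ℂ) (m : ℕ)

/-- The scalar `a` such that `Φ ^ i 1 = a z ^ (t i / n)` in `E(c z^{t/n})`. -/
def chainScalar (i : ℕ) : ℂ := c ^ i * ∏ l ∈ Finset.range i, (qpow τ ((n : ℂ)⁻¹) : ℂ) ^ (t * l)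

variable {c} in
theorem chainScalar_ne_zero (hc : c ≠ 0) (i : ℕ) : chainScalar τ t n c i ≠ 0 :=
  mul_ne_zero (pow_ne_zero _ hc) (Finset.prod_ne_zero_iff.2 fun _ _ =>
    zpow_ne_zero _ (Units.ne_zero _))

theorem chainScalar_eq_pow_mul (i : ℕ) :
    chainScalar τ t n c i = c ^ i * chainScalar τ t n 1 i := by
  rw [chainScalar, chainScalar, one_pow, one_mul]

variable [Module ℂ (Kn n ⊗[K] (Fin m → K))] [IsScalarTower ℂ K (Kn n ⊗[K] (Fin m → K))]

/-- The vectors `z ^ (k / n) ⊗ y` with `y ∈ ℂ ^ m`. -/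
def constTensor (k : ℤ) : (Fin m → ℂ) →ₗ[ℂ] Kn n ⊗[K] (Fin m → K) where
  toFun y := monomialKn n k 1 ⊗ₜ (algebraMap ℂ K ∘ y)
  map_add' y z := by
    rw [← TensorProduct.tmul_add]
    exact congrArg _ (funext fun i => map_add _ _ _)
  map_smul' a y := by
    rw [RingHom.id_apply, ← algebraMap_smul K a (_ ⊗ₜ[K] _), ← TensorProduct.tmul_smul]
    exact congrArg _ (funext fun i => map_mul _ _ _)

theorem monomial_smul_constTensor (l k : ℤ) (y : Fin m → ℂ) :
    monomial l (1 : ℂ) • constTensor n m k y = constTensor n m (n * l + k) y := by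
  change monomial l (1 : ℂ) • (monomialKn n k 1 ⊗ₜ[K] (algebraMap ℂ K ∘ y)) = _
  rw [TensorProduct.smul_tmul', monomial_smul_monomialKn, one_mul]
  rfl

theorem ΦEU_constTensor (k : ℤ) (y : Fin m → ℂ) : ΦEU τ t n c m (constTensor n m k y) =
    ((qpow τ ((n : ℂ)⁻¹) : ℂ) ^ k * c) •
      constTensor n m (k + t) ((1 + shiftMatrix m).mulVec y) := by
  change (φn τ n (monomialKn n k 1) * monomialKn n t c) ⊗ₜ ΦU τ m (algebraMap ℂ K ∘ y) =
    _ • (monomialKn n (k + t) 1 ⊗ₜ[K] _)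
  rw [φn_monomialKn, monomialKn_mul, ΦU_algebraMap_comp, ← algebraMap_smul K (_ * _) (_ ⊗ₜ[K] _),
    TensorProduct.smul_tmul', algebraMap_eq, monomial_smul_monomialKn, mul_zero, zero_add, mul_one,
    mul_one]

theorem complexEnd_pow_constTensor (i : ℕ) (y : Fin m → ℂ) :
    (complexEnd (ΦEU τ t n c m) ^ i) (constTensor n m 0 y) =
      chainScalar τ t n c i • constTensor n m (t * i) (((1 + shiftMatrix m) ^ i).mulVec y) := by
  induction i with
  | zero => simp [chainScalar]
  | succ i ih =>
    rw [pow_succ', Module.End.mul_apply, ih, map_smul, complexEnd_apply, ΦEU_constTensor,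
      smul_smul, Matrix.mulVec_mulVec, ← pow_succ', chainScalar, chainScalar,
      Finset.prod_range_succ, Nat.cast_succ, mul_add_one]
    congr 1
    ring

theorem slopeOperator_constTensor (y : Fin m → ℂ) :
    slopeOperator (ΦEU τ t n c m) t n (constTensor n m 0 y) =
      chainScalar τ t n c n • constTensor n m 0 (((1 + shiftMatrix m) ^ (n : ℕ)).mulVec y) := by
  rw [slopeOperator_apply, complexEnd_pow_constTensor, smul_comm, monomial_smul_constTensor,
    mul_neg, mul_comm, neg_add_cancel]

theorem sub_smul_one_pow_constTensor (j : ℕ) (y : Fin m → ℂ) :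
    ((slopeOperator (ΦEU τ t n c m) t n - chainScalar τ t n c n • 1) ^ j) (constTensor n m 0 y) =
      chainScalar τ t n c n ^ j •
        constTensor n m 0 ((((1 + shiftMatrix m) ^ (n : ℕ) - 1) ^ j).mulVec y) := by
  induction j with
  | zero => simp
  | succ j ih =>
    rw [pow_succ', Module.End.mul_apply, ih, map_smul, LinearMap.sub_apply,
      slopeOperator_constTensor, LinearMap.smul_apply, Module.End.one_apply, ← smul_sub, ← map_sub,
      smul_smul, ← pow_succ, pow_succ' (_ - 1), ← Matrix.mulVec_mulVec, Matrix.sub_mulVec,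
      Matrix.one_mulVec]

theorem jordanVec_constTensor (i j : ℕ) (y : Fin m → ℂ) :
    jordanVec (ΦEU τ t n c m) t n (chainScalar τ t n c n) (constTensor n m 0 y) i j =
      (chainScalar τ t n c n ^ j * chainScalar τ t n c i) • constTensor n m (t * i)
        (((1 + shiftMatrix m) ^ i).mulVec
          ((((1 + shiftMatrix m) ^ (n : ℕ) - 1) ^ j).mulVec y)) := by
  rw [jordanVec, sub_smul_one_pow_constTensor, map_smul, complexEnd_pow_constTensor, smul_smul]

variable {n m}

theorem eq_top_of_constTensor_mem {P : Submodule K (Kn n ⊗[K] (Fin m → K))}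
    (h : ∀ k y, constTensor n m k y ∈ P) : P = ⊤ := by
  rw [eq_top_iff, ← ((basisKn n).tensorProduct (Pi.basisFun K (Fin m))).span_eq, Submodule.span_le]
  rintro _ ⟨⟨a, i⟩, rfl⟩
  have hsingle : algebraMap ℂ K ∘ Pi.single i 1 = Pi.single i 1 :=
    funext fun j => by simp [Pi.single_apply, apply_ite]
  rw [Module.Basis.tensorProduct_apply, basisKn_apply, Pi.basisFun_apply, ← hsingle]
  exact h a (Pi.single i 1)

variable {τ t c}

theorem constTensor_mem {P : Submodule K (Kn n ⊗[K] (Fin m → K))} {y : Fin m → ℂ}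
    (hy : Submodule.span ℂ (Set.range fun j : Fin m =>
      (((1 + shiftMatrix m) ^ (n : ℕ) - 1) ^ (j : ℕ)).mulVec y) = ⊤) (hc : c ≠ 0)
    (hP : ∀ (i : Fin n) (j : Fin m),
      jordanVec (ΦEU τ t n c m) t n (chainScalar τ t n c n) (constTensor n m 0 y) i j ∈ P)
    (hcop : IsCoprime t (n : ℤ)) (k : ℤ) (x : Fin m → ℂ) : constTensor n m k x ∈ P := by
  obtain ⟨i, l, rfl⟩ := exists_eq_mul_add_mul hcop n.ne_zero k
  rw [← monomial_smul_constTensor]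
  refine P.smul_mem _ ?_
  obtain ⟨x, rfl⟩ := Matrix.mulVec_surjective_iff_isUnit.2
    ((isUnit_one_add_shiftMatrix (m := m)).pow (i : ℕ)) x
  have hle : Submodule.span ℂ (Set.range fun j : Fin m =>
      (((1 + shiftMatrix m) ^ (n : ℕ) - 1) ^ (j : ℕ)).mulVec y) ≤
      (P.restrictScalars ℂ).comap
        (constTensor n m (t * (i : ℕ)) ∘ₗ ((1 + shiftMatrix m) ^ (i : ℕ)).mulVecLin) := by
    rw [Submodule.span_le]
    rintro _ ⟨j, rfl⟩
    have hij := hP i j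
    rw [jordanVec_constTensor] at hij
    exact ((P.restrictScalars ℂ).smul_mem_iff (mul_ne_zero
      (pow_ne_zero _ (chainScalar_ne_zero τ t n hc n)) (chainScalar_ne_zero τ t n hc i))).1 hij
  exact hle (hy ▸ Submodule.mem_top)

theorem exists_isJordanGenerator_ΦEU (hcop : IsCoprime t (n : ℤ)) (hc : c ≠ 0)
    (hm : m ≠ 0) : ∃ v, IsJordanGenerator (ΦEU τ t n c m) t n (chainScalar τ t n c n) m v := by
  obtain ⟨y, hy⟩ := exists_span_mulVec_chain_eq_top (m := m) n.ne_zero hm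
  have hspan := eq_top_of_constTensor_mem (constTensor_mem (τ := τ) hy hc
    (P := Submodule.span K (Set.range fun ij : Fin n × Fin m => jordanVec (ΦEU τ t n c m) t n
      (chainScalar τ t n c n) (constTensor n m 0 y) ij.1 ij.2))
    (fun i j => Submodule.subset_span ⟨(i, j), rfl⟩) hcop)
  refine ⟨constTensor n m 0 y, ?_, ?_, hspan⟩
  · rw [sub_smul_one_pow_constTensor, one_add_shiftMatrix_pow_sub_one_pow_self, Matrix.zero_mulVec,
      map_zero, smul_zero]
  · refine linearIndependent_of_top_le_span_of_card_eq_finrank hspan.ge ?_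
    rw [Module.finrank_tensorProduct, Module.finrank_eq_card_basis (basisKn n),
      Module.finrank_fin_fun, Fintype.card_prod, Fintype.card_fin, Fintype.card_fin]

end Models

section Classification

variable {τ : ℂ} {t t' : ℤ} {n n' : ℕ+} {c c' : ℂ} {m m' : ℕ}

theorem existsUnique_zpow_mul_mem_Ioc {r x : ℝ} (hr : 0 < r) (hr1 : r < 1) (hx : 0 < x) :
    ∃! k : ℤ, r ^ k * x ∈ Set.Ioc r 1 := by
  convert existsUnique_sub_zsmul_mem_Ioc (neg_pos.2 (Real.log_neg hr hr1)) (Real.log x)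
    (Real.log r) using 2 with k
  have hk : 0 < r ^ k * x := mul_pos (zpow_pos hr k) hx
  have hlog : Real.log x - k • -Real.log r = Real.log (r ^ k * x) := by
    rw [Real.log_mul (zpow_pos hr k).ne' hx.ne', Real.log_zpow, zsmul_eq_mul]
    ring
  rw [hlog, Set.mem_Ioc, Set.mem_Ioc, Real.log_lt_log_iff hr hk, add_neg_cancel,
    Real.log_nonpos_iff hk.le]

theorem admissible_iff : Admissible τ t n c ↔
    IsCoprime t (n : ℤ) ∧ ‖c ^ (n : ℕ)‖ ∈ Set.Ioc ‖(qpow τ 1 : ℂ)‖ 1 := by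
  rw [Admissible, norm_pow, Set.mem_Ioc, pow_le_one_iff_of_nonneg (norm_nonneg c) n.ne_zero,
    ← pow_lt_pow_iff_left₀ (by positivity) (norm_nonneg c) n.ne_zero,
    Real.rpow_inv_natCast_pow (norm_nonneg _) n.ne_zero]

theorem Admissible.ne_zero (h : Admissible τ t n c) : c ≠ 0 :=
  norm_pos_iff.1 (lt_of_le_of_lt (by positivity) h.2.1)

theorem Admissible.pow_eq_pow (h : Admissible τ t n c) (hτ : 0 < τ.im) (h' : Admissible τ t' n' c')
    {k : ℤ} (hk : c' ^ (n' : ℕ) = (qpow τ 1 : ℂ) ^ k * c ^ (n : ℕ)) :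
    c ^ (n : ℕ) = c' ^ (n' : ℕ) := by
  have hmem := (admissible_iff.1 h').2
  rw [hk, norm_mul, norm_zpow] at hmem
  have hk0 : k = 0 := (existsUnique_zpow_mul_mem_Ioc (norm_pos_iff.2 (Units.ne_zero _))
    (norm_qpow_lt_one hτ) (norm_pos_iff.2 (pow_ne_zero _ h.ne_zero))).unique hmem
    (by simpa using (admissible_iff.1 h).2)
  rw [hk, hk0, zpow_zero, one_mul]

theorem exists_admissible_chainScalar_eq (hτ : 0 < τ.im) (hcop : IsCoprime t (n : ℤ))
    (x : ℂˣ ⧸ Subgroup.zpowers (qpow τ 1)) :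
    ∃ (c : ℂ) (lam : ℂˣ),
      Admissible τ t n c ∧ chainScalar τ t n c n = lam ∧ (lam : ℂˣ ⧸ _) = x := by
  obtain ⟨μ, rfl⟩ := QuotientGroup.mk_surjective x
  have hκ : chainScalar τ t n 1 n ≠ 0 := chainScalar_ne_zero τ t n one_ne_zero n
  obtain ⟨k, hk, -⟩ := existsUnique_zpow_mul_mem_Ioc (norm_pos_iff.2 (Units.ne_zero (qpow τ 1)))
    (norm_qpow_lt_one hτ) (norm_pos_iff.2 (div_ne_zero μ.ne_zero hκ))
  obtain ⟨c, hc⟩ := IsAlgClosed.exists_pow_nat_eq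
    ((qpow τ 1 : ℂ) ^ k * (μ / chainScalar τ t n 1 n)) n.pos
  refine ⟨c, qpow τ 1 ^ k * μ, admissible_iff.2 ⟨hcop, ?_⟩, ?_, zpow_mul_eq_coe _ _ _⟩
  · rwa [hc, norm_mul, norm_zpow]
  · rw [chainScalar_eq_pow_mul, hc, mul_assoc, div_mul_cancel₀ _ hκ, Units.val_mul,
      Units.val_zpow_eq_zpow_val]

theorem isIndecomposable_isPure_ΦEU (hτ : 0 < τ.im) (hcop : IsCoprime t (n : ℤ)) (hc : c ≠ 0)
    (hm : m ≠ 0) : IsIndecomposable (ΦEU τ t n c m) ∧ IsPure (ΦEU τ t n c m) := by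
  let _ := Module.compHom (Kn n ⊗[K] (Fin m → K)) (algebraMap ℂ K)
  have : IsScalarTower ℂ K (Kn n ⊗[K] (Fin m → K)) := .of_compHom ..
  obtain ⟨v, hv⟩ := exists_isJordanGenerator_ΦEU (τ := τ) hcop hc hm
  have hlam := chainScalar_ne_zero τ t n hc n
  exact ⟨hv.isIndecomposable hτ (isDifferenceModule_ΦEU τ t n hc m).2.1 hcop n.ne_zero hm hlam,
    hv.isPure hlam n.pos (Nat.pos_of_ne_zero hm)⟩

theorem IsPresentedBy.natDegree_pos {M : Type*} [AddCommGroup M] [Module K M] [Nontrivial M]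
    {Φ : M →ₛₗ[φ τ] M} {L : Polynomial K} (hL : IsPresentedBy Φ L) : 0 < L.natDegree := by
  obtain ⟨-, -, e, -, hspan, -⟩ := hL
  by_contra! h0
  have : IsEmpty (Fin L.natDegree) := by
    rw [Nat.le_zero.1 h0]
    infer_instance
  rw [Set.range_eq_empty, Submodule.span_empty] at hspan
  exact bot_ne_top hspan

theorem exists_iso_ΦEU (hτ : 0 < τ.im) {M : Type*} [AddCommGroup M] [Module K M]
    {Φ : M →ₛₗ[φ τ] M} (hM : IsDifferenceModule Φ) (hind : IsIndecomposable Φ) (hpure : IsPure Φ) :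
    ∃ (t : ℤ) (n : ℕ+) (c : ℂ) (m : ℕ), Admissible τ t n c ∧ 1 ≤ m ∧ Iso Φ (ΦEU τ t n c m) := by
  let _ := Module.compHom M (algebraMap ℂ K)
  have : IsScalarTower ℂ K M := .of_compHom ..
  have := hind.1
  obtain ⟨L, hL, s, -, hs⟩ := hpure
  let n : ℕ+ := ⟨s.den, s.den_pos⟩
  have hcop : IsCoprime s.num ((n : ℕ) : ℤ) := Int.isCoprime_iff_nat_coprime.2 s.reduced
  obtain ⟨B, e, hB⟩ := hL.exists_isIsoclinicRelation hL.natDegree_pos hs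
  obtain ⟨x, hx⟩ := hind.exists_spectralPart_eq_top hτ hM.2.1 n.ne_zero
    (hB.iSup_eigenspan_slopeOperator_eq_top hτ hM.2.1 n.ne_zero s.mul_den_eq_num)
  obtain ⟨c, lam, hadm, hlam, rfl⟩ := exists_admissible_chainScalar_eq hτ hcop x
  rw [spectralPart_singleton hM.2 hcop n.ne_zero] at hx
  obtain ⟨m, v, hm, hv⟩ := hind.exists_isJordanGenerator hτ hM hcop n.ne_zero lam.ne_zero hx
  refine ⟨s.num, n, c, m, hadm, hm, ?_⟩
  let _ := Module.compHom (Kn n ⊗[K] (Fin m → K)) (algebraMap ℂ K)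
  have : IsScalarTower ℂ K (Kn n ⊗[K] (Fin m → K)) := .of_compHom ..
  obtain ⟨w, hw⟩ :=
    exists_isJordanGenerator_ΦEU (τ := τ) hcop hadm.ne_zero (Nat.one_le_iff_ne_zero.1 hm)
  exact hv.iso (hlam ▸ hw)

theorem data_eq_of_iso (hτ : 0 < τ.im) (hcop : IsCoprime t (n : ℤ)) (hcop' : IsCoprime t' (n' : ℤ))
    (hc : c ≠ 0) (hc' : c' ≠ 0) (hm : m ≠ 0) (hm' : m' ≠ 0)
    (hiso : Iso (ΦEU τ t n c m) (ΦEU τ t' n' c' m')) :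
    (t : ℚ) / n = (t' : ℚ) / n' ∧
      (∃ k : ℤ, c' ^ (n' : ℕ) = (qpow τ 1 : ℂ) ^ k * c ^ (n : ℕ)) ∧ m = m' := by
  let _ := Module.compHom (Kn n ⊗[K] (Fin m → K)) (algebraMap ℂ K)
  have : IsScalarTower ℂ K (Kn n ⊗[K] (Fin m → K)) := .of_compHom ..
  let _ := Module.compHom (Kn n' ⊗[K] (Fin m' → K)) (algebraMap ℂ K)
  have : IsScalarTower ℂ K (Kn n' ⊗[K] (Fin m' → K)) := .of_compHom ..
  obtain ⟨e, he⟩ := hiso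
  obtain ⟨v, hv⟩ := exists_isJordanGenerator_ΦEU (τ := τ) hcop hc hm
  obtain ⟨v', hv'⟩ := exists_isJordanGenerator_ΦEU (τ := τ) hcop' hc' hm'
  replace hv := hv.map he
  have hlam := chainScalar_ne_zero τ t n hc n
  have hlam' := chainScalar_ne_zero τ t' n' hc' n'
  have hslope : (t : ℚ) / n = t' / n' := by
    rw [div_eq_div_iff (by exact_mod_cast n.ne_zero) (by exact_mod_cast n'.ne_zero)]
    exact_mod_cast (hv.mul_le_mul_of_isJordanGenerator hv' n'.ne_zero hm' hlam').antisymm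
      (hv'.mul_le_mul_of_isJordanGenerator hv n.ne_zero hm hlam)
  obtain ⟨rfl, hn⟩ := Rat.div_int_inj (by exact_mod_cast n.pos) (by exact_mod_cast n'.pos)
    (Int.isCoprime_iff_gcd_eq_one.1 hcop) (Int.isCoprime_iff_gcd_eq_one.1 hcop') hslope
  obtain rfl : n = n' := PNat.coe_injective (Int.natCast_inj.1 hn)
  have := (isIndecomposable_isPure_ΦEU hτ hcop' hc' hm').1.1
  obtain ⟨k, hk⟩ := Subgroup.mem_zpowers_iff.1 (QuotientGroup.eq_iff_div_mem.1
    (hv'.coe_eq_coe hτ (isDifferenceModule_ΦEU τ t n hc' m').2.1 n.ne_zero hv hlam' hlam))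
  refine ⟨rfl, ⟨k, ?_⟩,
    Nat.eq_of_mul_eq_mul_left n.pos (hv.finrank_eq.symm.trans hv'.finrank_eq)⟩
  have hk' := congrArg Units.val (eq_div_iff_mul_eq'.1 hk)
  simp only [Units.val_mul, Units.val_zpow_eq_zpow_val, Units.val_mk0] at hk'
  rw [chainScalar_eq_pow_mul τ t n c, chainScalar_eq_pow_mul τ t n c', ← mul_assoc] at hk'
  exact (mul_right_cancel₀ (chainScalar_ne_zero τ t n one_ne_zero n) hk').symm

end Classification

end QDiff

end

theorem theorem3p5_general (τ : ℂ) (hτ : 0 < τ.im) :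
    (∀ (t : ℤ) (n : ℕ+) (c : ℂ) (m : ℕ), IsCoprime t (n : ℤ) → c ≠ 0 → 1 ≤ m →
      QDiff.IsDifferenceModule (QDiff.ΦEU τ t n c m) ∧
      QDiff.IsIndecomposable (QDiff.ΦEU τ t n c m) ∧
      QDiff.IsPure (QDiff.ΦEU τ t n c m)) ∧
    (∀ (M : Type*) [AddCommGroup M] [Module QDiff.K M] (Φ : M →ₛₗ[QDiff.φ τ] M),
      QDiff.IsDifferenceModule Φ → QDiff.IsIndecomposable Φ → QDiff.IsPure Φ →
      ∃ (t : ℤ) (n : ℕ+) (c : ℂ) (m : ℕ), QDiff.Admissible τ t n c ∧ 1 ≤ m ∧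
        QDiff.Iso Φ (QDiff.ΦEU τ t n c m)) ∧
    (∀ (t t' : ℤ) (n n' : ℕ+) (c c' : ℂ) (m m' : ℕ),
      IsCoprime t (n : ℤ) → IsCoprime t' (n' : ℤ) → c ≠ 0 → c' ≠ 0 → 1 ≤ m → 1 ≤ m' →
      QDiff.Iso (QDiff.ΦEU τ t n c m) (QDiff.ΦEU τ t' n' c' m') →
      (t : ℚ) / n = (t' : ℚ) / n' ∧
        (∃ k : ℤ, c' ^ (n' : ℕ) = (QDiff.qpow τ 1 : ℂ) ^ k * c ^ (n : ℕ)) ∧ m = m') :=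
  ⟨fun _ _ _ _ hcop hc hm => ⟨QDiff.isDifferenceModule_ΦEU _ _ _ hc _,
      QDiff.isIndecomposable_isPure_ΦEU hτ hcop hc (Nat.one_le_iff_ne_zero.1 hm)⟩,
    fun _ _ _ _ => QDiff.exists_iso_ΦEU hτ,
    fun _ _ _ _ _ _ _ _ hcop hcop' hc hc' hm hm' => QDiff.data_eq_of_iso hτ hcop hcop' hc hc'
      (Nat.one_le_iff_ne_zero.1 hm) (Nat.one_le_iff_ne_zero.1 hm')⟩

theorem theorem3p5 (τ : ℂ) (hτ : 0 < τ.im) :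
    -- the modules `E(c z^{t/n}) ⊗ U_m` are indecomposable pure difference modules
    (∀ (t : ℤ) (n : ℕ+) (c : ℂ) (m : ℕ), QDiff.Admissible τ t n c → 1 ≤ m →
      QDiff.IsDifferenceModule (QDiff.ΦEU τ t n c m) ∧
      QDiff.IsIndecomposable (QDiff.ΦEU τ t n c m) ∧
      QDiff.IsPure (QDiff.ΦEU τ t n c m)) ∧
    -- every indecomposable pure difference module is isomorphic to one of them
    (∀ (M : Type*) [AddCommGroup M] [Module QDiff.K M] (Φ : M →ₛₗ[QDiff.φ τ] M),
      QDiff.IsDifferenceModule Φ → QDiff.IsIndecomposable Φ → QDiff.IsPure Φ →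
      ∃ (t : ℤ) (n : ℕ+) (c : ℂ) (m : ℕ), QDiff.Admissible τ t n c ∧ 1 ≤ m ∧
        QDiff.Iso Φ (QDiff.ΦEU τ t n c m)) ∧
    -- the triple `(t/n, c^n, m)` is determined by the module
    (∀ (t t' : ℤ) (n n' : ℕ+) (c c' : ℂ) (m m' : ℕ),
      QDiff.Admissible τ t n c → QDiff.Admissible τ t' n' c' → 1 ≤ m → 1 ≤ m' →
      QDiff.Iso (QDiff.ΦEU τ t n c m) (QDiff.ΦEU τ t' n' c' m') →
      (t : ℚ) / n = (t' : ℚ) / n' ∧ c ^ (n : ℕ) = c' ^ (n' : ℕ) ∧ m = m') := by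
  obtain ⟨hmodel, hexists, hunique⟩ := theorem3p5_general τ hτ
  exact ⟨fun t n c m h => hmodel t n c m h.1 h.ne_zero, hexists,
    fun t t' n n' c c' m m' h h' hm hm' hiso =>
      (hunique t t' n n' c c' m m' h.1 h'.1 h.ne_zero h'.ne_zero hm hm' hiso).imp_right
        (.imp_left fun ⟨_, hk⟩ => h.pow_eq_pow hτ h' hk)⟩
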